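/- Let $\mathcal G=([m],E)$ be a finite undirected graph, let $\mathcal S^+_{\mathcal G}$ be the cone of real symmetric positive definite $m\times m$ matrices $K$ with $K_{ij}=0$ whenever $i\ne j$ and $\{i,j\}\notin E$, and let $\mathrm{GL}_m(\mathbb R)$ act on symmetric matrices by $g\cdot K=g^{-T}Kg^{-1}$. Write $N(i)$ for the set of neighbours of $i$ in $\mathcal G$. Define a pre-order on $[m]$ by $i\preccurlyeq j$ if and only if $N(j)\cup\{j\}\subseteq N(i)\cup\{i\}$, let $i\sim j$ mean that $i\preccurlyeq j$ and $j\preccurlyeq i$, let $\bar i$ be the equivalence class of $i$, and write $\bar i\preccurlyeq\bar j$ if $i\preccurlyeq j$; this is a partial order on $[m]/\!\sim$. Let $\widetilde{\mathcal G}$ be the graph with vertex set $[m]/\!\sim$ in which two distinct classes are adjacent if and only if they have representatives that are adjacent in $\mathcal G$. Let $$G^0=\{g\in \mathrm{GL}_m(\mathbb R)\mid g_{ij}=0 \text{ for all } j\not\preccurlyeq i\},$$ which is a subgroup of $\mathrm{GL}_m(\mathbb R)$, and for each class $\bar i$ put $$n_{\bar i}=\max\Bigl\{0,\ |\bar i|-\sum_{\bar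 j}|\bar j|\Bigr\},$$ where the sum runs over all neighbours $\bar j$ of $\bar i$ in $\widetilde{\mathcal G}$ with $\bar i\not\preccurlyeq\bar j$ and $\bar j\not\preccurlyeq\bar i$. Then the following holds for a generic $K\in\mathcal S^+_{\mathcal G}$, that is, there is a polynomial $p$ in the matrix entries, not vanishing identically on $\mathcal S^+_{\mathcal G}$, such that it holds for every $K\in\mathcal S^+_{\mathcal G}$ with $p(K)\neq 0$: the stabilizer $G^0_K=\{g\in G^0\mid g\cdot K=K\}$ has dimension (as a Lie group, i.e. the dimension of its Lie algebra) $$\dim G^0_K=\sum_{\bar i\in[m]/\sim}\binom{n_{\bar i}}{2}.$$ Moreover, the identity component of $G^0_K$, which is the same set for the Euclidean and for the Zariski topology, is isomorphic as a topological group to the product $\prod_{\bar i\in[m]/\sim}\mathrm{SO}(n_{\bar i})$ of special orthogonal groups. -/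

import Mathlib

open scoped ContDiff

noncomputable section

namespace GGM

variable {m : ℕ}

/-! ### The cone of concentration matrices and the action of the general linear group -/

/-- The cone of positive definite symmetric matrices whose off-diagonal `(i, j)` entry vanishes
whenever `{i, j}` is not an edge of the graph. -/
def concentrationCone (𝒢 : SimpleGraph (Fin m)) : Set (Matrix (Fin m) (Fin m) ℝ) :=
  {K | K.PosDef ∧ ∀ i j, i ≠ j → ¬ 𝒢.Adj i j → K i j = 0}

/-- The action `g · K = g⁻ᵀ K g⁻¹` of `GL_m(ℝ)` on matrices. -/
def act (g : GL (Fin m) ℝ) (K : Matrix (Fin m) (Fin m) ℝ) : Matrix (Fin m) (Fin m) ℝ :=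
  (g⁻¹ : GL (Fin m) ℝ).val.transpose * K * (g⁻¹ : GL (Fin m) ℝ).val

theorem act_one (K : Matrix (Fin m) (Fin m) ℝ) : act 1 K = K := by
  simp [act]

theorem act_mul (g h : GL (Fin m) ℝ) (K : Matrix (Fin m) (Fin m) ℝ) :
    act (g * h) K = act g (act h K) := by
  simp only [act, mul_inv_rev, Units.val_mul, Matrix.transpose_mul, Matrix.mul_assoc]

/-! ### The pre-order on the vertices -/

/-- The pre-order on vertices: `i ≼ j` iff `N(j) ∪ {j} ⊆ N(i) ∪ {i}`. -/
def vle (𝒢 : SimpleGraph (Fin m)) (i j : Fin m) : Prop :=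
  insert j (𝒢.neighborSet j) ⊆ insert i (𝒢.neighborSet i)

theorem vle_refl (𝒢 : SimpleGraph (Fin m)) (i : Fin m) : vle 𝒢 i i := subset_rfl

theorem vle_trans {𝒢 : SimpleGraph (Fin m)} {i j k : Fin m} (h₁ : vle 𝒢 i j) (h₂ : vle 𝒢 j k) :
    vle 𝒢 i k := h₂.trans h₁

/-! ### The group `G⁰` -/

/-- The algebra of all matrices `g` with `g i j = 0` whenever `j ⋠ i`. -/
def patternAlgebra (𝒢 : SimpleGraph (Fin m)) : Subalgebra ℝ (Matrix (Fin m) (Fin m) ℝ) where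
  carrier := {g | ∀ i j, ¬ vle 𝒢 j i → g i j = 0}
  mul_mem' := by
    intro a b ha hb i j hij
    rw [Matrix.mul_apply]
    refine Finset.sum_eq_zero fun k _ => ?_
    by_cases h : vle 𝒢 k i
    · have : ¬ vle 𝒢 j k := fun h' => hij (vle_trans h' h)
      rw [hb k j this, mul_zero]
    · rw [ha i k h, zero_mul]
  add_mem' := by
    intro a b ha hb i j hij
    rw [Matrix.add_apply, ha i j hij, hb i j hij, add_zero]
  algebraMap_mem' := by
    intro r i j hij
    have : i ≠ j := by
      rintro rfl
      exact hij (vle_refl 𝒢 i)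
    simp [Matrix.algebraMap_matrix_apply, this]

theorem inv_mem_patternAlgebra (𝒢 : SimpleGraph (Fin m)) (g : GL (Fin m) ℝ)
    (hg : g.val ∈ patternAlgebra 𝒢) : (g⁻¹ : GL (Fin m) ℝ).val ∈ patternAlgebra 𝒢 := by
  let L : patternAlgebra 𝒢 →ₗ[ℝ] patternAlgebra 𝒢 := LinearMap.mulLeft ℝ ⟨g.val, hg⟩
  have hinj : Function.Injective L := by
    intro a b hab
    have h : g.val * a.val = g.val * b.val := congrArg Subtype.val hab
    exact Subtype.ext (g.isUnit.mul_left_cancel h)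
  obtain ⟨b, hb⟩ := LinearMap.injective_iff_surjective.mp hinj 1
  have h : g.val * b.val = 1 := congrArg Subtype.val hb
  have : (g⁻¹ : GL (Fin m) ℝ).val = b.val := Units.inv_eq_of_mul_eq_one_right h
  rw [this]
  exact b.property

/-- The group `G⁰ = {g ∈ GL_m(ℝ) | g i j = 0 for all j ⋠ i}`. -/
def G0 (𝒢 : SimpleGraph (Fin m)) : Subgroup (GL (Fin m) ℝ) where
  carrier := {g | ∀ i j, ¬ vle 𝒢 j i → g.val i j = 0}
  mul_mem' := fun {_ _} ha hb => (patternAlgebra 𝒢).mul_mem ha hb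
  one_mem' := (patternAlgebra 𝒢).one_mem
  inv_mem' := fun {g} hg => inv_mem_patternAlgebra 𝒢 g hg

/-- The stabilizer of the matrix `K` in the group `G⁰`. -/
def G0Stabilizer (𝒢 : SimpleGraph (Fin m)) (K : Matrix (Fin m) (Fin m) ℝ) :
    Subgroup (GL (Fin m) ℝ) where
  carrier := {g | g ∈ G0 𝒢 ∧ act g K = K}
  mul_mem' := by
    rintro a b ⟨ha, ha'⟩ ⟨hb, hb'⟩
    exact ⟨mul_mem ha hb, by rw [act_mul, hb', ha']⟩
  one_mem' := ⟨one_mem _, act_one K⟩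
  inv_mem' := by
    rintro g ⟨hg, hg'⟩
    refine ⟨inv_mem hg, ?_⟩
    have h := act_mul g⁻¹ g K
    rw [hg', inv_mul_cancel, act_one] at h
    exact h.symm

/-! ### The quotient graph and the numbers `n` -/

/-- Vertices `i`, `j` are equivalent if `i ≼ j` and `j ≼ i`. -/
def vertexSetoid (𝒢 : SimpleGraph (Fin m)) : Setoid (Fin m) where
  r i j := vle 𝒢 i j ∧ vle 𝒢 j i
  iseqv :=
    { refl := fun i => ⟨vle_refl 𝒢 i, vle_refl 𝒢 i⟩
      symm := fun h => ⟨h.2, h.1⟩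
      trans := fun h₁ h₂ => ⟨vle_trans h₁.1 h₂.1, vle_trans h₂.2 h₁.2⟩ }

/-- The set of equivalence classes of vertices. -/
def VertexClass (𝒢 : SimpleGraph (Fin m)) : Type := Quotient (vertexSetoid 𝒢)

/-- The equivalence class of a vertex. -/
def toClass (𝒢 : SimpleGraph (Fin m)) (i : Fin m) : VertexClass 𝒢 :=
  Quotient.mk (vertexSetoid 𝒢) i

instance (𝒢 : SimpleGraph (Fin m)) : Finite (VertexClass 𝒢) :=
  Finite.of_surjective (toClass 𝒢) Quotient.mk_surjective

instance (𝒢 : SimpleGraph (Fin m)) : Fintype (VertexClass 𝒢) := Fintype.ofFinite _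

/-- The partial order on classes, with `toClass 𝒢 i ≤ toClass 𝒢 j` iff `i ≼ j`. -/
instance (𝒢 : SimpleGraph (Fin m)) : PartialOrder (VertexClass 𝒢) where
  le := Quotient.lift₂ (vle 𝒢) fun _ _ _ _ h₁ h₂ => propext
    ⟨fun h => vle_trans h₁.2 (vle_trans h h₂.1), fun h => vle_trans h₁.1 (vle_trans h h₂.2)⟩
  le_refl a := Quotient.inductionOn a (vle_refl 𝒢)
  le_trans a b c := Quotient.inductionOn₃ a b c fun _ _ _ h₁ h₂ => vle_trans h₁ h₂
  le_antisymm a b := Quotient.inductionOn₂ a b fun _ _ h₁ h₂ => Quotient.sound ⟨h₁, h₂⟩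

theorem toClass_le_toClass (𝒢 : SimpleGraph (Fin m)) (i j : Fin m) :
    toClass 𝒢 i ≤ toClass 𝒢 j ↔ vle 𝒢 i j := Iff.rfl

/-- The number of vertices in a class. -/
def classSize (𝒢 : SimpleGraph (Fin m)) (a : VertexClass 𝒢) : ℕ :=
  Nat.card {i : Fin m // toClass 𝒢 i = a}

/-- The quotient graph on the set of classes: distinct classes are adjacent iff they have adjacent
representatives. -/
def quotientGraph (𝒢 : SimpleGraph (Fin m)) : SimpleGraph (VertexClass 𝒢) where
  Adj a b := a ≠ b ∧ ∃ i j, toClass 𝒢 i = a ∧ toClass 𝒢 j = b ∧ 𝒢.Adj i j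
  symm := ⟨fun _ _ ⟨hne, i, j, hi, hj, h⟩ => ⟨hne.symm, j, i, hj, hi, h.symm⟩⟩
  loopless := ⟨fun _ h => h.1 rfl⟩

open Classical in
/-- `n_a = max {0, |a| - ∑ |b|}`, the sum running over all neighbours `b` of `a` in the quotient
graph that are incomparable to `a`; the maximum with `0` is the truncation of the subtraction
in `ℕ`. -/
def nClass (𝒢 : SimpleGraph (Fin m)) (a : VertexClass 𝒢) : ℕ :=
  classSize 𝒢 a -
    ∑ b : VertexClass 𝒢 with (quotientGraph 𝒢).Adj a b ∧ ¬ a ≤ b ∧ ¬ b ≤ a, classSize 𝒢 b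

/-! ### Lie algebra, dimension and identity component of a closed matrix group -/

/-- The Lie algebra of a matrix group `H` (the tangent space at the identity): all velocities
`γ'(0)` of smooth curves `γ` in `GL_m(ℝ)` that run inside `H` and satisfy `γ(0) = 1`. -/
def lieAlgebra (H : Subgroup (GL (Fin m) ℝ)) : Submodule ℝ (Matrix (Fin m) (Fin m) ℝ) where
  carrier := {X | ∃ γ : ℝ → GL (Fin m) ℝ, γ 0 = 1 ∧ (∀ t, γ t ∈ H) ∧
    ∀ i j, ContDiff ℝ ∞ (fun t => (γ t).val i j) ∧
      HasDerivAt (fun t => (γ t).val i j) (X i j) 0}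
  add_mem' := by
    rintro X Y ⟨γ, hγ0, hγH, hγ⟩ ⟨δ, hδ0, hδH, hδ⟩
    refine ⟨fun t => γ t * δ t, by simp [hγ0, hδ0], fun t => mul_mem (hγH t) (hδH t),
      fun i j => ⟨?_, ?_⟩⟩
    · simp only [Units.val_mul, Matrix.mul_apply]
      exact ContDiff.sum fun k _ => (hγ i k).1.mul (hδ k j).1
    · have h := HasDerivAt.fun_sum (u := Finset.univ) fun k _ => (hγ i k).2.mul (hδ k j).2
      simp only [Units.val_mul, Matrix.mul_apply]
      refine h.congr_deriv ?_
      simp [hγ0, hδ0, Matrix.one_apply, Finset.sum_add_distrib]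
  zero_mem' := ⟨fun _ => 1, rfl, fun _ => one_mem H, fun i j =>
    ⟨contDiff_const, by simpa using hasDerivAt_const (0 : ℝ) ((1 : GL (Fin m) ℝ).val i j)⟩⟩
  smul_mem' := by
    rintro c X ⟨γ, hγ0, hγH, hγ⟩
    refine ⟨fun t => γ (c * t), by simp [hγ0], fun t => hγH _, fun i j => ⟨?_, ?_⟩⟩
    · exact (hγ i j).1.comp (contDiff_const.mul contDiff_id)
    · have h1 : HasDerivAt (fun t : ℝ => c * t) c 0 := by
        simpa using (hasDerivAt_id (0 : ℝ)).const_mul c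
      have h2 : HasDerivAt (fun t => (γ t).val i j) (X i j) (c * 0) := by
        rw [mul_zero]
        exact (hγ i j).2
      exact (h2.comp (0 : ℝ) h1).congr_deriv (by simp [mul_comm])

/-- The dimension of a closed matrix group, as a Lie group. -/
def lieDim (H : Subgroup (GL (Fin m) ℝ)) : ℕ := Module.finrank ℝ (lieAlgebra H)

/-- The value of a polynomial in the `m²` matrix entries at a matrix. -/
def evalMatrix (p : MvPolynomial (Fin m × Fin m) ℝ) (A : Matrix (Fin m) (Fin m) ℝ) : ℝ :=
  MvPolynomial.eval (fun ij => A ij.1 ij.2) p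

/-- The Zariski topology on `GL_m(ℝ)`: closed sets are defined by polynomial equations in the
matrix entries. -/
@[reducible] def zariskiGL (m : ℕ) : TopologicalSpace (GL (Fin m) ℝ) :=
  TopologicalSpace.generateFrom
    (Set.range fun p : MvPolynomial (Fin m × Fin m) ℝ => {g | evalMatrix p g.val ≠ 0})

/-- The identity component of a matrix group in the Euclidean topology. -/
def identityComponent (H : Subgroup (GL (Fin m) ℝ)) : Set (GL (Fin m) ℝ) :=
  connectedComponentIn (H : Set (GL (Fin m) ℝ)) 1

/-- The identity component of a matrix group in the Zariski topology. -/
def zariskiIdentityComponent (H : Subgroup (GL (Fin m) ℝ)) : Set (GL (Fin m) ℝ) :=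
  @connectedComponentIn (GL (Fin m) ℝ) (zariskiGL m) (H : Set (GL (Fin m) ℝ)) 1

/-- `P` holds for a generic matrix in the concentration cone: it holds for all matrices in the cone
outside the zero set of some polynomial that does not vanish identically on the cone. -/
def HoldsGenerically (𝒢 : SimpleGraph (Fin m)) (P : Matrix (Fin m) (Fin m) ℝ → Prop) : Prop :=
  ∃ p : MvPolynomial (Fin m × Fin m) ℝ,
    (∃ K ∈ concentrationCone 𝒢, evalMatrix p K ≠ 0) ∧
    ∀ K ∈ concentrationCone 𝒢, evalMatrix p K ≠ 0 → P K

end GGM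

end

/-! For `K` in the cone, a block Gram–Schmidt process inside the group `G0 𝒢` produces `h =
normalizer 𝒢 K` such that the form `M = hᵀ K h` vanishes between strictly comparable vertices. Since
closed neighbourhoods shrink as one goes up in the pre-order, `M` can couple two distinct classes
only if they are adjacent and incomparable ("side neighbours"). Conjugation by `h` turns the
stabilizer of `K` into that of `M`. By positive definiteness an element of `G0 𝒢` preserving `M` is
block diagonal with respect to the classes (`isBlock_of_isometry`).

Such a block isometry `g` also preserves the block diagonal part `A` of `M`. Hence it commutes with
`A⁻¹ M` and with the `A`-self-adjoint operators on a class `a` that pass through another class `b`.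
If `b` is a side neighbour with `|a| ≤ |b|`, then for generic `K` this operator has a cyclic vector
on `a`. Then `g` restricted to `a` is a polynomial in it, so it is both orthogonal and self-adjoint,
hence an involution, and its trace takes finitely many values (`IsBlockIsometry.trace_mem`). Call
`a` tame when such a cyclic operator exists. A class for which no such `b` exists is strictly larger
than all its side neighbours, and these are therefore tame.

Suppose that `g` is the identity on all tame classes. Commutation with `A⁻¹ M` then confines `g - 1`
to the residual spaces, the vectors supported in a class `a` and `M`-orthogonal to all other
classes; generically these have dimension `n_a` by rank and nullity. Such a `g` acts as an
orthogonal transformation on each residual space and trivially on their common orthogonal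
complement. If its determinant on every class is one, it is a product of rotations
(`IsBlockIsometry.exists_eq_frameMatrix`).

Conversely all these rotations stabilize the form, and they form a connected set because `SO(n)` is
generated by pairs of reflections. They therefore lie in the Euclidean component, which lies in the
Zariski component. Traces on tame classes and determinants on classes are polynomials with finitely
many values on the stabilizer, hence constant on the Zariski component, which brings it back inside
the rotations. All three sets coincide. A smooth curve in the stabilizer through the identity stays
in this component, so the Lie algebra is a product of spaces of skew matrices.

Genericity amounts to the nonvanishing of determinants polynomial in `K`. Each is nonzero at a
perturbation of the identity whose off-diagonal entries form a matching with distinct small weights.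
Finitely many such conditions can be met together, since a nonzero polynomial on a segment in the
cone has finitely many roots. -/

namespace GGM

/-! ### Connectedness of the special orthogonal group -/

section Reflections

variable {n : Type*} [Fintype n] [DecidableEq n]

/-- The matrix of the reflection in the hyperplane orthogonal to `u`. -/
noncomputable def reflMatrix (u : n → ℝ) : Matrix n n ℝ :=
  1 - (2 / (u ⬝ᵥ u)) • Matrix.vecMulVec u u

theorem reflMatrix_transpose (u : n → ℝ) : (reflMatrix u).transpose = reflMatrix u := by
  ext i j
  simp [reflMatrix, Matrix.vecMulVec_apply, Matrix.one_apply, eq_comm, mul_comm]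

omit [DecidableEq n] in
theorem dotProduct_self_ne_zero {u : n → ℝ} (hu : u ≠ 0) : u ⬝ᵥ u ≠ 0 := by
  simpa using hu

theorem reflMatrix_mul_self {u : n → ℝ} (hu : u ≠ 0) : reflMatrix u * reflMatrix u = 1 := by
  have h := dotProduct_self_ne_zero hu
  simp only [reflMatrix, sub_mul, mul_sub, one_mul, mul_one, Matrix.smul_mul, Matrix.mul_smul,
    Matrix.vecMulVec_mul_vecMulVec, smul_smul]
  ext i j
  simp [Matrix.vecMulVec_apply]
  field_simp
  ring

theorem det_reflMatrix {u : n → ℝ} (hu : u ≠ 0) : (reflMatrix u).det = -1 := by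
  have h := dotProduct_self_ne_zero hu
  have : reflMatrix u = 1 + Matrix.vecMulVec (-(2 / (u ⬝ᵥ u)) • u) u := by
    simp [reflMatrix, Matrix.smul_vecMulVec, sub_eq_add_neg]
  rw [this, Matrix.vecMulVec_eq Unit, Matrix.det_one_add_replicateCol_mul_replicateRow]
  simp only [dotProduct_smul, smul_eq_mul]
  field_simp
  norm_num

theorem continuousOn_reflMatrix :
    ContinuousOn (reflMatrix : (n → ℝ) → Matrix n n ℝ) {0}ᶜ := by
  unfold reflMatrix
  refine continuousOn_const.sub (ContinuousOn.smul (f := fun u : n → ℝ => 2 / (u ⬝ᵥ u)) ?_ ?_)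
  · refine continuousOn_const.div ?_ fun u hu => dotProduct_self_ne_zero hu
    simp only [dotProduct]
    fun_prop
  · refine Continuous.continuousOn ?_
    exact Continuous.matrix_vecMulVec continuous_id continuous_id

/-- The matrix of a linear isometry of Euclidean space, as a monoid homomorphism. -/
noncomputable def isometryMatrix :
    (EuclideanSpace ℝ n ≃ₗᵢ[ℝ] EuclideanSpace ℝ n) →* Matrix n n ℝ where
  toFun φ := LinearMap.toMatrix' ((WithLp.linearEquiv 2 ℝ (n → ℝ)).toLinearMap ∘ₗ
    φ.toLinearEquiv.toLinearMap ∘ₗ (WithLp.linearEquiv 2 ℝ (n → ℝ)).symm.toLinearMap)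
  map_one' := by
    rw [← LinearMap.toMatrix'_one]
    rfl
  map_mul' φ ψ := by
    rw [← LinearMap.toMatrix'_comp]
    rfl

theorem isometryMatrix_reflection (v : EuclideanSpace ℝ n) :
    isometryMatrix (Submodule.span ℝ {v})ᗮ.reflection = reflMatrix v.ofLp := by
  ext i j
  simp only [isometryMatrix, MonoidHom.coe_mk, OneHom.coe_mk]
  rw [LinearMap.toMatrix'_apply]
  simp only [LinearMap.comp_apply, LinearEquiv.coe_coe]
  simp [Submodule.reflection_orthogonal_apply, Submodule.reflection_singleton_apply, reflMatrix,
    Matrix.vecMulVec_apply, EuclideanSpace.inner_eq_star_dotProduct, EuclideanSpace.norm_sq_eq,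
    dotProduct, Matrix.one_apply]
  ring_nf

theorem exists_isometryMatrix_eq {A : Matrix n n ℝ} (hA : A.transpose * A = 1) :
    ∃ φ, isometryMatrix φ = A := by
  let f : EuclideanSpace ℝ n →ₗᵢ[ℝ] EuclideanSpace ℝ n :=
    { toLinearMap := (WithLp.linearEquiv 2 ℝ (n → ℝ)).symm.toLinearMap ∘ₗ Matrix.toLin' A ∘ₗ
        (WithLp.linearEquiv 2 ℝ (n → ℝ)).toLinearMap
      norm_map' := fun v => by
        rw [← sq_eq_sq₀ (norm_nonneg _) (norm_nonneg _), ← real_inner_self_eq_norm_sq,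
          ← real_inner_self_eq_norm_sq, EuclideanSpace.inner_eq_star_dotProduct,
          EuclideanSpace.inner_eq_star_dotProduct]
        simp only [star_trivial, LinearMap.comp_apply, LinearEquiv.coe_coe,
          WithLp.linearEquiv_apply, WithLp.linearEquiv_symm_apply, Matrix.toLin'_apply]
        simp only [AddEquiv.toEquiv_eq_coe, Equiv.toFun_as_coe, Equiv.invFun_as_coe,
          EquivLike.coe_coe, WithLp.addEquiv_apply, AddEquiv.coe_toEquiv_symm,
          WithLp.addEquiv_symm_apply]
        rw [Matrix.dotProduct_mulVec, Matrix.vecMul_mulVec, hA, Matrix.vecMul_one] }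
  refine ⟨f.toLinearIsometryEquiv rfl, ?_⟩
  exact LinearMap.toMatrix'_toLin' A

/-- This is the Cartan–Dieudonné theorem in matrix form. The reflection attached to the zero vector
is the identity and is discarded, so that every remaining factor has determinant `-1`. -/
theorem exists_list_reflMatrix {A : Matrix n n ℝ} (hA : A.transpose * A = 1) :
    ∃ l : List (n → ℝ), (∀ u ∈ l, u ≠ 0) ∧ A = (l.map reflMatrix).prod := by
  obtain ⟨φ, rfl⟩ := exists_isometryMatrix_eq hA
  obtain ⟨l, -, rfl⟩ := φ.reflections_generate_dim
  clear hA
  induction l with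
  | nil => exact ⟨[], by simp, by simp⟩
  | cons v l ih =>
    obtain ⟨l', hl', h⟩ := ih
    rw [List.map_cons, List.prod_cons, map_mul, h, isometryMatrix_reflection]
    by_cases hv : v.ofLp = 0
    · exact ⟨l', hl', by simp [hv, reflMatrix]⟩
    · exact ⟨v.ofLp :: l', by simpa [hv] using hl', by simp⟩

/-- The set of orthogonal matrices of determinant one. -/
def rotationSet (n : Type*) [Fintype n] [DecidableEq n] : Set (Matrix n n ℝ) :=
  {A | A.transpose * A = 1 ∧ A.det = 1}

/-- The products of `2k` reflections. -/
def evenProducts (n : Type*) [Fintype n] [DecidableEq n] : ℕ → Set (Matrix n n ℝ)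
  | 0 => {1}
  | k + 1 => (fun p : Matrix n n ℝ × (n → ℝ) × (n → ℝ) =>
      p.1 * (reflMatrix p.2.1 * reflMatrix p.2.2)) '' (evenProducts n k ×ˢ ({0}ᶜ ×ˢ {0}ᶜ))

theorem evenProducts_subset (k : ℕ) : evenProducts n k ⊆ rotationSet n := by
  induction k with
  | zero => rintro _ rfl; simp [rotationSet]
  | succ k ih =>
    rintro _ ⟨⟨A, u, v⟩, ⟨hA, hu, hv⟩, rfl⟩
    obtain ⟨h1, h2⟩ := ih hA
    refine ⟨?_, ?_⟩
    · simp only [Matrix.transpose_mul, reflMatrix_transpose]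
      calc _ = reflMatrix v * (reflMatrix u * (A.transpose * A) * reflMatrix u) * reflMatrix v := by
            simp only [Matrix.mul_assoc]
        _ = 1 := by rw [h1, mul_one, reflMatrix_mul_self hu, mul_one, reflMatrix_mul_self hv]
    · simp only [Matrix.det_mul]
      rw [h2, det_reflMatrix hu, det_reflMatrix hv]
      norm_num

theorem isPreconnected_evenProducts (h : 1 < Module.rank ℝ (n → ℝ)) (k : ℕ) :
    IsPreconnected (evenProducts n k) := by
  induction k with
  | zero => exact isPreconnected_singleton
  | succ k ih =>
    have h0 := (isConnected_compl_singleton_of_one_lt_rank h (0 : n → ℝ)).isPreconnected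
    refine (ih.prod (h0.prod h0)).image _ ?_
    refine continuousOn_fst.mul (ContinuousOn.mul ?_ ?_)
    · exact continuousOn_reflMatrix.comp (by fun_prop) fun p hp => hp.2.1
    · exact continuousOn_reflMatrix.comp (by fun_prop) fun p hp => hp.2.2

theorem one_mem_evenProducts [Nonempty n] (k : ℕ) : 1 ∈ evenProducts n k := by
  induction k with
  | zero => rfl
  | succ k ih =>
    have h1 : (1 : n → ℝ) ≠ 0 := one_ne_zero
    exact ⟨⟨1, 1, 1⟩, ⟨ih, h1, h1⟩, by simp [reflMatrix_mul_self h1]⟩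

theorem list_prod_mem_evenProducts (k : ℕ) (l : List (n → ℝ)) (hl : ∀ u ∈ l, u ≠ 0)
    (hk : l.length = 2 * k) : (l.map reflMatrix).prod ∈ evenProducts n k := by
  induction k generalizing l with
  | zero => simp_all [evenProducts]
  | succ k ih =>
    obtain ⟨l₁, v, rfl⟩ := (List.eq_nil_or_concat l).resolve_left (by rintro rfl; simp at hk)
    obtain ⟨l₂, u, rfl⟩ := (List.eq_nil_or_concat l₁).resolve_left (by
      rintro rfl; simp at hk; omega)
    refine ⟨⟨(l₂.map reflMatrix).prod, u, v⟩, ⟨ih l₂ (fun w hw => hl w (by simp [hw])) (by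
      simp at hk; omega), hl u (by simp), hl v (by simp)⟩, ?_⟩
    simp

/-- By determinants a rotation is a product of an even number of reflections. In dimension at least
two the nonzero vectors form a connected set, so the products of `2k` reflections do too, and all
these sets contain the identity. In dimension at most one there is a single rotation. -/
theorem isPreconnected_rotationSet : IsPreconnected (rotationSet n) := by
  rcases Nat.lt_or_ge 1 (Fintype.card n) with hn | hn
  · have : Nonempty n := Fintype.card_pos_iff.mp (by omega)
    have h : 1 < Module.rank ℝ (n → ℝ) := by
      rw [rank_fun']
      exact_mod_cast hn
    have heq : rotationSet n = ⋃ k, evenProducts n k := by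
      refine Set.Subset.antisymm ?_ (Set.iUnion_subset evenProducts_subset)
      rintro A ⟨hA, hdet⟩
      obtain ⟨l, hl, rfl⟩ := exists_list_reflMatrix hA
      have hd : ∀ l : List (n → ℝ), (∀ u ∈ l, u ≠ 0) →
          (l.map reflMatrix).prod.det = (-1) ^ l.length := by
        intro l hl
        induction l with
        | nil => simp
        | cons u l ih =>
          rw [List.map_cons, List.prod_cons, Matrix.det_mul, det_reflMatrix (hl u (by simp)),
            ih fun w hw => hl w (by simp [hw]), List.length_cons, pow_succ]
          ring
      rw [hd l hl] at hdet
      have heven : Even l.length := by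
        by_contra hodd
        rw [(Nat.not_even_iff_odd.mp hodd).neg_one_pow] at hdet
        norm_num at hdet
      obtain ⟨k, hk⟩ := heven
      exact Set.mem_iUnion.mpr ⟨k, list_prod_mem_evenProducts k l hl (by omega)⟩
    rw [heq]
    exact isPreconnected_iUnion ⟨1, Set.mem_iInter.mpr one_mem_evenProducts⟩
      (isPreconnected_evenProducts h)
  · refine Set.Subsingleton.isPreconnected ?_
    have : Subsingleton n := Fintype.card_le_one_iff_subsingleton.mp hn
    rintro A ⟨-, hA⟩ B ⟨-, hB⟩
    ext i j
    obtain rfl := Subsingleton.elim i j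
    rw [Matrix.det_eq_elem_of_subsingleton A i] at hA
    rw [Matrix.det_eq_elem_of_subsingleton B i] at hB
    rw [hA, hB]

theorem mem_specialOrthogonalGroup_iff_transpose {A : Matrix n n ℝ} :
    A ∈ Matrix.specialOrthogonalGroup n ℝ ↔ A.transpose * A = 1 ∧ A.det = 1 := by
  rw [Matrix.mem_specialOrthogonalGroup_iff, Matrix.mem_orthogonalGroup_iff']

instance : PreconnectedSpace (Matrix.specialOrthogonalGroup n ℝ) := by
  refine isPreconnected_iff_preconnectedSpace.mp ?_
  have : (Matrix.specialOrthogonalGroup n ℝ : Set (Matrix n n ℝ)) = rotationSet n := by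
    ext A
    exact mem_specialOrthogonalGroup_iff_transpose
  rw [this]
  exact isPreconnected_rotationSet

end Reflections

/-! ### One-parameter groups of rotations and the dimension of the space of skew matrices -/

section Exp

variable {n : Type*} [Fintype n] [DecidableEq n]

section Norm

attribute [local instance] Matrix.linftyOpNormedRing Matrix.linftyOpNormedAlgebra

theorem contDiff_exp_smul_apply (Y : Matrix n n ℝ) (i j : n) :
    ContDiff ℝ ∞ (fun t : ℝ => NormedSpace.exp (t • Y) i j) := by
  have h : ContDiff ℝ ∞ (fun t : ℝ => NormedSpace.exp (t • Y)) := by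
    have h1 : ContDiff ℝ ∞ (NormedSpace.exp : Matrix n n ℝ → Matrix n n ℝ) :=
      contDiff_iff_contDiffAt.mpr fun x => (NormedSpace.exp_analytic (𝕂 := ℝ) x).contDiffAt
    exact h1.comp (contDiff_id.smul contDiff_const)
  let e : Matrix n n ℝ →L[ℝ] ℝ := LinearMap.toContinuousLinearMap (Matrix.entryLinearMap ℝ ℝ i j)
  exact e.contDiff.comp h

theorem hasDerivAt_exp_smul_apply (Y : Matrix n n ℝ) (i j : n) :
    HasDerivAt (fun t : ℝ => NormedSpace.exp (t • Y) i j) (Y i j) 0 := by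
  have h : HasDerivAt (fun t : ℝ => NormedSpace.exp (t • Y)) Y 0 := by
    have h := hasDerivAt_exp_smul_const (𝕂 := ℝ) Y (0 : ℝ)
    rw [zero_smul, NormedSpace.exp_zero, one_mul] at h
    exact h
  let e : Matrix n n ℝ →L[ℝ] ℝ := LinearMap.toContinuousLinearMap (Matrix.entryLinearMap ℝ ℝ i j)
  exact e.hasFDerivAt.comp_hasDerivAt (0 : ℝ) h

end Norm

theorem exp_mem_specialOrthogonalGroup {Y : Matrix n n ℝ} (hY : Y.transpose = -Y) :
    NormedSpace.exp Y ∈ Matrix.specialOrthogonalGroup n ℝ := by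
  have horth : ∀ Z : Matrix n n ℝ, Z.transpose = -Z →
      (NormedSpace.exp Z).transpose * NormedSpace.exp Z = 1 := by
    intro Z hZ
    rw [← Matrix.exp_transpose, hZ, Matrix.exp_neg,
      Matrix.nonsing_inv_mul _ ((Matrix.isUnit_iff_isUnit_det _).mp (Matrix.isUnit_exp Z))]
  rw [mem_specialOrthogonalGroup_iff_transpose]
  refine ⟨horth Y hY, ?_⟩
  -- Orthogonality alone gives determinant `±1`; writing `exp Y` as the square of `exp (Y / 2)`
  -- makes it one.
  have h2 : Y = 2 • ((2⁻¹ : ℝ) • Y) := by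
    rw [← Nat.cast_smul_eq_nsmul ℝ, smul_smul]
    norm_num
  have h3 := congrArg Matrix.det (horth ((2⁻¹ : ℝ) • Y) (by simp [hY]))
  rw [h2, Matrix.exp_nsmul, Matrix.det_pow]
  simpa [sq] using h3

end Exp

/-- The skew-symmetric matrices. -/
def skewMatrices (n : Type*) : Submodule ℝ (Matrix n n ℝ) where
  carrier := {Y | Y.transpose = -Y}
  add_mem' {X Y} hX hY := by
    simp only [Set.mem_ofPred_eq] at *
    rw [Matrix.transpose_add, hX, hY, neg_add]
  zero_mem' := by simp
  smul_mem' c X hX := by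
    simp only [Set.mem_ofPred_eq] at *
    rw [Matrix.transpose_smul, hX, smul_neg]

theorem skewMatrices_apply {n : Type*} (Y : skewMatrices n) (i j : n) :
    Y.val j i = - Y.val i j := congrFun (congrFun Y.property i) j

/-- A skew-symmetric matrix is determined by its entries above the diagonal. -/
def skewMatricesEquiv (n : ℕ) :
    skewMatrices (Fin n) ≃ₗ[ℝ] ({p : Fin n × Fin n // p.1 < p.2} → ℝ) where
  toFun Y p := Y.val p.1.1 p.1.2
  map_add' _ _ := rfl
  map_smul' _ _ := rfl
  invFun f := ⟨Matrix.of fun i j =>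
    if h : i < j then f ⟨(i, j), h⟩ else if h : j < i then - f ⟨(j, i), h⟩ else 0, by
      ext i j
      rcases lt_trichotomy i j with h | rfl | h
      · simp [h, h.not_gt]
      · simp
      · simp [h, h.not_gt]⟩
  left_inv Y := by
    ext i j
    rcases lt_trichotomy i j with h | rfl | h
    · simp [h]
    · have := skewMatrices_apply Y i i
      simp
      linarith
    · have := skewMatrices_apply Y j i
      simp [h, h.not_gt]
      linarith
  right_inv f := by
    ext ⟨p, hp⟩
    simp [hp]

theorem finrank_skewMatrices (n : ℕ) :
    Module.finrank ℝ (skewMatrices (Fin n)) = n.choose 2 := by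
  rw [(skewMatricesEquiv n).finrank_eq, Module.finrank_fintype_fun_eq_card, Fintype.card_subtype,
    Fintype.card_product_filter_lt, Fintype.card_fin]

variable {m : ℕ}

/-! ### Polynomial functions and connected components -/

theorem continuous_evalMatrix (p : MvPolynomial (Fin m × Fin m) ℝ) :
    Continuous fun g : GL (Fin m) ℝ => evalMatrix p g.val := by
  unfold evalMatrix
  refine (MvPolynomial.continuous_eval p).comp ?_
  refine continuous_pi fun ij => ?_
  exact Units.continuous_val.matrix_elem ij.1 ij.2

theorem le_zariskiGL (m : ℕ) : (inferInstance : TopologicalSpace (GL (Fin m) ℝ)) ≤ zariskiGL m := by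
  refine le_generateFrom ?_
  rintro _ ⟨p, rfl⟩
  exact isOpen_ne_fun (continuous_evalMatrix p) continuous_const

theorem IsPreconnected.mono_topology {X : Type*} {t t' : TopologicalSpace X} (h : t ≤ t')
    {s : Set X} (hs : @IsPreconnected X t s) : @IsPreconnected X t' s :=
  fun u v hu hv => hs u v (h u hu) (h v hv)

theorem identityComponent_subset_zariskiIdentityComponent (H : Subgroup (GL (Fin m) ℝ)) :
    identityComponent H ⊆ zariskiIdentityComponent H := by
  have h1 : (1 : GL (Fin m) ℝ) ∈ (H : Set (GL (Fin m) ℝ)) := one_mem H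
  refine @IsPreconnected.subset_connectedComponentIn _ (zariskiGL m) _ _ _ ?_ ?_ ?_
  · exact IsPreconnected.mono_topology (le_zariskiGL m) isPreconnected_connectedComponentIn
  · exact mem_connectedComponentIn h1
  · exact connectedComponentIn_subset _ _

/-- A polynomial with finitely many values on `H` cuts `H` into level sets that are both open and
closed in the Zariski topology, so it is constant on a connected subset. -/
theorem eval_eq_of_mem_zariskiIdentityComponent {H : Subgroup (GL (Fin m) ℝ)}
    (p : MvPolynomial (Fin m × Fin m) ℝ)
    (hp : ((fun g : GL (Fin m) ℝ => evalMatrix p g.val) '' H).Finite)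
    {g : GL (Fin m) ℝ} (hg : g ∈ zariskiIdentityComponent H) :
    evalMatrix p g.val = evalMatrix p (1 : GL (Fin m) ℝ).val := by
  classical
  by_contra hne
  have h1 : (1 : GL (Fin m) ℝ) ∈ (H : Set (GL (Fin m) ℝ)) := one_mem H
  have hopen : ∀ q : MvPolynomial (Fin m × Fin m) ℝ,
      @IsOpen _ (zariskiGL m) {g : GL (Fin m) ℝ | evalMatrix q g.val ≠ 0} :=
    fun q => TopologicalSpace.GenerateOpen.basic _ ⟨q, rfl⟩
  let c := evalMatrix p (1 : GL (Fin m) ℝ).val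
  -- On `H` this product is nonzero exactly where `p` takes the value `c`, so it exhibits the level
  -- set of `c` as Zariski open; `p - c` does the same for the complement.
  let q : MvPolynomial (Fin m × Fin m) ℝ := ∏ x ∈ hp.toFinset.erase c, (p - MvPolynomial.C x)
  have hq : ∀ g : GL (Fin m) ℝ, evalMatrix q g.val =
      ∏ x ∈ hp.toFinset.erase c, (evalMatrix p g.val - x) := by
    intro g
    simp [q, evalMatrix]
  have hr : ∀ g : GL (Fin m) ℝ, evalMatrix (p - MvPolynomial.C c) g.val =
      evalMatrix p g.val - c := by
    intro g
    simp [evalMatrix]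
  have hval : ∀ g ∈ H, evalMatrix p g.val ∈ hp.toFinset := fun g hg => by
    simpa using ⟨g, hg, rfl⟩
  have hpre := @isPreconnected_connectedComponentIn _ (zariskiGL m) 1 (H : Set (GL (Fin m) ℝ))
  have hsub := @connectedComponentIn_subset _ (zariskiGL m) (H : Set (GL (Fin m) ℝ)) 1
  have hq0 : ∀ g : GL (Fin m) ℝ, evalMatrix p g.val = c → evalMatrix q g.val ≠ 0 := by
    intro g h
    rw [hq, h]
    refine Finset.prod_ne_zero_iff.mpr fun y hy => sub_ne_zero.mpr ?_
    exact (Finset.ne_of_mem_erase hy).symm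
  have hr0 : ∀ g : GL (Fin m) ℝ, evalMatrix p g.val ≠ c →
      evalMatrix (p - MvPolynomial.C c) g.val ≠ 0 := fun g h => by
    rw [hr]
    exact sub_ne_zero.mpr h
  obtain ⟨x, hx, hx1, hx2⟩ := hpre _ _ (hopen q) (hopen (p - MvPolynomial.C c))
    (fun x _ => (eq_or_ne (evalMatrix p x.val) c).imp (hq0 x) (hr0 x))
    ⟨1, @mem_connectedComponentIn _ (zariskiGL m) _ _ h1, hq0 1 rfl⟩ ⟨g, hg, hr0 g hne⟩
  have hxH := hval x (hsub hx)
  simp only [Set.mem_ofPred_eq, hq, hr] at hx1 hx2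
  exact hx1 (Finset.prod_eq_zero (Finset.mem_erase.mpr ⟨sub_ne_zero.mp hx2, hxH⟩) (sub_self _))

/-! ### Products of rotation groups embedded along a frame -/

section Frame

variable {ι : Type} [Fintype ι] [DecidableEq ι] {n : ι → ℕ}
  (J : Matrix (Fin m) (Σ a, Fin (n a)) ℝ) (L : Matrix (Σ a, Fin (n a)) (Fin m) ℝ)

/-- The matrix acting by the blocks `s` along the frame `J` with dual frame `L`, and as the
identity on the kernel of `L`. -/
def frameMatrix (s : (a : ι) → Matrix (Fin (n a)) (Fin (n a)) ℝ) : Matrix (Fin m) (Fin m) ℝ :=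
  1 + J * (Matrix.blockDiagonal' s - 1) * L

variable {J L}

/-- Compression by `L` and `J` recovers the blocks from the group element. This makes the frame
homomorphism an embedding and lets one differentiate the blocks along a curve. -/
theorem dual_mul_frameMatrix_mul (hLJ : L * J = 1)
    (s : (a : ι) → Matrix (Fin (n a)) (Fin (n a)) ℝ) :
    L * frameMatrix J L s * J = Matrix.blockDiagonal' s := by
  have : L * frameMatrix J L s * J = L * J + (L * J) * (Matrix.blockDiagonal' s - 1) * (L * J) := by
    simp only [frameMatrix, Matrix.mul_add, Matrix.add_mul, Matrix.mul_assoc, Matrix.mul_one]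
  rw [this, hLJ]
  simp

/-- The homomorphism from the product of rotation groups defined by a frame. -/
def frameHom (hLJ : L * J = 1) :
    ((a : ι) → Matrix.specialOrthogonalGroup (Fin (n a)) ℝ) →* GL (Fin m) ℝ :=
  MonoidHom.toHomUnits
    { toFun := fun s => frameMatrix J L fun a => (s a).val
      map_one' := by
        have : (fun a => ((1 : (a : ι) → Matrix.specialOrthogonalGroup (Fin (n a)) ℝ) a).val) =
          (1 : (a : ι) → Matrix (Fin (n a)) (Fin (n a)) ℝ) := rfl
        rw [this, frameMatrix, Matrix.blockDiagonal'_one]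
        simp
      map_mul' := fun s t => by
        have : (fun a => ((s * t) a).val) = fun a => (s a).val * (t a).val := rfl
        rw [this, frameMatrix, frameMatrix, frameMatrix, Matrix.blockDiagonal'_mul]
        set S := Matrix.blockDiagonal' fun a => (s a).val
        set T := Matrix.blockDiagonal' fun a => (t a).val
        have h : J * (S - 1) * L * (J * (T - 1) * L) = J * ((S - 1) * (T - 1)) * L := by
          calc _ = J * (S - 1) * (L * J) * (T - 1) * L := by simp only [Matrix.mul_assoc]
            _ = _ := by rw [hLJ]; simp only [Matrix.mul_assoc, Matrix.mul_one]
        rw [add_mul, one_mul, mul_add, mul_one, h]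
        have h2 : S * T - 1 = (S - 1) * (T - 1) + (S - 1) + (T - 1) := by noncomm_ring
        rw [h2]
        simp only [Matrix.mul_add, Matrix.add_mul]
        abel }

theorem frameHom_val (hLJ : L * J = 1)
    (s : (a : ι) → Matrix.specialOrthogonalGroup (Fin (n a)) ℝ) :
    (frameHom hLJ s).val = frameMatrix J L fun a => (s a).val := rfl

theorem continuous_frameHom (hLJ : L * J = 1) : Continuous (frameHom hLJ) := by
  have h : Continuous fun s => (frameHom hLJ s).val := by
    simp only [frameHom_val, frameMatrix]
    refine continuous_const.add (Continuous.matrix_mul (Continuous.matrix_mul continuous_const ?_)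
      continuous_const)
    refine Continuous.sub ?_ continuous_const
    refine Continuous.matrix_blockDiagonal' ?_
    exact continuous_pi fun a => continuous_subtype_val.comp (continuous_apply a)
  refine Units.continuous_iff.mpr ⟨h, ?_⟩
  have hinv : Continuous fun s : (a : ι) → Matrix.specialOrthogonalGroup (Fin (n a)) ℝ => s⁻¹ := by
    refine continuous_pi fun a => ?_
    refine Continuous.subtype_mk ?_ _
    exact Continuous.matrix_transpose (continuous_subtype_val.comp (continuous_apply a))
  refine (h.comp hinv).congr fun s => ?_
  simp

/-- Reading off the diagonal blocks of `L g J` is continuous in `g` and inverts the homomorphism on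
its image. -/
theorem isEmbedding_frameHom (hLJ : L * J = 1) : Topology.IsEmbedding (frameHom hLJ) := by
  let r : GL (Fin m) ℝ → ((a : ι) → Matrix (Fin (n a)) (Fin (n a)) ℝ) :=
    fun g => Matrix.blockDiag' (L * g.val * J)
  have hr : Continuous r := by
    refine Continuous.matrix_blockDiag' ?_
    exact (continuous_const.matrix_mul Units.continuous_val).matrix_mul continuous_const
  refine Topology.IsEmbedding.of_comp (continuous_frameHom hLJ) hr ?_
  have : r ∘ frameHom hLJ = Pi.map fun a => Subtype.val := by
    funext s
    simp only [r, Function.comp_apply, frameHom_val, dual_mul_frameMatrix_mul hLJ,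
      Matrix.blockDiag'_blockDiagonal']
    rfl
  rw [this]
  exact Topology.IsEmbedding.piMap fun a => Topology.IsEmbedding.subtypeVal

theorem isPreconnected_range_frameHom (hLJ : L * J = 1) :
    IsPreconnected (Set.range (frameHom hLJ)) :=
  isPreconnected_range (continuous_frameHom hLJ)

/-- If the group contains the rotations along a frame, and these are exactly the elements on which
some polynomials with finitely many values on the group take the same value as at the identity,
then both identity components consist of these rotations. -/
theorem range_frameHom_eq_components {H : Subgroup (GL (Fin m) ℝ)} (hLJ : L * J = 1)
    (hmem : ∀ s, frameHom hLJ s ∈ H) (P : Set (MvPolynomial (Fin m × Fin m) ℝ))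
    (hfin : ∀ p ∈ P, ((fun g : GL (Fin m) ℝ => evalMatrix p g.val) '' H).Finite)
    (hrigid : ∀ g ∈ H, (∀ p ∈ P, evalMatrix p g.val = evalMatrix p (1 : GL (Fin m) ℝ).val) →
      g ∈ Set.range (frameHom hLJ)) :
    Set.range (frameHom hLJ) = identityComponent H ∧
      Set.range (frameHom hLJ) = zariskiIdentityComponent H := by
  have h1 : Set.range (frameHom hLJ) ⊆ identityComponent H :=
    (isPreconnected_range_frameHom hLJ).subset_connectedComponentIn ⟨1, map_one _⟩
      (Set.range_subset_iff.mpr hmem)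
  have h2 := identityComponent_subset_zariskiIdentityComponent H
  have h3 : zariskiIdentityComponent H ⊆ Set.range (frameHom hLJ) := fun g hg =>
    hrigid g (@connectedComponentIn_subset _ (zariskiGL m) _ _ _ hg) fun p hp =>
      eval_eq_of_mem_zariskiIdentityComponent p (hfin p hp) hg
  exact ⟨h1.antisymm (h2.trans h3), (h1.trans h2).antisymm h3⟩

/-! ### The Lie algebra -/

theorem hasDerivAt_mul_mul_apply {k l k' l' : Type*} [Fintype k] [Fintype l]
    (A : Matrix k' k ℝ) (B : Matrix l l' ℝ) {γ : ℝ → Matrix k l ℝ} {γ' : Matrix k l ℝ} {t : ℝ}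
    (h : ∀ i j, HasDerivAt (fun t => γ t i j) (γ' i j) t) (i : k') (j : l') :
    HasDerivAt (fun t => (A * γ t * B) i j) ((A * γ' * B) i j) t := by
  simp only [Matrix.mul_apply]
  exact HasDerivAt.fun_sum (u := Finset.univ) fun y _ => HasDerivAt.mul_const
    (HasDerivAt.fun_sum (u := Finset.univ) fun x _ => HasDerivAt.const_mul (A i x) (h x y)) (B y j)

theorem contDiff_mul_mul_apply {k l k' l' : Type*} [Fintype k] [Fintype l]
    (A : Matrix k' k ℝ) (B : Matrix l l' ℝ) {γ : ℝ → Matrix k l ℝ}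
    (h : ∀ i j, ContDiff ℝ ∞ (fun t => γ t i j)) (i : k') (j : l') :
    ContDiff ℝ ∞ (fun t => (A * γ t * B) i j) := by
  simp only [Matrix.mul_apply]
  exact ContDiff.sum fun y _ => (ContDiff.sum fun x _ => contDiff_const.mul (h x y)).mul
    contDiff_const

/-- The linear map sending skew-symmetric blocks to the tangent vectors along a frame. -/
def frameTangent (J : Matrix (Fin m) (Σ a, Fin (n a)) ℝ) (L : Matrix (Σ a, Fin (n a)) (Fin m) ℝ) :
    ((a : ι) → skewMatrices (Fin (n a))) →ₗ[ℝ] Matrix (Fin m) (Fin m) ℝ where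
  toFun Y := J * Matrix.blockDiagonal' (fun a => (Y a).val) * L
  map_add' X Y := by
    have : (fun a => ((X + Y) a).val) = (fun a => (X a).val) + fun a => (Y a).val := rfl
    rw [this, Matrix.blockDiagonal'_add, Matrix.mul_add, Matrix.add_mul]
  map_smul' c Y := by
    have : (fun a => ((c • Y) a).val) = c • fun a => (Y a).val := rfl
    rw [this, Matrix.blockDiagonal'_smul, Matrix.mul_smul, Matrix.smul_mul]
    rfl

theorem frameTangent_injective (hLJ : L * J = 1) : Function.Injective (frameTangent J L) := by
  intro X Y h
  have hX : ∀ Z : (a : ι) → skewMatrices (Fin (n a)), L * frameTangent J L Z * J =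
      Matrix.blockDiagonal' fun a => (Z a).val := by
    intro Z
    calc _ = (L * J) * (Matrix.blockDiagonal' fun a => (Z a).val) * (L * J) := by
          simp only [frameTangent, LinearMap.coe_mk, AddHom.coe_mk, Matrix.mul_assoc]
      _ = _ := by rw [hLJ]; simp
  have h' := hX X
  rw [h, hX Y] at h'
  funext a
  exact Subtype.ext (congrFun (Matrix.blockDiagonal'_injective h') a).symm

theorem frameTangent_mem_lieAlgebra {H : Subgroup (GL (Fin m) ℝ)} (hLJ : L * J = 1)
    (hmem : ∀ s, frameHom hLJ s ∈ H) (Y : (a : ι) → skewMatrices (Fin (n a))) :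
    frameTangent J L Y ∈ lieAlgebra H := by
  have hskew : ∀ (t : ℝ) a, (t • (Y a).val).transpose = -(t • (Y a).val) := fun t a =>
    (t • Y a).property
  refine ⟨fun t => frameHom hLJ fun a =>
    ⟨NormedSpace.exp (t • (Y a).val), exp_mem_specialOrthogonalGroup (hskew t a)⟩, ?_,
    fun t => hmem _, fun i j => ?_⟩
  · refine (congrArg (frameHom hLJ) (funext fun a => Subtype.ext ?_)).trans (map_one _)
    change NormedSpace.exp ((0 : ℝ) • (Y a).val) = 1
    rw [zero_smul, NormedSpace.exp_zero]
  · simp only [frameHom_val, frameMatrix, frameTangent, LinearMap.coe_mk, AddHom.coe_mk]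
    simp only [Matrix.add_apply]
    constructor
    · refine contDiff_const.add (contDiff_mul_mul_apply J L ?_ i j)
      rintro ⟨a, k⟩ ⟨b, l⟩
      simp only [Matrix.sub_apply]
      refine ContDiff.sub ?_ contDiff_const
      simp only [Matrix.blockDiagonal'_apply]
      split_ifs with h
      · exact contDiff_exp_smul_apply _ _ _
      · exact contDiff_const
    · refine HasDerivAt.const_add _ (hasDerivAt_mul_mul_apply J L ?_ i j)
      rintro ⟨a, k⟩ ⟨b, l⟩
      simp only [Matrix.sub_apply]
      refine HasDerivAt.sub_const _ ?_
      simp only [Matrix.blockDiagonal'_apply]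
      split_ifs with h
      · exact hasDerivAt_exp_smul_apply _ _ _
      · exact hasDerivAt_const _ _

/-- A smooth curve in `H` through the identity has connected image, so it consists of frame
rotations. Its compression `D = L γ J` is block diagonal and orthogonal with `D 0 = 1`.
Differentiating these two conditions shows that the velocity has skew diagonal blocks and no others.
-/
theorem mem_range_frameTangent {H : Subgroup (GL (Fin m) ℝ)} (hLJ : L * J = 1)
    (hcomp : identityComponent H ⊆ Set.range (frameHom hLJ)) {X : Matrix (Fin m) (Fin m) ℝ}
    (hX : X ∈ lieAlgebra H) : X ∈ LinearMap.range (frameTangent J L) := by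
  obtain ⟨γ, hγ0, hγH, hγ⟩ := hX
  have hval : Continuous fun t => (γ t).val :=
    continuous_matrix fun i j => (hγ i j).1.continuous
  have hdet : ∀ t, (γ t).val.det ≠ 0 := fun t =>
    ((Matrix.isUnit_iff_isUnit_det _).mp (γ t).isUnit).ne_zero
  -- The topology on units also involves the inverse, whose continuity comes from the formula `det⁻¹
  -- • adjugate`.
  have hcont : Continuous γ := by
    refine Units.continuous_iff.mpr ⟨hval, ?_⟩
    have : (fun t => (γ t)⁻¹.val) = fun t => (γ t).val.det⁻¹ • (γ t).val.adjugate := by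
      funext t
      rw [Matrix.coe_units_inv, Matrix.inv_def, Ring.inverse_eq_inv]
    rw [this]
    exact (hval.matrix_det.inv₀ hdet).smul hval.matrix_adjugate
  have hrange : ∀ t, γ t ∈ Set.range (frameHom hLJ) := by
    intro t
    refine hcomp ?_
    have hpre : IsPreconnected (Set.range γ) := isPreconnected_range hcont
    exact hpre.subset_connectedComponentIn ⟨0, hγ0⟩ (Set.range_subset_iff.mpr hγH) ⟨t, rfl⟩
  choose s hs using hrange
  have hγs : ∀ t, (γ t).val = frameMatrix J L fun a => (s t a).val := fun t => by
    rw [← hs t, frameHom_val]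
  let D : ℝ → Matrix (Σ a, Fin (n a)) (Σ a, Fin (n a)) ℝ := fun t => L * (γ t).val * J
  have hD : ∀ t, D t = Matrix.blockDiagonal' fun a => (s t a).val := fun t => by
    simp only [D, hγs, dual_mul_frameMatrix_mul hLJ]
  have hDderiv : ∀ k l, HasDerivAt (fun t => D t k l) ((L * X * J) k l) 0 := by
    exact hasDerivAt_mul_mul_apply L J fun i j => (hγ i j).2
  have hblock : ∀ t (k l : Σ a, Fin (n a)), k.1 ≠ l.1 → D t k l = 0 := by
    rintro t ⟨a, k⟩ ⟨b, l⟩ h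
    rw [hD, Matrix.blockDiagonal'_apply_ne _ _ _ h]
  have hXblock : ∀ k l : Σ a, Fin (n a), k.1 ≠ l.1 → (L * X * J) k l = 0 := by
    intro k l h
    have h1 := hDderiv k l
    simp only [hblock _ k l h] at h1
    exact h1.unique (hasDerivAt_const _ _)
  have hD0 : D 0 = 1 := by simp [D, hγ0, hLJ]
  have hXskew : (L * X * J).transpose = -(L * X * J) := by
    ext k l
    have horth : ∀ t, ∑ i, D t i k * D t i l = (1 : Matrix _ _ ℝ) k l := by
      intro t
      have : (D t).transpose * D t = 1 := by
        rw [hD, Matrix.blockDiagonal'_transpose, ← Matrix.blockDiagonal'_mul,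
          ← Matrix.blockDiagonal'_one]
        congr 1
        funext a
        exact (mem_specialOrthogonalGroup_iff_transpose.mp (s t a).property).1
      rw [← this, Matrix.mul_apply]
      rfl
    have h1 := HasDerivAt.fun_sum (u := Finset.univ) fun i _ => (hDderiv i k).fun_mul (hDderiv i l)
    simp only [horth, hD0] at h1
    have h2 := h1.unique (hasDerivAt_const _ _)
    simp only [Matrix.one_apply, mul_ite, ite_mul, mul_one, mul_zero, one_mul, zero_mul,
      Finset.sum_add_distrib, Finset.sum_ite_eq', Finset.mem_univ, if_true]
      at h2
    rw [Matrix.transpose_apply, Matrix.neg_apply]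
    linarith
  refine ⟨fun a => ⟨Matrix.blockDiag' (L * X * J) a, ?_⟩, ?_⟩
  · ext k l
    exact congrFun (congrFun hXskew ⟨a, k⟩) ⟨a, l⟩
  · have hbd : Matrix.blockDiagonal' (Matrix.blockDiag' (L * X * J)) = L * X * J := by
      ext ⟨a, k⟩ ⟨b, l⟩
      by_cases h : a = b
      · subst h
        simp [Matrix.blockDiagonal'_apply_eq, Matrix.blockDiag'_apply]
      · rw [Matrix.blockDiagonal'_apply_ne _ _ _ h, hXblock ⟨a, k⟩ ⟨b, l⟩ h]
    change J * Matrix.blockDiagonal' (Matrix.blockDiag' (L * X * J)) * L = X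
    rw [hbd]
    ext i j
    have hg : ∀ t, (γ t).val i j = (1 - J * L + J * D t * L : Matrix (Fin m) (Fin m) ℝ) i j := by
      intro t
      rw [hγs t, hD t, frameMatrix]
      simp only [Matrix.mul_sub, Matrix.sub_mul, Matrix.mul_one, Matrix.add_apply,
        Matrix.sub_apply]
      ring
    have h1 := (hγ i j).2
    simp only [hg] at h1
    have h2 : HasDerivAt (fun t => (1 - J * L + J * D t * L : Matrix (Fin m) (Fin m) ℝ) i j)
        ((J * (L * X * J) * L) i j) 0 := by
      exact HasDerivAt.const_add _ (hasDerivAt_mul_mul_apply J L hDderiv i j)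
    exact h2.unique h1

theorem lieDim_eq_of_frame {H : Subgroup (GL (Fin m) ℝ)} (hLJ : L * J = 1)
    (hmem : ∀ s, frameHom hLJ s ∈ H) (hcomp : identityComponent H ⊆ Set.range (frameHom hLJ)) :
    lieDim H = ∑ a, (n a).choose 2 := by
  have h : lieAlgebra H = LinearMap.range (frameTangent J L) := by
    refine le_antisymm (fun X hX => mem_range_frameTangent hLJ hcomp hX) ?_
    rintro _ ⟨Y, rfl⟩
    exact frameTangent_mem_lieAlgebra hLJ hmem Y
  rw [lieDim, h, LinearMap.finrank_range_of_inj (frameTangent_injective hLJ),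
    Module.finrank_pi_fintype]
  simp only [finrank_skewMatrices]

end Frame

/-! ### Linear algebra of self-adjoint operators -/

section LinearAlgebra

variable {n : Type*} [Fintype n] [DecidableEq n]

theorem transpose_aeval (S : Matrix n n ℝ) (q : Polynomial ℝ) :
    (Polynomial.aeval S q).transpose = Polynomial.aeval S.transpose q := by
  induction q using Polynomial.induction_on' with
  | add p q hp hq => simp [hp, hq]
  | monomial k c => simp [Polynomial.aeval_monomial, Algebra.algebraMap_eq_smul_one]

theorem mul_aeval_of_mul_eq {A S R : Matrix n n ℝ} (h : A * S = R * A) (q : Polynomial ℝ) :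
    A * Polynomial.aeval S q = Polynomial.aeval R q * A := by
  have hpow : ∀ k : ℕ, A * S ^ k = R ^ k * A := by
    intro k
    induction k with
    | zero => simp
    | succ k ih => rw [pow_succ, ← mul_assoc, ih, mul_assoc, h, ← mul_assoc, pow_succ]
  induction q using Polynomial.induction_on' with
  | add p q hp hq => simp [mul_add, add_mul, hp, hq]
  | monomial k c => simp [Polynomial.aeval_monomial, Algebra.algebraMap_eq_smul_one, hpow]

/-- An isometry that commutes with a self-adjoint operator having a cyclic vector on the range of a
projection squares to the identity on this range. -/
theorem mul_self_mul_eq_of_cyclic {A P S g : Matrix n n ℝ} (hA : IsUnit A)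
    (hPt : P.transpose = P) (hP : P * P = P) (hAP : A * P = P * A) (hAS : A * S = S.transpose * A)
    (hgP : g * P = P * g) (hgS : g * S = S * g) (hg : g.transpose * A * g = A) {x : n → ℝ}
    (hx : P.mulVec x = x)
    (hcyc : ∀ u, ∃ q : Polynomial ℝ, P.mulVec u = (Polynomial.aeval S q).mulVec x) :
    g * g * P = P := by
  -- Since `g` commutes with `S`, it is determined on the range of `P` by its value at the cyclic
  -- vector. So it agrees there with the polynomial `p` in `S`, which is self-adjoint for `A`. An
  -- isometry that equals its own adjoint is an involution.
  obtain ⟨p, hp⟩ := hcyc (g.mulVec x)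
  rw [Matrix.mulVec_mulVec, ← hgP, ← Matrix.mulVec_mulVec, hx] at hp
  have hgp : g * P = Polynomial.aeval S p * P := by
    refine Matrix.ext_of_mulVec_single fun i => ?_
    obtain ⟨q, hq⟩ := hcyc (Pi.single i 1)
    rw [← Matrix.mulVec_mulVec, ← Matrix.mulVec_mulVec, hq, Matrix.mulVec_mulVec,
      mul_aeval_of_mul_eq hgS, ← Matrix.mulVec_mulVec, hp, Matrix.mulVec_mulVec,
      Matrix.mulVec_mulVec, ← map_mul, ← map_mul, mul_comm]
  have hpt : P * (Polynomial.aeval S p).transpose = P * g.transpose := by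
    have := congrArg Matrix.transpose hgp
    rwa [Matrix.transpose_mul, Matrix.transpose_mul, hPt, eq_comm] at this
  have hAp : A * Polynomial.aeval S p = (Polynomial.aeval S p).transpose * A := by
    rw [transpose_aeval, mul_aeval_of_mul_eq hAS]
  refine hA.mul_left_cancel ?_
  have h1 : g * g * P = P * (g * g * P) := by
    calc g * g * P = g * (g * (P * P)) := by rw [hP, mul_assoc]
      _ = P * (g * g * P) := by
        rw [← mul_assoc g P, hgP, mul_assoc, ← mul_assoc g P, hgP]
        simp only [mul_assoc, hgP]
  calc A * (g * g * P) = P * A * (g * g * P) := by rw [h1, ← mul_assoc, hAP, ← h1]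
    _ = P * A * (g * P * g * P) := by
      rw [mul_assoc g P g, ← hgP, mul_assoc, mul_assoc, mul_assoc, mul_assoc, mul_assoc, hP]
    _ = P * (A * Polynomial.aeval S p) * (P * g * P) := by
      rw [hgp]
      simp only [mul_assoc]
    _ = P * g.transpose * A * (P * g * P) := by
      rw [hAp, ← mul_assoc P _ A, hpt, mul_assoc P g P]
    _ = P * (g.transpose * A * g) * P := by
      rw [← hgP, mul_assoc g P P, hP]
      simp only [mul_assoc]
    _ = A * P := by rw [hg, ← hAP, mul_assoc, hP]

theorem isIdempotentElem_toLin {e : Matrix n n ℝ} (he : e * e = e) :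
    IsIdempotentElem (Matrix.toLin' e) := by
  rw [IsIdempotentElem, Module.End.mul_eq_comp, ← Matrix.toLin'_mul, he]

theorem trace_idempotent_mem {e : Matrix n n ℝ} (he : e * e = e) :
    ∃ k ≤ Fintype.card n, e.trace = k := by
  refine ⟨Module.finrank ℝ (LinearMap.range (Matrix.toLin' e)), ?_, ?_⟩
  · exact (Submodule.finrank_le _).trans (by simp)
  · rw [← Matrix.trace_toLin'_eq,
      (LinearMap.IsIdempotentElem.isProj_range _ (isIdempotentElem_toLin he)).trace]

/-- Half of `P - B` projects onto the `-1` eigenspace of the involution `B`. Its trace vanishes, and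
an idempotent of trace zero is zero in characteristic zero. -/
theorem eq_of_trace_eq {B P : Matrix n n ℝ} (hP : P * P = P) (hBP : B * P = B) (hPB : P * B = B)
    (hB : B * B = P) (htr : B.trace = P.trace) : B = P := by
  have he : ((2⁻¹ : ℝ) • (P - B)) * ((2⁻¹ : ℝ) • (P - B)) = (2⁻¹ : ℝ) • (P - B) := by
    simp only [Matrix.smul_mul, Matrix.mul_smul, sub_mul, mul_sub, hP, hBP, hPB, hB]
    module
  have h0 : (2⁻¹ : ℝ) • (P - B) = 0 := by
    have h := (LinearMap.IsIdempotentElem.trace_eq_zero_iff (isIdempotentElem_toLin he)).mp (by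
      rw [Matrix.trace_toLin'_eq, Matrix.trace_smul, Matrix.trace_sub, htr]
      simp)
    exact (LinearEquiv.map_eq_zero_iff Matrix.toLin').mp h
  exact (sub_eq_zero.mp ((smul_eq_zero.mp h0).resolve_left (by norm_num))).symm

/-- Half of `P + B` is idempotent, so its trace is its rank, a natural number at most the dimension.
-/
theorem trace_involution_mem {B P : Matrix n n ℝ} (hP : P * P = P) (hBP : B * P = B)
    (hPB : P * B = B) (hB : B * B = P) :
    B.trace ∈ (fun k : ℕ => 2 * (k : ℝ) - P.trace) '' Set.Iic (Fintype.card n) := by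
  have he : ((2⁻¹ : ℝ) • (P + B)) * ((2⁻¹ : ℝ) • (P + B)) = (2⁻¹ : ℝ) • (P + B) := by
    simp only [Matrix.smul_mul, Matrix.mul_smul, add_mul, mul_add, hP, hBP, hPB, hB]
    module
  obtain ⟨k, hk, h⟩ := trace_idempotent_mem he
  refine ⟨k, hk, ?_⟩
  simp only [← h, Matrix.trace_smul, Matrix.trace_add, smul_eq_mul]
  ring

-- Factoring `A = BᵀB` makes `B` an isometry from the form `A` to Euclidean space; an orthonormal
-- basis of the image of `F` is pulled back, and `J Jᵀ A` is the orthogonal projection onto `F`.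
open scoped MatrixOrder in
theorem exists_orthonormal_frame {A : Matrix n n ℝ} (hA : A.PosDef) (F : Submodule ℝ (n → ℝ))
    {k : ℕ} (hk : Module.finrank ℝ F = k) :
    ∃ J : Matrix n (Fin k) ℝ, J.transpose * A * J = 1 ∧ (∀ l, (fun i => J i l) ∈ F) ∧
      ∀ v ∈ F, v = J.mulVec ((J.transpose * A).mulVec v) := by
  obtain ⟨B, hB⟩ := CStarAlgebra.nonneg_iff_eq_star_mul_self.mp hA.posSemidef.nonneg
  replace hB : A = B.transpose * B := by simpa [Matrix.star_eq_conjTranspose] using hB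
  let f : (n → ℝ) →ₗ[ℝ] EuclideanSpace ℝ n :=
    (WithLp.linearEquiv 2 ℝ (n → ℝ)).symm.toLinearMap ∘ₗ Matrix.toLin' B
  have hf : ∀ u v, inner ℝ (f u) (f v) = u ⬝ᵥ A.mulVec v := by
    intro u v
    rw [EuclideanSpace.inner_eq_star_dotProduct, star_trivial, dotProduct_comm]
    change B.mulVec u ⬝ᵥ B.mulVec v = _
    rw [hB, ← Matrix.mulVec_mulVec, Matrix.dotProduct_mulVec u, Matrix.vecMul_transpose]
  have hinj : Function.Injective f := by
    refine (injective_iff_map_eq_zero f).mpr fun v hv => ?_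
    by_contra h0
    have h1 := hA.dotProduct_mulVec_pos h0
    rw [star_trivial, ← hf, hv, inner_zero_left] at h1
    exact lt_irrefl _ h1
  have hfin : Module.finrank ℝ (F.map f) = k := by
    rw [← hk, (Submodule.equivMapOfInjective f hinj F).finrank_eq]
  let b := (stdOrthonormalBasis ℝ (F.map f)).reindex (finCongr hfin)
  have hb : ∀ l, ∃ v ∈ F, f v = (b l : EuclideanSpace ℝ n) := fun l =>
    Submodule.mem_map.mp (b l).property
  choose v hvF hfv using hb
  refine ⟨Matrix.of fun i l => v l i, ?_, hvF, ?_⟩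
  · ext k l
    have h1 := hf (v k) (v l)
    rw [hfv, hfv, ← Submodule.coe_inner, orthonormal_iff_ite.mp b.orthonormal] at h1
    rw [Matrix.one_apply, h1, Matrix.mul_assoc]
    rfl
  · intro w hw
    refine hinj ?_
    have h1 := b.sum_repr' ⟨f w, Submodule.mem_map_of_mem hw⟩
    have h2 := congrArg Subtype.val h1
    rw [AddSubmonoidClass.coe_finsetSum] at h2
    have hJ : (Matrix.of fun i l => v l i).mulVec
        (((Matrix.of fun i l => v l i).transpose * A).mulVec w) =
        ∑ l, (v l ⬝ᵥ A.mulVec w) • v l := by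
      rw [← Matrix.mulVec_mulVec]
      ext i
      simp [Matrix.mulVec, dotProduct, mul_comm]
    rw [hJ, map_sum]
    refine h2.symm.trans (Finset.sum_congr rfl fun l _ => ?_)
    rw [map_smul, hfv, ← hf, hfv]
    rfl

end LinearAlgebra

/-! ### Block diagonal isometries of a positive definite form -/

section Blocks

variable {ι : Type} [DecidableEq ι] (cls : Fin m → ι)

/-- The coordinate projection onto the class `a`. -/
def classProj (a : ι) : Matrix (Fin m) (Fin m) ℝ :=
  Matrix.diagonal fun i => if cls i = a then 1 else 0

/-- The matrices that are block diagonal with respect to the classes. -/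
def IsBlock (g : Matrix (Fin m) (Fin m) ℝ) : Prop :=
  ∀ i j, cls i ≠ cls j → g i j = 0

/-- The block diagonal part of a matrix. -/
def blockPart (M : Matrix (Fin m) (Fin m) ℝ) : Matrix (Fin m) (Fin m) ℝ :=
  Matrix.of fun i j => if cls i = cls j then M i j else 0

/-- The matrix of the form `M` relative to its block diagonal part, up to a scalar. -/
def transferOp (M : Matrix (Fin m) (Fin m) ℝ) : Matrix (Fin m) (Fin m) ℝ :=
  (blockPart cls M).adjugate * M

/-- The self-adjoint operator on the class `a` that runs through the class `b`. -/
def crossOp (M : Matrix (Fin m) (Fin m) ℝ) (a b : ι) : Matrix (Fin m) (Fin m) ℝ :=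
  classProj cls a * transferOp cls M * classProj cls b * transferOp cls M * classProj cls a

/-- The indicator vector of the class `a` is cyclic for some operator `crossOp cls M a b`. -/
def IsTame (M : Matrix (Fin m) (Fin m) ℝ) (a : ι) : Prop :=
  ∃ b, ∀ u, ∃ q : Polynomial ℝ, (classProj cls a).mulVec u =
    (Polynomial.aeval (crossOp cls M a b) q).mulVec ((classProj cls a).mulVec 1)

/-- The vectors supported in the class `a` that are orthogonal to all other coordinate vectors. -/
def residual (M : Matrix (Fin m) (Fin m) ℝ) (a : ι) : Submodule ℝ (Fin m → ℝ) where
  carrier := {v | (∀ i, cls i ≠ a → v i = 0) ∧ ∀ i, cls i ≠ a → M.mulVec v i = 0}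
  add_mem' {u v} hu hv := ⟨fun i hi => by simp [hu.1 i hi, hv.1 i hi], fun i hi => by
    simp [Matrix.mulVec_add, hu.2 i hi, hv.2 i hi]⟩
  zero_mem' := by simp
  smul_mem' c v hv := ⟨fun i hi => by simp [hv.1 i hi], fun i hi => by
    simp [Matrix.mulVec_smul, hv.2 i hi]⟩

variable {cls}

theorem classProj_transpose (a : ι) : (classProj cls a).transpose = classProj cls a :=
  Matrix.diagonal_transpose _

theorem classProj_mul_self (a : ι) : classProj cls a * classProj cls a = classProj cls a := by
  simp [classProj]

theorem classProj_mulVec (a : ι) (v : Fin m → ℝ) (i : Fin m) :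
    (classProj cls a).mulVec v i = if cls i = a then v i else 0 := by
  simp [classProj, Matrix.mulVec_diagonal]

theorem classProj_mul_apply {k : Type*} (a : ι) (g : Matrix (Fin m) k ℝ) (i : Fin m) (j : k) :
    (classProj cls a * g) i j = if cls i = a then g i j else 0 := by
  simp [classProj, Matrix.diagonal_mul]

theorem mul_classProj_apply (a : ι) (g : Matrix (Fin m) (Fin m) ℝ) (i j : Fin m) :
    (g * classProj cls a) i j = if cls j = a then g i j else 0 := by
  simp [classProj, Matrix.mul_diagonal]

theorem sum_classProj [Fintype ι] : ∑ a, classProj cls a = 1 := by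
  ext i j
  simp [classProj, Matrix.sum_apply, Matrix.diagonal_apply, Matrix.one_apply]

namespace IsBlock

variable {g g' : Matrix (Fin m) (Fin m) ℝ}

theorem commute (h : IsBlock cls g) (a : ι) : g * classProj cls a = classProj cls a * g := by
  ext i j
  rw [classProj_mul_apply, mul_classProj_apply]
  by_cases hij : cls i = cls j
  · rw [hij]
  · simp [h i j hij]

omit [DecidableEq ι] in
theorem transpose (h : IsBlock cls g) : IsBlock cls g.transpose :=
  fun i j hij => h j i hij.symm

/-- A block diagonal matrix does not mix classes, so restricting the form to the classes commutes
with changing basis. Hence block isometries of `M` also preserve its block diagonal part. -/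
theorem blockPart_conj (h : IsBlock cls g) (M : Matrix (Fin m) (Fin m) ℝ) :
    blockPart cls (g.transpose * M * g) = g.transpose * blockPart cls M * g := by
  ext i j
  simp only [blockPart, Matrix.of_apply, Matrix.mul_apply, Matrix.transpose_apply]
  split_ifs with hij
  · refine Finset.sum_congr rfl fun k _ => ?_
    by_cases hk : cls k = cls j
    · congr 1
      refine Finset.sum_congr rfl fun l _ => ?_
      by_cases hl : cls l = cls i
      · rw [if_pos (by rw [hl, hk, hij])]
      · rw [h l i hl, zero_mul, zero_mul]
    · rw [h k j hk, mul_zero, mul_zero]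
  · symm
    refine Finset.sum_eq_zero fun k _ => ?_
    by_cases hk : cls k = cls j
    · rw [Finset.sum_eq_zero, zero_mul]
      intro l _
      by_cases hl : cls l = cls i
      · rw [if_neg (by rw [hl, hk]; exact hij), mul_zero]
      · rw [h l i hl, zero_mul]
    · rw [h k j hk, mul_zero]

end IsBlock

theorem isBlock_blockPart (M : Matrix (Fin m) (Fin m) ℝ) : IsBlock cls (blockPart cls M) :=
  fun i j hij => by simp [blockPart, hij]

theorem transpose_eq_of_posDef {M : Matrix (Fin m) (Fin m) ℝ} (hM : M.PosDef) :
    M.transpose = M := by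
  have := hM.isHermitian.eq
  rwa [Matrix.conjTranspose_eq_transpose_of_trivial] at this

theorem blockPart_transpose {M : Matrix (Fin m) (Fin m) ℝ} (hM : M.transpose = M) :
    (blockPart cls M).transpose = blockPart cls M := by
  ext i j
  have h := congrFun (congrFun hM i) j
  rw [Matrix.transpose_apply] at h
  simp [blockPart, h, eq_comm]

/-- The block diagonal part evaluates at `x` to the sum over the classes of `M` evaluated at the
components of `x`. -/
theorem posDef_blockPart [Fintype ι] {M : Matrix (Fin m) (Fin m) ℝ} (hM : M.PosDef) :
    (blockPart cls M).PosDef := by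
  have hsum : blockPart cls M = ∑ a, classProj cls a * M * classProj cls a := by
    ext i j
    rw [Matrix.sum_apply]
    simp only [mul_classProj_apply, classProj_mul_apply, blockPart, Matrix.of_apply]
    simp only [← ite_and]
    by_cases h : cls i = cls j
    · rw [h, if_pos rfl]
      simp
    · rw [if_neg h, Finset.sum_eq_zero]
      intro a _
      rw [if_neg]
      rintro ⟨h1, h2⟩
      exact h (h2.trans h1.symm)
  refine Matrix.PosDef.of_dotProduct_mulVec_pos ?_ fun x hx => ?_
  · rw [Matrix.IsHermitian, Matrix.conjTranspose_eq_transpose_of_trivial,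
      blockPart_transpose (transpose_eq_of_posDef hM)]
  · have hterm : ∀ a, x ⬝ᵥ (classProj cls a * M * classProj cls a).mulVec x =
        (classProj cls a).mulVec x ⬝ᵥ M.mulVec ((classProj cls a).mulVec x) := by
      intro a
      rw [Matrix.mul_assoc, ← Matrix.mulVec_mulVec, Matrix.dotProduct_mulVec,
        ← Matrix.mulVec_mulVec]
      congr 1
      rw [← Matrix.mulVec_transpose, classProj_transpose]
    rw [star_trivial, hsum, Matrix.sum_mulVec, dotProduct_sum]
    simp only [hterm]
    obtain ⟨i, hi⟩ := Function.ne_iff.mp hx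
    refine Finset.sum_pos' (fun a _ => ?_) ⟨cls i, Finset.mem_univ _, ?_⟩
    · simpa using hM.posSemidef.dotProduct_mulVec_nonneg ((classProj cls a).mulVec x)
    · have h0 : (classProj cls (cls i)).mulVec x ≠ 0 := by
        intro h
        have := congrFun h i
        rw [classProj_mulVec, if_pos rfl] at this
        exact hi this
      simpa using hM.dotProduct_mulVec_pos h0

theorem blockPart_mul_transferOp (M : Matrix (Fin m) (Fin m) ℝ) :
    blockPart cls M * transferOp cls M = (blockPart cls M).det • M := by
  rw [transferOp, ← mul_assoc, Matrix.mul_adjugate, Matrix.smul_mul, one_mul]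

/-- `A` times the transfer operator is a multiple of the symmetric `M`, so the transfer operator is
self-adjoint for `A`. So are the class projections, as `A` is block diagonal, and `crossOp` is a
palindromic product of these. -/
theorem blockPart_mul_crossOp {M : Matrix (Fin m) (Fin m) ℝ} (hM : M.transpose = M) (a b : ι) :
    blockPart cls M * crossOp cls M a b =
      (crossOp cls M a b).transpose * blockPart cls M := by
  have hA := blockPart_transpose (cls := cls) hM
  have hT : blockPart cls M * transferOp cls M =
      (transferOp cls M).transpose * blockPart cls M := by
    have h := blockPart_mul_transferOp (cls := cls) M
    have h' := congrArg Matrix.transpose h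
    rw [Matrix.transpose_mul, Matrix.transpose_smul, hM, hA] at h'
    rw [h, h']
  have hP := fun a => (isBlock_blockPart (cls := cls) M).commute a
  simp only [crossOp, Matrix.transpose_mul, classProj_transpose]
  calc _ = (blockPart cls M * classProj cls a) * transferOp cls M * classProj cls b *
        transferOp cls M * classProj cls a := by simp only [mul_assoc]
    _ = classProj cls a * (blockPart cls M * transferOp cls M) * classProj cls b *
        transferOp cls M * classProj cls a := by rw [hP]; simp only [mul_assoc]
    _ = classProj cls a * (transferOp cls M).transpose * (blockPart cls M * classProj cls b) *
        transferOp cls M * classProj cls a := by rw [hT]; simp only [mul_assoc]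
    _ = classProj cls a * (transferOp cls M).transpose * classProj cls b *
        (blockPart cls M * transferOp cls M) * classProj cls a := by
          rw [hP]; simp only [mul_assoc]
    _ = classProj cls a * (transferOp cls M).transpose * classProj cls b *
        (transferOp cls M).transpose * (blockPart cls M * classProj cls a) := by
          rw [hT]; simp only [mul_assoc]
    _ = _ := by rw [hP]; simp only [mul_assoc]

/-! ### Constraints on block diagonal isometries. -/

/-- A block diagonal isometry of the form `M`. -/
structure IsBlockIsometry (cls : Fin m → ι) (M g : Matrix (Fin m) (Fin m) ℝ) : Prop where
  isBlock : IsBlock cls g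
  isometry : g.transpose * M * g = M

namespace IsBlockIsometry

variable {M g : Matrix (Fin m) (Fin m) ℝ}

theorem blockPart_isometry (h : IsBlockIsometry cls M g) :
    g.transpose * blockPart cls M * g = blockPart cls M := by
  rw [← h.isBlock.blockPart_conj, h.isometry]

/-- An isometry of two forms commutes with the operator `A⁻¹ M` relating them. -/
theorem commute_inv_mul (h : IsBlockIsometry cls M g) (hA : IsUnit (blockPart cls M)) :
    g * ((blockPart cls M)⁻¹ * M) = (blockPart cls M)⁻¹ * M * g := by
  have hA' := (Matrix.isUnit_iff_isUnit_det _).mp hA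
  have h1 := h.blockPart_isometry
  have hgt : IsUnit g.transpose := by
    refine (Matrix.isUnit_iff_isUnit_det _).mpr ?_
    have h2 := congrArg Matrix.det h1
    rw [Matrix.det_mul, Matrix.det_mul] at h2
    exact isUnit_of_mul_isUnit_left (isUnit_of_mul_isUnit_left (h2 ▸ hA'))
  refine hA.mul_left_cancel (hgt.mul_left_cancel ?_)
  calc _ = (g.transpose * blockPart cls M * g) * ((blockPart cls M)⁻¹ * M) := by
        simp only [mul_assoc]
    _ = M := by rw [h1, ← mul_assoc, Matrix.mul_nonsing_inv _ hA', one_mul]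
    _ = g.transpose * M * g := h.isometry.symm
    _ = g.transpose * (blockPart cls M * (blockPart cls M)⁻¹) * M * g := by
        rw [Matrix.mul_nonsing_inv _ hA', mul_one]
    _ = _ := by simp only [mul_assoc]

/-- The adjugate is the inverse up to the determinant; it is used in `transferOp` so that everything
stays polynomial in the entries of the form. -/
theorem commute_transferOp (h : IsBlockIsometry cls M g) (hA : IsUnit (blockPart cls M)) :
    g * transferOp cls M = transferOp cls M * g := by
  have hA' := (Matrix.isUnit_iff_isUnit_det _).mp hA
  have : transferOp cls M = (blockPart cls M).det • ((blockPart cls M)⁻¹ * M) := by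
    rw [Matrix.inv_def, transferOp, Matrix.smul_mul, smul_smul, Ring.mul_inverse_cancel _ hA',
      one_smul]
  rw [this, Matrix.mul_smul, Matrix.smul_mul, h.commute_inv_mul hA]

theorem commute_crossOp (h : IsBlockIsometry cls M g) (hA : IsUnit (blockPart cls M)) (a b : ι) :
    g * crossOp cls M a b = crossOp cls M a b * g := by
  have hT : Commute g (transferOp cls M) := h.commute_transferOp hA
  have hP : ∀ a, Commute g (classProj cls a) := h.isBlock.commute
  exact ((((hP a).mul_right hT).mul_right (hP b)).mul_right hT).mul_right (hP a)

omit [DecidableEq ι] in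
theorem isUnit (h : IsBlockIsometry cls M g) (hM : IsUnit M) : IsUnit g := by
  refine (Matrix.isUnit_iff_isUnit_det _).mpr ?_
  have h2 := congrArg Matrix.det h.isometry
  rw [Matrix.det_mul] at h2
  exact isUnit_of_mul_isUnit_right (h2 ▸ (Matrix.isUnit_iff_isUnit_det _).mp hM)

variable [Fintype ι]

theorem mul_self_mul_classProj (h : IsBlockIsometry cls M g) (hM : M.PosDef) {a : ι}
    (ha : IsTame cls M a) : g * g * classProj cls a = classProj cls a := by
  obtain ⟨b, hb⟩ := ha
  have hA := (posDef_blockPart (cls := cls) hM).isUnit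
  exact mul_self_mul_eq_of_cyclic hA (classProj_transpose a) (classProj_mul_self a)
    ((isBlock_blockPart M).commute a) (blockPart_mul_crossOp (transpose_eq_of_posDef hM) a b)
    (h.isBlock.commute a) (h.commute_crossOp hA a b) h.blockPart_isometry
    (by rw [Matrix.mulVec_mulVec, classProj_mul_self]) hb

theorem mul_classProj_involution (h : IsBlockIsometry cls M g) (hM : M.PosDef) {a : ι}
    (ha : IsTame cls M a) : (g * classProj cls a) * classProj cls a = g * classProj cls a ∧
      classProj cls a * (g * classProj cls a) = g * classProj cls a ∧
      (g * classProj cls a) * (g * classProj cls a) = classProj cls a := by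
  have h1 : classProj cls a * (g * classProj cls a) = g * classProj cls a := by
    rw [← mul_assoc, ← h.isBlock.commute a, mul_assoc, classProj_mul_self]
  refine ⟨by rw [mul_assoc, classProj_mul_self], h1, ?_⟩
  rw [mul_assoc, h1, ← mul_assoc, h.mul_self_mul_classProj hM ha]

theorem trace_mem (h : IsBlockIsometry cls M g) (hM : M.PosDef) {a : ι} (ha : IsTame cls M a) :
    (g * classProj cls a).trace ∈
      (fun k : ℕ => 2 * (k : ℝ) - (classProj cls a).trace) '' Set.Iic m := by
  obtain ⟨h1, h2, h3⟩ := h.mul_classProj_involution hM ha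
  simpa using trace_involution_mem (classProj_mul_self a) h1 h2 h3

theorem mul_classProj_eq (h : IsBlockIsometry cls M g) (hM : M.PosDef) {a : ι}
    (ha : IsTame cls M a) (htr : (g * classProj cls a).trace = (classProj cls a).trace) :
    g * classProj cls a = classProj cls a := by
  obtain ⟨h1, h2, h3⟩ := h.mul_classProj_involution hM ha
  exact eq_of_trace_eq (classProj_mul_self a) h1 h2 h3 htr

/-- Replacing `g` by the identity outside the class `a` still gives an isometry of the block
diagonal form, so the square of the determinant is one. -/
theorem det_mem (h : IsBlockIsometry cls M g) (hM : M.PosDef) (a : ι) :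
    (classProj cls a * g + (1 - classProj cls a)).det = 1 ∨
      (classProj cls a * g + (1 - classProj cls a)).det = -1 := by
  have hA := posDef_blockPart (cls := cls) hM
  set A := blockPart cls M
  set P := classProj cls a
  have hPt : P.transpose = P := classProj_transpose a
  have hPP : P * P = P := classProj_mul_self a
  have hAP : A * P = P * A := (isBlock_blockPart M).commute a
  have hgP : g * P = P * g := h.isBlock.commute a
  have hgt : g.transpose * P = P * g.transpose := h.isBlock.transpose.commute a
  have hg : g.transpose * A * g = A := h.blockPart_isometry
  have key : (P * g + (1 - P)).transpose * A * (P * g + (1 - P)) = A := by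
    have hPAP : P * A * P = P * A := by rw [mul_assoc, hAP, ← mul_assoc, hPP]
    have e1 : g.transpose * P * A * (P * g) = P * A := by
      calc _ = g.transpose * (P * A * P) * g := by simp only [mul_assoc]
        _ = P * (g.transpose * A * g) := by
          rw [hPAP, ← mul_assoc, hgt]; simp only [mul_assoc]
        _ = P * A := by rw [hg]
    have e2 : g.transpose * P * A * (1 - P) = 0 := by
      rw [mul_sub, mul_one, mul_assoc (g.transpose * P), hAP, ← mul_assoc, mul_assoc _ P P, hPP,
        sub_self]
    have e3 : (1 - P) * A * (P * g) = 0 := by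
      rw [mul_assoc, ← mul_assoc A, hAP, ← mul_assoc, ← mul_assoc, sub_mul, one_mul, hPP,
        sub_self, zero_mul, zero_mul]
    have e4 : (1 - P) * A * (1 - P) = A - P * A := by
      rw [sub_mul, one_mul, sub_mul, mul_sub, mul_sub, hPAP, mul_one, mul_one, hAP]
      abel
    rw [Matrix.transpose_add, Matrix.transpose_mul, Matrix.transpose_sub, Matrix.transpose_one,
      hPt, add_mul, add_mul, mul_add, mul_add, e1, e2, e3, e4]
    abel
  have hdet := congrArg Matrix.det key
  rw [Matrix.det_mul, Matrix.det_mul, Matrix.det_transpose] at hdet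
  have h0 := hA.det_pos.ne'
  refine mul_self_eq_one_iff.mp (mul_right_cancel₀ h0 ?_)
  rw [one_mul, mul_right_comm, hdet]

-- The residual space is cut out by conditions on the supports of `v` and of `M v`; `g` preserves
-- the first, and `gᵀ`, which carries `M g v` to `M v`, preserves the second and is invertible.
omit [Fintype ι] in
theorem mulVec_mem_residual (h : IsBlockIsometry cls M g) (hM : IsUnit M) {a : ι}
    {v : Fin m → ℝ} (hv : v ∈ residual cls M a) : g.mulVec v ∈ residual cls M a := by
  have hP : ∀ w : Fin m → ℝ, (∀ i, cls i ≠ a → w i = 0) ↔ (classProj cls a).mulVec w = w := by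
    intro w
    rw [funext_iff]
    refine forall_congr' fun i => ?_
    rw [classProj_mulVec]
    by_cases hi : cls i = a
    · simp [hi]
    · simp [hi, eq_comm]
  obtain ⟨h1, h2⟩ := hv
  refine ⟨(hP _).mpr ?_, (hP _).mpr ?_⟩
  · rw [Matrix.mulVec_mulVec, ← h.isBlock.commute, ← Matrix.mulVec_mulVec, (hP v).mp h1]
  · have hg : Function.Injective g.transpose.mulVec := by
      refine Matrix.mulVec_injective_iff_isUnit.mpr ?_
      exact (Matrix.isUnit_transpose g).mpr (h.isUnit hM)
    refine hg ?_
    have e : g.transpose.mulVec (M.mulVec (g.mulVec v)) = M.mulVec v := by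
      rw [Matrix.mulVec_mulVec, Matrix.mulVec_mulVec, h.isometry]
    rw [Matrix.mulVec_mulVec, h.isBlock.transpose.commute, ← Matrix.mulVec_mulVec, e, (hP _).mp h2]

end IsBlockIsometry

end Blocks

/-! ### The frame of an isometry group of a form in block normal form -/

section

variable {ι : Type} [Fintype ι] [DecidableEq ι] {n : ι → ℕ}

/-- The columns of `J` are orthonormal for `M`; the matrix acts orthogonally on their span and
trivially on its `M`-orthogonal complement, the kernel of `Jᵀ M`. -/
theorem frameMatrix_isometry {M : Matrix (Fin m) (Fin m) ℝ} (hM : M.transpose = M)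
    {J : Matrix (Fin m) (Σ a, Fin (n a)) ℝ} (hJ : J.transpose * M * J = 1)
    {s : (a : ι) → Matrix (Fin (n a)) (Fin (n a)) ℝ} (hs : ∀ a, (s a).transpose * s a = 1) :
    (frameMatrix J (J.transpose * M) s).transpose * M * frameMatrix J (J.transpose * M) s = M := by
  set D := Matrix.blockDiagonal' s with hD
  have hDD : D.transpose * D = 1 := by
    rw [hD, Matrix.blockDiagonal'_transpose, ← Matrix.blockDiagonal'_mul,
      ← Matrix.blockDiagonal'_one]
    congr 1
    funext a
    exact hs a
  have e : (frameMatrix J (J.transpose * M) s).transpose =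
      1 + M * J * (D.transpose - 1) * J.transpose := by
    simp only [frameMatrix, Matrix.transpose_add, Matrix.transpose_mul, Matrix.transpose_sub,
      Matrix.transpose_one, Matrix.transpose_transpose, hM, ← hD, Matrix.mul_assoc]
  have e2 : M * J * (D.transpose - 1) * J.transpose * M * (J * (D - 1) * (J.transpose * M)) =
      M * J * ((D.transpose - 1) * (D - 1)) * (J.transpose * M) := by
    calc _ = M * J * (D.transpose - 1) * (J.transpose * M * J) * (D - 1) * (J.transpose * M) := by
          simp only [Matrix.mul_assoc]
      _ = _ := by rw [hJ, Matrix.mul_one]; simp only [Matrix.mul_assoc]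
  have e3 : (D.transpose - 1) * (D - 1) = - (D.transpose - 1) - (D - 1) := by
    rw [sub_mul, mul_sub, hDD, one_mul, mul_one]
    abel
  rw [e, frameMatrix, ← hD, Matrix.mul_add, Matrix.mul_one, Matrix.add_mul, Matrix.add_mul,
    Matrix.one_mul, e2, e3]
  simp only [Matrix.mul_sub, Matrix.sub_mul, Matrix.mul_neg, Matrix.neg_mul, Matrix.mul_assoc]
  abel

variable {cls : Fin m → ι} {M : Matrix (Fin m) (Fin m) ℝ}

/-- Residual spaces of different classes have disjoint supports and are orthogonal for the block
diagonal form, so orthonormal bases of them can be concatenated. -/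
theorem exists_residual_frame (hM : M.PosDef)
    (hn : ∀ a, Module.finrank ℝ (residual cls M a) = n a) :
    ∃ J : Matrix (Fin m) (Σ a, Fin (n a)) ℝ, J.transpose * blockPart cls M * J = 1 ∧
      (∀ k : Σ a, Fin (n a), (fun i => J i k) ∈ residual cls M k.1) ∧
      ∀ a, ∀ v ∈ residual cls M a,
        v = J.mulVec ((J.transpose * blockPart cls M).mulVec v) := by
  have hA := posDef_blockPart (cls := cls) hM
  choose J hJ1 hJ2 hJ3 using fun a => exists_orthonormal_frame hA (residual cls M a) (hn a)
  have horth : ∀ a b, a ≠ b → ∀ v ∈ residual cls M a, ∀ k : Fin (n b),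
      ((J b).transpose * blockPart cls M).mulVec v k = 0 := by
    intro a b hab v hv k
    change ∑ j, ((J b).transpose * blockPart cls M) k j * v j = 0
    refine Finset.sum_eq_zero fun j _ => ?_
    by_cases hj : cls j = a
    · rw [Matrix.mul_apply, Finset.sum_eq_zero, zero_mul]
      intro i _
      by_cases hi : cls i = b
      · rw [isBlock_blockPart M i j (by rw [hi, hj]; exact hab.symm), mul_zero]
      · have e : J b i k = 0 := (hJ2 b k).1 i hi
        rw [Matrix.transpose_apply, e, zero_mul]
    · rw [hv.1 j hj, mul_zero]
  refine ⟨Matrix.of fun i k => J k.1 i k.2, ?_, fun k => hJ2 k.1 k.2, ?_⟩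
  · ext ⟨a, k⟩ ⟨b, l⟩
    by_cases hab : b = a
    · subst hab
      have := congrFun (congrFun (hJ1 b) k) l
      simpa [Matrix.one_apply, Matrix.mul_apply] using this
    · rw [Matrix.one_apply_ne (by simp [Ne.symm hab])]
      exact horth b a hab _ (hJ2 b l) k
  · intro a v hv
    ext i
    change v i = ∑ k : Σ a, Fin (n a),
      J k.1 i k.2 * ((J k.1).transpose * blockPart cls M).mulVec v k.2
    rw [Fintype.sum_sigma, Finset.sum_eq_single a]
    · exact congrFun (hJ3 a v hv) i
    · intro b _ hb
      refine Finset.sum_eq_zero fun k _ => ?_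
      rw [horth a b hb.symm v hv k, mul_zero]
    · simp

-- Residual vectors pair to zero under `M` with all other classes, so on them `M` and its block
-- diagonal part agree. Rotations of the frame are therefore isometries of `M` itself.
omit [Fintype ι] in
theorem transpose_mul_blockPart_eq {J : Matrix (Fin m) (Σ a, Fin (n a)) ℝ}
    (hM : M.transpose = M) (hJ : ∀ k : Σ a, Fin (n a), (fun i => J i k) ∈ residual cls M k.1) :
    J.transpose * blockPart cls M = J.transpose * M := by
  ext k j
  by_cases hj : cls j = k.1
  · rw [Matrix.mul_apply, Matrix.mul_apply]
    refine Finset.sum_congr rfl fun i _ => ?_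
    by_cases hi : cls i = k.1
    · simp [blockPart, hi, hj]
    · have e : J i k = 0 := (hJ k).1 i hi
      rw [Matrix.transpose_apply, e, zero_mul, zero_mul]
  · have h1 : (J.transpose * M) k j = M.mulVec (fun i => J i k) j := by
      rw [← Matrix.vecMul_transpose, hM]
      rfl
    rw [h1, (hJ k).2 j hj, Matrix.mul_apply]
    refine Finset.sum_eq_zero fun i _ => ?_
    by_cases hi : cls i = k.1
    · rw [isBlock_blockPart M i j (by rw [hi]; exact Ne.symm hj), mul_zero]
    · have e : J i k = 0 := (hJ k).1 i hi
      rw [Matrix.transpose_apply, e, zero_mul]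

/-- The coupling condition between the classes under which the isometries are rigid: a class is
tame without residual vectors, or all classes coupled to it are tame. -/
def IsRigidlyCoupled (cls : Fin m → ι) (M : Matrix (Fin m) (Fin m) ℝ) : Prop :=
  ∀ a, IsTame cls M a ∨
    ∀ b, b ≠ a → (∃ i j, cls i = a ∧ cls j = b ∧ M i j ≠ 0) → IsTame cls M b

namespace IsBlockIsometry

variable {g : Matrix (Fin m) (Fin m) ℝ}

/-- The matrix `J Jᵀ A` projects onto the residual spaces, so the claim is that `g - 1` depends only
on this projection. Equivalently, the rows of `(g - 1) P_a A⁻¹` are residual vectors of `a`. -/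
theorem sub_one_mul_frame (h : IsBlockIsometry cls M g) (hM : M.PosDef)
    (hc : IsRigidlyCoupled cls M)
    (htame : ∀ a, IsTame cls M a → g * classProj cls a = classProj cls a)
    {J : Matrix (Fin m) (Σ a, Fin (n a)) ℝ}
    (hJ : ∀ a, ∀ v ∈ residual cls M a,
      v = J.mulVec ((J.transpose * blockPart cls M).mulVec v)) :
    (g - 1) * J * (J.transpose * blockPart cls M) = g - 1 := by
  have hA := posDef_blockPart (cls := cls) hM
  have hMt := transpose_eq_of_posDef hM
  have hAt := blockPart_transpose (cls := cls) hMt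
  have hA' := (Matrix.isUnit_iff_isUnit_det _).mp hA.isUnit
  have hAblock := isBlock_blockPart (cls := cls) M
  have hP : ∀ a, IsTame cls M a → (g - 1) * classProj cls a = 0 := fun a ha => by
    rw [sub_mul, htame a ha, one_mul, sub_self]
  have hAinv : ∀ a, (blockPart cls M)⁻¹ * classProj cls a =
      classProj cls a * (blockPart cls M)⁻¹ := by
    intro a
    refine hA.isUnit.mul_left_cancel (hA.isUnit.mul_right_cancel ?_)
    rw [← mul_assoc, Matrix.mul_nonsing_inv _ hA', one_mul, mul_assoc, mul_assoc,
      Matrix.nonsing_inv_mul _ hA', mul_one, hAblock.commute]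
  -- If `a` is tame, `(g - 1) P_a` vanishes. If `b` is tame, `g - 1` is moved past `A⁻¹ M` and kills
  -- `P_b`. Otherwise rigid coupling says that `M` has no entries between `a` and `b`.
  have hcross : ∀ a b, b ≠ a →
      (g - 1) * classProj cls a * (blockPart cls M)⁻¹ * M * classProj cls b = 0 := by
    intro a b hab
    have hcomm : (g - 1) * ((blockPart cls M)⁻¹ * M) = (blockPart cls M)⁻¹ * M * (g - 1) := by
      rw [sub_mul, mul_sub, h.commute_inv_mul hA.isUnit, one_mul, mul_one]
    rcases hc a with ha | ha
    · rw [hP a ha, zero_mul, zero_mul, zero_mul]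
    · by_cases hb : IsTame cls M b
      · have hcommP : (g - 1) * classProj cls a = classProj cls a * (g - 1) := by
          rw [sub_mul, mul_sub, h.isBlock.commute, one_mul, mul_one]
        calc _ = classProj cls a * ((g - 1) * ((blockPart cls M)⁻¹ * M)) * classProj cls b := by
              rw [hcommP]; simp only [mul_assoc]
          _ = classProj cls a * ((blockPart cls M)⁻¹ * M) * ((g - 1) * classProj cls b) := by
              rw [hcomm]; simp only [mul_assoc]
          _ = 0 := by rw [hP b hb, mul_zero]
      · have h0 : classProj cls a * M * classProj cls b = 0 := by
          ext i j
          rw [mul_classProj_apply, classProj_mul_apply]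
          split_ifs with h1 h2
          · by_contra hne
            exact hb (ha b hab ⟨i, j, h2, h1, hne⟩)
          · rfl
          · rfl
        calc _ = (g - 1) * (classProj cls a * (blockPart cls M)⁻¹) * M * classProj cls b := by
              simp only [mul_assoc]
          _ = (g - 1) * (blockPart cls M)⁻¹ * (classProj cls a * M * classProj cls b) := by
              rw [← hAinv]; simp only [mul_assoc]
          _ = 0 := by rw [h0, mul_zero]
  have hrow : ∀ a, (g - 1) * classProj cls a * J * (J.transpose * blockPart cls M) =
      (g - 1) * classProj cls a := by
    intro a
    obtain ⟨Y, hY⟩ : ∃ Y, Y = (g - 1) * classProj cls a := ⟨_, rfl⟩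
    rw [← hY]
    have hYP : Y * classProj cls a = Y := by rw [hY, mul_assoc, classProj_mul_self]
    ext i j
    set v : Fin m → ℝ := fun j => (Y * (blockPart cls M)⁻¹) i j with hv
    have hvres : v ∈ residual cls M a := by
      constructor
      · intro j hj
        have : Y * (blockPart cls M)⁻¹ = Y * (blockPart cls M)⁻¹ * classProj cls a := by
          rw [mul_assoc, hAinv, ← mul_assoc, hYP]
        simp only [hv]
        rw [this, mul_classProj_apply, if_neg hj]
      · intro j hj
        have h1 := congrFun (congrFun (hcross a (cls j) hj) i) j
        rw [mul_classProj_apply, if_pos rfl, ← hY] at h1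
        rw [← Matrix.vecMul_transpose, hMt]
        exact h1
    have h2 := hJ a v hvres
    have h3 : Y i = Matrix.vecMul v (blockPart cls M) := by
      have : Y = Y * (blockPart cls M)⁻¹ * blockPart cls M := by
        rw [mul_assoc, Matrix.nonsing_inv_mul _ hA', mul_one]
      conv_lhs => rw [this]
      rfl
    have h4 : (Y * J * (J.transpose * blockPart cls M)) i =
        Matrix.vecMul (Y i) (J * (J.transpose * blockPart cls M)) := by
      rw [Matrix.mul_assoc]
      rfl
    have h5 : v = Matrix.vecMul v (blockPart cls M * J * J.transpose) := by
      conv_lhs => rw [h2]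
      rw [Matrix.mulVec_mulVec, ← Matrix.vecMul_transpose]
      simp only [Matrix.transpose_mul, Matrix.transpose_transpose, hAt]
    rw [h4]
    conv_rhs => rw [h3, h5]
    rw [h3, Matrix.vecMul_vecMul, Matrix.vecMul_vecMul]
    simp only [Matrix.mul_assoc]
  have hsum : g - 1 = ∑ a, (g - 1) * classProj cls a := by
    rw [← Finset.mul_sum, sum_classProj, mul_one]
  conv_lhs => rw [hsum]
  rw [Matrix.sum_mul, Matrix.sum_mul]
  simp only [hrow]
  exact hsum.symm

/-- A block diagonal isometry that is the identity on the tame classes and has determinant one on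
all classes is a product of rotations along the residual frame. -/
theorem exists_eq_frameMatrix (h : IsBlockIsometry cls M g) (hM : M.PosDef)
    (hc : IsRigidlyCoupled cls M)
    (htame : ∀ a, IsTame cls M a → g * classProj cls a = classProj cls a)
    (hdet : ∀ a, (classProj cls a * g + (1 - classProj cls a)).det = 1)
    {J : Matrix (Fin m) (Σ a, Fin (n a)) ℝ} (hJ1 : J.transpose * blockPart cls M * J = 1)
    (hJ2 : ∀ k : Σ a, Fin (n a), (fun i => J i k) ∈ residual cls M k.1)
    (hJ3 : ∀ a, ∀ v ∈ residual cls M a,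
      v = J.mulVec ((J.transpose * blockPart cls M).mulVec v)) :
    ∃ s : (a : ι) → Matrix.specialOrthogonalGroup (Fin (n a)) ℝ,
      g = frameMatrix J (J.transpose * M) fun a => (s a).val := by
  have hMt := transpose_eq_of_posDef hM
  have hY := h.sub_one_mul_frame hM hc htame hJ3
  have hAb := isBlock_blockPart (cls := cls) M
  set A := blockPart cls M with hA
  set D := J.transpose * A * g * J with hD
  -- Since `g` preserves the residual spaces, it acts on the frame through a matrix `D`.
  have hgJ : g * J = J * D := by
    ext i k
    have h1 := congrFun (hJ3 k.1 _ (h.mulVec_mem_residual hM.isUnit (hJ2 k))) i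
    have h2 : (g * J) i k = g.mulVec (fun i => J i k) i := rfl
    have h3 : (J * D) i k = (J * (J.transpose * A) * g).mulVec (fun i => J i k) i := by
      have e : J * D = J * (J.transpose * A) * g * J := by
        rw [hD]
        simp only [Matrix.mul_assoc]
      rw [e]
      rfl
    rw [h2, h3, h1, Matrix.mulVec_mulVec, Matrix.mulVec_mulVec, ← Matrix.mul_assoc]
  have hDblock : Matrix.blockDiagonal' (Matrix.blockDiag' D) = D := by
    ext ⟨a, k⟩ ⟨b, l⟩
    by_cases hab : a = b
    · subst hab
      rw [Matrix.blockDiagonal'_apply_eq, Matrix.blockDiag'_apply]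
    · rw [Matrix.blockDiagonal'_apply_ne _ _ _ hab, hD, Matrix.mul_assoc, Matrix.mul_apply]
      symm
      refine Finset.sum_eq_zero fun i _ => ?_
      by_cases hi : cls i = b
      · rw [Matrix.mul_apply, Finset.sum_eq_zero, zero_mul]
        intro j _
        by_cases hj : cls j = a
        · rw [hAb j i (by rw [hi, hj]; exact hab), mul_zero]
        · have e : J j ⟨a, k⟩ = 0 := (hJ2 ⟨a, k⟩).1 j hj
          rw [Matrix.transpose_apply, e, zero_mul]
      · have : (g * J) i ⟨b, l⟩ = g.mulVec (fun i => J i ⟨b, l⟩) i := rfl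
        rw [this, (h.mulVec_mem_residual hM.isUnit (hJ2 ⟨b, l⟩)).1 i hi, mul_zero]
  have hgeq : g = frameMatrix J (J.transpose * M) (Matrix.blockDiag' D) := by
    rw [frameMatrix, hDblock, ← transpose_mul_blockPart_eq hMt hJ2, Matrix.mul_sub, ← hgJ,
      Matrix.mul_one]
    rw [Matrix.sub_mul, Matrix.one_mul] at hY
    rw [hY]
    abel
  have hDD : D.transpose * D = 1 := by
    have h1 : D = J.transpose * A * (J * D) := by
      rw [← Matrix.mul_assoc, hJ1, Matrix.one_mul]
    have hAt : A.transpose = A := blockPart_transpose hMt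
    calc D.transpose * D = D.transpose * (J.transpose * A * (J * D)) := by rw [← h1]
      _ = (J * D).transpose * A * (J * D) := by
        rw [Matrix.transpose_mul J D]; simp only [Matrix.mul_assoc]
      _ = J.transpose * (g.transpose * A * g) * J := by
        rw [← hgJ, Matrix.transpose_mul]; simp only [Matrix.mul_assoc]
      _ = 1 := by rw [h.blockPart_isometry, hJ1]
  have horth : ∀ a, (Matrix.blockDiag' D a).transpose * Matrix.blockDiag' D a = 1 := by
    rw [← hDblock, Matrix.blockDiagonal'_transpose, ← Matrix.blockDiagonal'_mul,
      ← Matrix.blockDiagonal'_one] at hDD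
    exact fun a => congrFun (Matrix.blockDiagonal'_injective hDD) a
  -- By `det (1 + XY) = det (1 + YX)`, the determinant of `g` on the class `a` equals that of the
  -- block of `D` on the frame vectors of `a`; `E` includes these into the whole frame.
  have hdetD : ∀ a, (Matrix.blockDiag' D a).det = 1 := by
    intro a
    let e : Fin (n a) → Σ b, Fin (n b) := fun k => ⟨a, k⟩
    let E : Matrix (Σ b, Fin (n b)) (Fin (n a)) ℝ :=
      (1 : Matrix (Σ b, Fin (n b)) (Σ b, Fin (n b)) ℝ).submatrix id e
    have hE : ∀ X : Matrix (Σ b, Fin (n b)) (Σ b, Fin (n b)) ℝ,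
        E.transpose * X * E = X.submatrix e e := by
      intro X
      ext k l
      simp [E, Matrix.mul_apply, Matrix.one_apply]
    have hPJ : (classProj cls a * J) * (D - 1) =
        J * E * ((E.transpose * (D - 1) * E) * E.transpose) := by
      rw [hE]
      ext i ⟨b, l⟩
      have hPa : ∀ c (k : Fin (n c)), c ≠ a → (classProj cls a * J) i ⟨c, k⟩ = 0 := by
        intro c k hc
        rw [classProj_mul_apply]
        split_ifs with hi
        · exact (hJ2 ⟨c, k⟩).1 i (by rw [hi]; exact hc.symm)
        · rfl
      have hPa' : ∀ k, (classProj cls a * J) i (e k) = J i (e k) := by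
        intro k
        rw [classProj_mul_apply]
        split_ifs with hi
        · rfl
        · exact ((hJ2 ⟨a, k⟩).1 i hi).symm
      have hJE : ∀ k, (J * E) i k = J i (e k) := fun k => by
        simp [E, Matrix.mul_apply, Matrix.one_apply]
      have hX : ∀ k, ((D - 1).submatrix e e * E.transpose) k ⟨b, l⟩ = (D - 1) (e k) ⟨b, l⟩ := by
        intro k
        by_cases hb : b = a
        · subst hb
          simp [E, e, Matrix.mul_apply, Matrix.one_apply]
        · have h0 : (D - 1) (e k) ⟨b, l⟩ = 0 := by
            rw [← hDblock, ← Matrix.blockDiagonal'_one, ← Matrix.blockDiagonal'_sub,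
              Matrix.blockDiagonal'_apply_ne _ _ _ (Ne.symm hb)]
          rw [h0, Matrix.mul_apply]
          refine Finset.sum_eq_zero fun p _ => ?_
          simp [E, e, Matrix.one_apply, hb]
      rw [Matrix.mul_apply, Matrix.mul_apply, Fintype.sum_sigma, Finset.sum_eq_single a]
      · exact Finset.sum_congr rfl fun k _ => by rw [hPa' k, hJE, hX]
      · intro c _ hc
        exact Finset.sum_eq_zero fun k _ => by rw [hPa c k hc, zero_mul]
      · simp
    have h1 := hdet a
    have h2 : classProj cls a * g + (1 - classProj cls a) =
        1 + (J * E) * (E.transpose * (D - 1) * E * (E.transpose * (J.transpose * A))) := by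
      have : classProj cls a * g = classProj cls a +
          (classProj cls a * J) * (D - 1) * (J.transpose * A) := by
        conv_lhs => rw [hgeq, frameMatrix, hDblock, ← transpose_mul_blockPart_eq hMt hJ2]
        rw [Matrix.mul_add, Matrix.mul_one]
        simp only [Matrix.mul_assoc, hA]
      rw [this, hPJ]
      simp only [Matrix.mul_assoc]
      abel
    have h3 : E.transpose * (J.transpose * A) * (J * E) = 1 := by
      calc _ = E.transpose * (J.transpose * A * J) * E := by simp only [Matrix.mul_assoc]
        _ = 1 := by
          rw [hJ1, hE]
          exact Matrix.submatrix_one e fun x y h => by simpa [e] using h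
    rw [h2, Matrix.det_one_add_mul_comm, Matrix.mul_assoc, h3, Matrix.mul_one, hE] at h1
    rw [← h1]
    congr 1
    ext k l
    simp [Matrix.blockDiag'_apply, Matrix.one_apply, e]
  refine ⟨fun a => ⟨Matrix.blockDiag' D a,
    mem_specialOrthogonalGroup_iff_transpose.mpr ⟨horth a, hdetD a⟩⟩, hgeq⟩

end IsBlockIsometry

end

/-! ### Polynomial functions of a matrix -/

/-- The function is given by a polynomial in the matrix entries. -/
def IsPolyFun (f : Matrix (Fin m) (Fin m) ℝ → ℝ) : Prop :=
  ∃ p : MvPolynomial (Fin m × Fin m) ℝ, ∀ A, evalMatrix p A = f A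

namespace IsPolyFun

variable {f g : Matrix (Fin m) (Fin m) ℝ → ℝ}

theorem entry (i j : Fin m) : IsPolyFun fun A : Matrix (Fin m) (Fin m) ℝ => A i j :=
  ⟨MvPolynomial.X (i, j), fun A => by simp [evalMatrix]⟩

theorem const (c : ℝ) : IsPolyFun fun _ : Matrix (Fin m) (Fin m) ℝ => c :=
  ⟨MvPolynomial.C c, fun A => by simp [evalMatrix]⟩

theorem add (hf : IsPolyFun f) (hg : IsPolyFun g) : IsPolyFun fun A => f A + g A := by
  obtain ⟨p, hp⟩ := hf
  obtain ⟨q, hq⟩ := hg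
  exact ⟨p + q, fun A => by simp [evalMatrix, ← hp, ← hq]⟩

theorem mul (hf : IsPolyFun f) (hg : IsPolyFun g) : IsPolyFun fun A => f A * g A := by
  obtain ⟨p, hp⟩ := hf
  obtain ⟨q, hq⟩ := hg
  exact ⟨p * q, fun A => by simp [evalMatrix, ← hp, ← hq]⟩

theorem sub (hf : IsPolyFun f) (hg : IsPolyFun g) : IsPolyFun fun A => f A - g A := by
  obtain ⟨p, hp⟩ := hf
  obtain ⟨q, hq⟩ := hg
  exact ⟨p - q, fun A => by simp [evalMatrix, ← hp, ← hq]⟩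

theorem sum {κ : Type*} (s : Finset κ) {f : κ → Matrix (Fin m) (Fin m) ℝ → ℝ}
    (hf : ∀ k ∈ s, IsPolyFun (f k)) : IsPolyFun fun A => ∑ k ∈ s, f k A := by
  classical
  induction s using Finset.induction_on with
  | empty => simpa using const 0
  | insert k s hk ih =>
    simp only [Finset.sum_insert hk]
    exact (hf k (by simp)).add (ih fun l hl => hf l (by simp [hl]))

theorem prod {κ : Type*} (s : Finset κ) {f : κ → Matrix (Fin m) (Fin m) ℝ → ℝ}
    (hf : ∀ k ∈ s, IsPolyFun (f k)) : IsPolyFun fun A => ∏ k ∈ s, f k A := by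
  classical
  induction s using Finset.induction_on with
  | empty => simpa using const 1
  | insert k s hk ih =>
    simp only [Finset.prod_insert hk]
    exact (hf k (by simp)).mul (ih fun l hl => hf l (by simp [hl]))

theorem ite {c : Prop} [Decidable c] (hf : c → IsPolyFun f) (hg : ¬ c → IsPolyFun g) :
    IsPolyFun fun A => if c then f A else g A := by
  split_ifs with h
  · exact hf h
  · exact hg h

end IsPolyFun

/-- All entries of the matrix-valued function are polynomials in the matrix entries. -/
def IsPolyMat {k l : Type*} (F : Matrix (Fin m) (Fin m) ℝ → Matrix k l ℝ) : Prop :=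
  ∀ i j, IsPolyFun fun A => F A i j

namespace IsPolyMat

variable {k l r : Type*}

theorem id : IsPolyMat fun A : Matrix (Fin m) (Fin m) ℝ => A := IsPolyFun.entry

theorem const (B : Matrix k l ℝ) : IsPolyMat fun _ : Matrix (Fin m) (Fin m) ℝ => B :=
  fun i j => IsPolyFun.const (B i j)

theorem add {F G : Matrix (Fin m) (Fin m) ℝ → Matrix k l ℝ} (hF : IsPolyMat F)
    (hG : IsPolyMat G) : IsPolyMat fun A => F A + G A :=
  fun i j => (hF i j).add (hG i j)

theorem transpose {F : Matrix (Fin m) (Fin m) ℝ → Matrix k l ℝ} (hF : IsPolyMat F) :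
    IsPolyMat fun A => (F A).transpose :=
  fun i j => hF j i

theorem mul [Fintype l] {F : Matrix (Fin m) (Fin m) ℝ → Matrix k l ℝ}
    {G : Matrix (Fin m) (Fin m) ℝ → Matrix l r ℝ} (hF : IsPolyMat F) (hG : IsPolyMat G) :
    IsPolyMat fun A => F A * G A := by
  intro i j
  simp only [Matrix.mul_apply]
  exact IsPolyFun.sum _ fun x _ => (hF i x).mul (hG x j)

theorem mulVec [Fintype l] {F : Matrix (Fin m) (Fin m) ℝ → Matrix k l ℝ}
    {v : Matrix (Fin m) (Fin m) ℝ → l → ℝ} (hF : IsPolyMat F)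
    (hv : ∀ i, IsPolyFun fun A => v A i) (i : k) : IsPolyFun fun A => (F A).mulVec (v A) i := by
  simp only [Matrix.mulVec, dotProduct]
  exact IsPolyFun.sum _ fun x _ => (hF i x).mul (hv x)

variable [Fintype k] [DecidableEq k] {F : Matrix (Fin m) (Fin m) ℝ → Matrix k k ℝ}

theorem det (hF : IsPolyMat F) : IsPolyFun fun A => (F A).det := by
  simp only [Matrix.det_apply']
  exact IsPolyFun.sum _ fun σ _ => (IsPolyFun.const _).mul (IsPolyFun.prod _ fun i _ => hF _ _)

omit [DecidableEq k] in
theorem trace (hF : IsPolyMat F) : IsPolyFun fun A => (F A).trace := by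
  simp only [Matrix.trace, Matrix.diag_apply]
  exact IsPolyFun.sum _ fun i _ => hF i i

theorem adjugate (hF : IsPolyMat F) : IsPolyMat fun A => (F A).adjugate := by
  intro i j
  simp only [Matrix.adjugate_apply]
  refine det fun x y => ?_
  simp only [Matrix.updateRow_apply]
  exact IsPolyFun.ite (fun _ => IsPolyFun.const _) fun _ => hF x y

theorem pow (hF : IsPolyMat F) (r : ℕ) : IsPolyMat fun A => F A ^ r := by
  induction r with
  | zero => simpa using const 1
  | succ r ih =>
    simp only [pow_succ]
    exact ih.mul hF

end IsPolyMat

/-! ### Block normal form of a concentration matrix -/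

section NormalForm

variable (𝒢 : SimpleGraph (Fin m))

/-- The strict order on vertices. -/
def vlt (i j : Fin m) : Prop := vle 𝒢 i j ∧ ¬ vle 𝒢 j i

open Classical in
/-- The principal submatrix of `K` on the vertices strictly above `l`, completed by the identity. -/
noncomputable def upperPart (K : Matrix (Fin m) (Fin m) ℝ) (l : Fin m) : Matrix (Fin m) (Fin m) ℝ :=
  Matrix.of fun i j => if vlt 𝒢 l i ∧ vlt 𝒢 l j then K i j else if i = j then 1 else 0

open Classical in
/-- The part of the column `l` of `K` strictly above `l`. -/
noncomputable def upperColumn (K : Matrix (Fin m) (Fin m) ℝ) (l : Fin m) : Fin m → ℝ :=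
  fun j => if vlt 𝒢 l j then K j l else 0

/-- The change of basis whose column `l` is orthogonal to all coordinate vectors strictly
above `l`. -/
noncomputable def normalizer (K : Matrix (Fin m) (Fin m) ℝ) : Matrix (Fin m) (Fin m) ℝ :=
  Matrix.of fun i l => (if i = l then (upperPart 𝒢 K l).det else 0) -
    (upperPart 𝒢 K l).adjugate.mulVec (upperColumn 𝒢 K l) i

/-- The form `K` after the change of basis. -/
noncomputable def normalForm (K : Matrix (Fin m) (Fin m) ℝ) : Matrix (Fin m) (Fin m) ℝ :=
  (normalizer 𝒢 K).transpose * K * normalizer 𝒢 K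

variable {𝒢}

theorem isPolyMat_upperPart (l : Fin m) : IsPolyMat fun K => upperPart 𝒢 K l := by
  intro i j
  simp only [upperPart, Matrix.of_apply]
  split_ifs
  · exact IsPolyFun.entry i j
  · exact IsPolyFun.const _
  · exact IsPolyFun.const _

theorem isPolyMat_normalizer : IsPolyMat (normalizer 𝒢) := by
  intro i l
  refine IsPolyFun.sub (IsPolyFun.ite (fun _ => (isPolyMat_upperPart l).det)
    fun _ => IsPolyFun.const _) ?_
  refine (isPolyMat_upperPart l).adjugate.mulVec (fun j => ?_) i
  exact @IsPolyFun.ite _ _ _ _ (Classical.propDecidable _) (fun _ => IsPolyFun.entry j l)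
    fun _ => IsPolyFun.const _

theorem isPolyMat_normalForm : IsPolyMat (normalForm 𝒢) :=
  (isPolyMat_normalizer.transpose.mul IsPolyMat.id).mul isPolyMat_normalizer

theorem vlt_of_vlt_of_vle {i j k : Fin m} (h : vlt 𝒢 i j) (h' : vle 𝒢 j k) : vlt 𝒢 i k :=
  ⟨vle_trans h.1 h', fun h'' => h.2 (vle_trans h' h'')⟩

theorem vlt_of_vle_of_vlt {i j k : Fin m} (h : vle 𝒢 i j) (h' : vlt 𝒢 j k) : vlt 𝒢 i k :=
  ⟨vle_trans h h'.1, fun h'' => h'.2 (vle_trans h'' h)⟩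

theorem eq_zero_of_dotProduct_mulVec {K : Matrix (Fin m) (Fin m) ℝ} (hK : K.PosDef)
    {x : Fin m → ℝ} (h : ∀ i, x i = 0 ∨ K.mulVec x i = 0) : x = 0 := by
  by_contra hx
  have h1 := hK.dotProduct_mulVec_pos hx
  rw [star_trivial, dotProduct, Finset.sum_eq_zero] at h1
  · exact lt_irrefl _ h1
  · intro i _
    rcases h i with h | h <;> simp [h]

/-- Completing the principal submatrix by the identity keeps the matrix size fixed and forces
solutions of systems with zero right-hand side off the vertices above `l` to be supported on these
vertices. -/
theorem upperPart_mulVec (K : Matrix (Fin m) (Fin m) ℝ) (l : Fin m) (x : Fin m → ℝ) (i : Fin m)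
    (hi : ¬ vlt 𝒢 l i) : (upperPart 𝒢 K l).mulVec x i = x i := by
  simp [upperPart, Matrix.mulVec, dotProduct, hi]

theorem upperPart_mulVec_of_vlt (K : Matrix (Fin m) (Fin m) ℝ) (l : Fin m) {x : Fin m → ℝ}
    (hx : ∀ i, ¬ vlt 𝒢 l i → x i = 0) (i : Fin m) (hi : vlt 𝒢 l i) :
    (upperPart 𝒢 K l).mulVec x i = K.mulVec x i := by
  simp only [upperPart, Matrix.mulVec, dotProduct, Matrix.of_apply]
  refine Finset.sum_congr rfl fun j _ => ?_
  by_cases hj : vlt 𝒢 l j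
  · rw [if_pos ⟨hi, hj⟩]
  · rw [hx j hj, mul_zero, mul_zero]

theorem det_upperPart_ne_zero {K : Matrix (Fin m) (Fin m) ℝ} (hK : K.PosDef) (l : Fin m) :
    (upperPart 𝒢 K l).det ≠ 0 := by
  intro h
  obtain ⟨x, hx, hx0⟩ := Matrix.exists_mulVec_eq_zero_iff.mpr h
  have hsupp : ∀ i, ¬ vlt 𝒢 l i → x i = 0 := fun i hi => by
    rw [← upperPart_mulVec K l x i hi, hx0, Pi.zero_apply]
  refine hx (eq_zero_of_dotProduct_mulVec hK fun i => ?_)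
  by_cases hi : vlt 𝒢 l i
  · right
    rw [← upperPart_mulVec_of_vlt K l hsupp i hi, hx0, Pi.zero_apply]
  · exact Or.inl (hsupp i hi)

theorem upperPart_mulVec_adjugate (K : Matrix (Fin m) (Fin m) ℝ) (l : Fin m) :
    (upperPart 𝒢 K l).mulVec ((upperPart 𝒢 K l).adjugate.mulVec (upperColumn 𝒢 K l)) =
      (upperPart 𝒢 K l).det • upperColumn 𝒢 K l := by
  rw [Matrix.mulVec_mulVec, Matrix.mul_adjugate, Matrix.smul_mulVec, Matrix.one_mulVec]

theorem adjugate_mulVec_eq_zero (K : Matrix (Fin m) (Fin m) ℝ) (l i : Fin m)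
    (hi : ¬ vlt 𝒢 l i) :
    (upperPart 𝒢 K l).adjugate.mulVec (upperColumn 𝒢 K l) i = 0 := by
  rw [← upperPart_mulVec K l (Matrix.mulVec _ _) i hi, upperPart_mulVec_adjugate]
  simp [upperColumn, hi]

theorem normalizer_eq_zero (K : Matrix (Fin m) (Fin m) ℝ) {i l : Fin m} (h : i ≠ l)
    (hi : ¬ vlt 𝒢 l i) : normalizer 𝒢 K i l = 0 := by
  simp [normalizer, h, adjugate_mulVec_eq_zero K l i hi]

theorem normalizer_self (K : Matrix (Fin m) (Fin m) ℝ) (l : Fin m) :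
    normalizer 𝒢 K l l = (upperPart 𝒢 K l).det := by
  simp [normalizer, adjugate_mulVec_eq_zero K l l fun h => h.2 h.1]

theorem normalizer_mem_patternAlgebra (K : Matrix (Fin m) (Fin m) ℝ) :
    normalizer 𝒢 K ∈ patternAlgebra 𝒢 := by
  intro i j hij
  refine normalizer_eq_zero K ?_ fun h => hij h.1
  rintro rfl
  exact hij (vle_refl 𝒢 i)

/-- The correction to the basis vector `l` solves the linear system on the vertices strictly above
`l` by Cramer's rule. Multiplying by the determinant instead of dividing keeps the change of basis
polynomial in `K`. -/
theorem mul_normalizer_eq_zero (K : Matrix (Fin m) (Fin m) ℝ) {i l : Fin m} (hi : vlt 𝒢 l i) :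
    (K * normalizer 𝒢 K) i l = 0 := by
  have h1 : (K * normalizer 𝒢 K) i l = (upperPart 𝒢 K l).det * K i l -
      K.mulVec ((upperPart 𝒢 K l).adjugate.mulVec (upperColumn 𝒢 K l)) i := by
    simp only [Matrix.mul_apply, normalizer, Matrix.of_apply, mul_sub, Finset.sum_sub_distrib]
    congr 1
    simp [mul_comm]
  rw [h1, ← upperPart_mulVec_of_vlt K l (adjugate_mulVec_eq_zero K l) i hi,
    upperPart_mulVec_adjugate]
  simp [upperColumn, hi]

/-- The matrix is triangular for the pre-order with nonzero diagonal. At a minimal vertex where a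
kernel vector is nonzero, only the diagonal term survives. -/
theorem isUnit_normalizer {K : Matrix (Fin m) (Fin m) ℝ} (hK : K.PosDef) :
    IsUnit (normalizer 𝒢 K) := by
  refine (Matrix.isUnit_iff_isUnit_det _).mpr (isUnit_iff_ne_zero.mpr fun h => ?_)
  obtain ⟨x, hx, hx0⟩ := Matrix.exists_mulVec_eq_zero_iff.mpr h
  refine hx ?_
  by_contra hne
  obtain ⟨i₀, hi₀⟩ := Function.ne_iff.mp hx
  have hwf : WellFounded (vlt 𝒢) := by
    have : IsTrans (Fin m) (vlt 𝒢) := ⟨fun a b c h h' => vlt_of_vlt_of_vle h h'.1⟩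
    have : Std.Irrefl (vlt 𝒢) := ⟨fun a h => h.2 h.1⟩
    exact Finite.wellFounded_of_trans_of_irrefl _
  obtain ⟨l, hl, hmin⟩ := hwf.has_min {i | x i ≠ 0} ⟨i₀, hi₀⟩
  have h2 := congrFun hx0 l
  rw [Matrix.mulVec, dotProduct, Finset.sum_eq_single l, normalizer_self] at h2
  · exact mul_ne_zero (det_upperPart_ne_zero hK l) hl h2
  · intro j _ hj
    by_cases h3 : x j = 0
    · rw [h3, mul_zero]
    · rw [normalizer_eq_zero K (Ne.symm hj) (hmin j h3), zero_mul]
  · simp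

theorem posDef_normalForm {K : Matrix (Fin m) (Fin m) ℝ} (hK : K.PosDef) :
    (normalForm 𝒢 K).PosDef := by
  have h := hK.conjTranspose_mul_mul_same (B := normalizer 𝒢 K)
    (Matrix.mulVec_injective_iff_isUnit.mpr (isUnit_normalizer hK))
  rwa [Matrix.conjTranspose_eq_transpose_of_trivial] at h

theorem normalForm_apply (K : Matrix (Fin m) (Fin m) ℝ) (i l : Fin m) :
    normalForm 𝒢 K i l = ∑ k, normalizer 𝒢 K k i * (K * normalizer 𝒢 K) k l := by
  rw [normalForm, Matrix.mul_assoc, Matrix.mul_apply]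
  rfl

/-- Column `i` of the normalizer lives on vertices weakly above `i`, hence strictly above `l`, and
there column `l` of `K * normalizer 𝒢 K` vanishes. -/
theorem normalForm_eq_zero_of_vlt (K : Matrix (Fin m) (Fin m) ℝ) {i l : Fin m}
    (h : vlt 𝒢 l i) : normalForm 𝒢 K i l = 0 := by
  rw [normalForm_apply]
  refine Finset.sum_eq_zero fun k _ => ?_
  by_cases hk : vle 𝒢 i k
  · rw [mul_normalizer_eq_zero K (vlt_of_vlt_of_vle h hk), mul_zero]
  · rw [normalizer_mem_patternAlgebra K k i hk, zero_mul]

theorem normalForm_symm {K : Matrix (Fin m) (Fin m) ℝ} (hK : K.PosDef) (i l : Fin m) :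
    normalForm 𝒢 K i l = normalForm 𝒢 K l i :=
  congrFun (congrFun (transpose_eq_of_posDef (posDef_normalForm (𝒢 := 𝒢) hK)) l) i

/-- Going down in the pre-order enlarges closed neighbourhoods. This is why the change of basis
creates no entries outside the graph. -/
theorem eq_or_adj_of_vle {i j k l : Fin m} (hik : vle 𝒢 i k) (hjl : vle 𝒢 j l)
    (h : k = l ∨ 𝒢.Adj k l) : i = j ∨ 𝒢.Adj i j := by
  have h1 : l ∈ insert i (𝒢.neighborSet i) := hik (by
    rcases h with rfl | h
    · exact Set.mem_insert _ _
    · exact Set.mem_insert_of_mem _ h)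
  have h2 : i ∈ insert j (𝒢.neighborSet j) := hjl (by
    rcases h1 with rfl | h1
    · exact Set.mem_insert _ _
    · exact Set.mem_insert_of_mem _ (show 𝒢.Adj l i from (show 𝒢.Adj i l from h1).symm))
  rcases h2 with h2 | h2
  · exact Or.inl h2
  · exact Or.inr (show 𝒢.Adj j i from h2).symm

/-- The incomparable neighbours in the quotient graph. -/
def IsSideNeighbor (𝒢 : SimpleGraph (Fin m)) (a b : VertexClass 𝒢) : Prop :=
  (quotientGraph 𝒢).Adj a b ∧ ¬ a ≤ b ∧ ¬ b ≤ a

theorem IsSideNeighbor.symm {a b : VertexClass 𝒢} (h : IsSideNeighbor 𝒢 a b) :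
    IsSideNeighbor 𝒢 b a := ⟨h.1.symm, h.2.2, h.2.1⟩

theorem isSideNeighbor_of_normalForm_ne_zero {K : Matrix (Fin m) (Fin m) ℝ}
    (hK : K ∈ concentrationCone 𝒢) {i j : Fin m} (hne : toClass 𝒢 i ≠ toClass 𝒢 j)
    (h : normalForm 𝒢 K i j ≠ 0) : IsSideNeighbor 𝒢 (toClass 𝒢 i) (toClass 𝒢 j) := by
  refine ⟨⟨hne, i, j, rfl, rfl, ?_⟩, fun hle => ?_, fun hle => ?_⟩
  · rw [normalForm_apply] at h
    obtain ⟨k, -, hk⟩ := Finset.exists_ne_zero_of_sum_ne_zero h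
    obtain ⟨hk1, hk2⟩ := mul_ne_zero_iff.mp hk
    rw [Matrix.mul_apply] at hk2
    obtain ⟨l, -, hl⟩ := Finset.exists_ne_zero_of_sum_ne_zero hk2
    obtain ⟨hl1, hl2⟩ := mul_ne_zero_iff.mp hl
    have h1 : vle 𝒢 i k := by
      by_contra hc
      exact hk1 (normalizer_mem_patternAlgebra K k i hc)
    have h2 : vle 𝒢 j l := by
      by_contra hc
      exact hl2 (normalizer_mem_patternAlgebra K l j hc)
    have h3 : k = l ∨ 𝒢.Adj k l := by
      by_contra hc
      push Not at hc
      exact hl1 (hK.2 k l hc.1 hc.2)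
    refine (eq_or_adj_of_vle h1 h2 h3).resolve_left ?_
    rintro rfl
    exact hne rfl
  · refine h ?_
    rw [normalForm_symm hK.1]
    exact normalForm_eq_zero_of_vlt K ⟨hle, fun hle' => hne (Quotient.sound ⟨hle, hle'⟩)⟩
  · exact h (normalForm_eq_zero_of_vlt K ⟨hle, fun hle' => hne (Quotient.sound ⟨hle', hle⟩)⟩)

/-- A lower triangular isometry of the normal form is block diagonal. -/
theorem isBlock_of_isometry {K : Matrix (Fin m) (Fin m) ℝ} (hK : K.PosDef) {g : GL (Fin m) ℝ}
    (hg : g.val ∈ patternAlgebra 𝒢)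
    (hiso : g.val.transpose * normalForm 𝒢 K * g.val = normalForm 𝒢 K) :
    IsBlock (toClass 𝒢) g.val := by
  classical
  set M := normalForm 𝒢 K with hM
  have hinv := inv_mem_patternAlgebra 𝒢 g hg
  have hMg : M * g.val = (g⁻¹ : GL (Fin m) ℝ).val.transpose * M := by
    have h1 : (g⁻¹ : GL (Fin m) ℝ).val.transpose * g.val.transpose = 1 := by
      rw [← Matrix.transpose_mul, ← Units.val_mul, mul_inv_cancel, Units.val_one,
        Matrix.transpose_one]
    conv_rhs => rw [← hiso, mul_assoc, ← mul_assoc, h1, one_mul]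
  -- Row `i` of the inverse transpose involves only vertices `j` weakly above `i`, and `M` vanishes
  -- between these and `l`.
  have hzero : ∀ i l, vlt 𝒢 l i → (M * g.val) i l = 0 := by
    intro i l hil
    rw [hMg, Matrix.mul_apply]
    refine Finset.sum_eq_zero fun j _ => ?_
    by_cases hj : vle 𝒢 i j
    · rw [hM, normalForm_eq_zero_of_vlt K (vlt_of_vlt_of_vle hil hj), mul_zero]
    · rw [Matrix.transpose_apply, hinv j i hj, zero_mul]
  intro i l hil
  by_cases hle : vle 𝒢 l i
  swap
  · exact hg i l hle
  have hlt : vlt 𝒢 l i := ⟨hle, fun h => hil (Quotient.sound ⟨h, hle⟩)⟩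
  -- The part `w` of column `l` strictly above `l` satisfies `(M w)_i = 0` wherever `w_i` may be
  -- nonzero, so `wᵀ M w = 0`.
  have hw : (fun i => if vlt 𝒢 l i then g.val i l else 0) = 0 := by
    refine eq_zero_of_dotProduct_mulVec (posDef_normalForm (𝒢 := 𝒢) hK) fun i => ?_
    by_cases hi : vlt 𝒢 l i
    · right
      refine Eq.trans ?_ (hzero i l hi)
      rw [Matrix.mul_apply, ← hM]
      change ∑ j, M i j * (if vlt 𝒢 l j then g.val j l else 0) = _
      refine Finset.sum_congr rfl fun j _ => ?_
      split_ifs with hj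
      · rfl
      · by_cases hlj : vle 𝒢 l j
        -- The omitted vertices `j` in the support of the column are equivalent to `l`, hence
        -- strictly below `i`, so `M i j` is zero.
        · have hji : vlt 𝒢 j i := by
            refine vlt_of_vle_of_vlt ?_ hi
            by_contra hc
            exact hj ⟨hlj, hc⟩
          rw [hM, normalForm_eq_zero_of_vlt K hji, zero_mul, zero_mul]
        · rw [hg j l hlj, mul_zero]
    · left
      simp [hi]
  have := congrFun hw i
  simpa [hlt] using this

end NormalForm

/-! ### The stabilizer of a sufficiently general concentration matrix -/

section Stabilizer

variable {𝒢 : SimpleGraph (Fin m)}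

noncomputable instance : DecidableEq (VertexClass 𝒢) := Classical.decEq _

/-- The vertices in a class. -/
noncomputable def classFinset (𝒢 : SimpleGraph (Fin m)) (a : VertexClass 𝒢) : Finset (Fin m) :=
  Finset.univ.filter fun i => toClass 𝒢 i = a

open Classical in
/-- The vertices in the incomparable neighbours of a class. -/
noncomputable def sideFinset (𝒢 : SimpleGraph (Fin m)) (a : VertexClass 𝒢) : Finset (Fin m) :=
  Finset.univ.filter fun i => IsSideNeighbor 𝒢 a (toClass 𝒢 i)

theorem mem_classFinset {a : VertexClass 𝒢} {i : Fin m} :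
    i ∈ classFinset 𝒢 a ↔ toClass 𝒢 i = a := by simp [classFinset]

theorem mem_sideFinset {a : VertexClass 𝒢} {i : Fin m} :
    i ∈ sideFinset 𝒢 a ↔ IsSideNeighbor 𝒢 a (toClass 𝒢 i) := by simp [sideFinset]

theorem classSize_eq_card (a : VertexClass 𝒢) : classSize 𝒢 a = (classFinset 𝒢 a).card := by
  rw [classSize, Nat.card_eq_fintype_card, Fintype.card_subtype]
  rfl

theorem nClass_eq (a : VertexClass 𝒢) :
    nClass 𝒢 a = (classFinset 𝒢 a).card - (sideFinset 𝒢 a).card := by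
  classical
  rw [nClass, classSize_eq_card]
  congr 1
  rw [Finset.card_eq_sum_card_fiberwise (f := toClass 𝒢)
    (t := Finset.univ.filter fun b => IsSideNeighbor 𝒢 a b)]
  · refine Finset.sum_congr (by
      ext b
      simp only [Finset.mem_filter, Finset.mem_univ, true_and]
      rfl) fun b hb => ?_
    rw [classSize_eq_card]
    congr 1
    ext i
    simp only [mem_classFinset, Finset.mem_filter, mem_sideFinset]
    constructor
    · rintro rfl
      exact ⟨(Finset.mem_filter.mp hb).2, rfl⟩
    · exact fun h => h.2
  · intro i hi
    simpa using mem_sideFinset.mp hi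

/-- No nonzero vector supported in `s` is orthogonal to all coordinate vectors in `t`. -/
def Separates (M : Matrix (Fin m) (Fin m) ℝ) (s t : Finset (Fin m)) : Prop :=
  ∀ v : Fin m → ℝ, (∀ i, i ∉ s → v i = 0) → (∀ j ∈ t, M.mulVec v j = 0) → v = 0

/-- The conditions on a concentration matrix under which its stabilizer is determined. -/
structure IsSufficientlyGeneral (𝒢 : SimpleGraph (Fin m)) (K : Matrix (Fin m) (Fin m) ℝ) :
    Prop where
  cyclic : ∀ a b, IsSideNeighbor 𝒢 a b → (classFinset 𝒢 a).card ≤ (classFinset 𝒢 b).card →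
    ∀ u, ∃ q : Polynomial ℝ, (classProj (toClass 𝒢) a).mulVec u =
      (Polynomial.aeval (crossOp (toClass 𝒢) (normalForm 𝒢 K) a b) q).mulVec
        ((classProj (toClass 𝒢) a).mulVec 1)
  separates_side : ∀ a, (sideFinset 𝒢 a).card ≤ (classFinset 𝒢 a).card →
    Separates (normalForm 𝒢 K) (sideFinset 𝒢 a) (classFinset 𝒢 a)
  separates_class : ∀ a, (classFinset 𝒢 a).card ≤ (sideFinset 𝒢 a).card →
    Separates (normalForm 𝒢 K) (classFinset 𝒢 a) (sideFinset 𝒢 a)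

variable {K : Matrix (Fin m) (Fin m) ℝ}

theorem residual_eq_bot {M : Matrix (Fin m) (Fin m) ℝ} {a : VertexClass 𝒢}
    (h : Separates M (classFinset 𝒢 a) (sideFinset 𝒢 a)) : residual (toClass 𝒢) M a = ⊥ := by
  refine (Submodule.eq_bot_iff _).mpr fun v hv => h v (fun i hi => hv.1 i ?_) fun j hj => hv.2 j ?_
  · exact fun h' => hi (mem_classFinset.mpr h')
  · exact (mem_sideFinset.mp hj).1.1.symm

/-- The residual space is the kernel of the block of `M` from the class to its side neighbours.
Separation says that the transpose of this block is injective, so it has full row rank, and rank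
plus nullity gives the dimension. -/
theorem finrank_residual_of_separates {M : Matrix (Fin m) (Fin m) ℝ} (hM : M.transpose = M)
    {a : VertexClass 𝒢}
    (hsupp : ∀ i j, toClass 𝒢 i = a → toClass 𝒢 j ≠ a → ¬ IsSideNeighbor 𝒢 a (toClass 𝒢 j) →
      M j i = 0)
    (h : Separates M (sideFinset 𝒢 a) (classFinset 𝒢 a)) :
    Module.finrank ℝ (residual (toClass 𝒢) M a) =
      (classFinset 𝒢 a).card - (sideFinset 𝒢 a).card := by
  classical
  let L : Matrix (sideFinset 𝒢 a) (classFinset 𝒢 a) ℝ := M.submatrix (↑) (↑)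
  let R : residual (toClass 𝒢) M a →ₗ[ℝ] (classFinset 𝒢 a → ℝ) :=
    { toFun := fun v i => v.val i
      map_add' := fun _ _ => rfl
      map_smul' := fun _ _ => rfl }
  have hext : ∀ (s : Finset (Fin m)) (v : Fin m → ℝ), (∀ i, i ∉ s → v i = 0) → ∀ j,
      M.mulVec v j = ∑ i : s, M j i * v i := by
    intro s v hv j
    rw [Finset.sum_coe_sort s fun i => M j i * v i]
    refine (Finset.sum_subset (Finset.subset_univ s) fun i _ hi => ?_).symm
    rw [hv i hi, mul_zero]
  have hmem : ∀ v ∈ residual (toClass 𝒢) M a, ∀ i, i ∉ classFinset 𝒢 a → v i = 0 :=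
    fun v hv i hi => hv.1 i fun h' => hi (mem_classFinset.mpr h')
  have hR : Function.Injective R := by
    intro v w hvw
    refine Subtype.ext (funext fun i => ?_)
    by_cases hi : i ∈ classFinset 𝒢 a
    · exact congrFun hvw ⟨i, hi⟩
    · rw [hmem v.1 v.2 i hi, hmem w.1 w.2 i hi]
  have hrange : LinearMap.range R = LinearMap.ker L.mulVecLin := by
    ext w
    constructor
    · rintro ⟨v, rfl⟩
      refine LinearMap.mem_ker.mpr (funext fun j => ?_)
      have h1 := v.2.2 j (mem_sideFinset.mp j.2).1.1.symm
      rw [hext _ _ (hmem v.1 v.2)] at h1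
      exact h1
    · intro hw
      let v : Fin m → ℝ := fun i => if hi : i ∈ classFinset 𝒢 a then w ⟨i, hi⟩ else 0
      have hv : ∀ i, i ∉ classFinset 𝒢 a → v i = 0 := fun i hi => by simp [v, hi]
      have hvw : ∀ i : classFinset 𝒢 a, v i = w i := fun i => by simp [v]
      refine ⟨⟨v, fun i hi => hv i fun h' => hi (mem_classFinset.mp h'), fun j hj => ?_⟩,
        funext hvw⟩
      rw [hext _ _ hv]
      by_cases hjs : IsSideNeighbor 𝒢 a (toClass 𝒢 j)
      · have h1 := congrFun (LinearMap.mem_ker.mp hw) ⟨j, mem_sideFinset.mpr hjs⟩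
        simp only [hvw]
        exact h1
      · refine Finset.sum_eq_zero fun i _ => ?_
        rw [hsupp i j (mem_classFinset.mp i.2) hj hjs, zero_mul]
  have hLt : Function.Injective L.transpose.mulVecLin := by
    refine (injective_iff_map_eq_zero _).mpr fun w hw => ?_
    let v : Fin m → ℝ := fun i => if hi : i ∈ sideFinset 𝒢 a then w ⟨i, hi⟩ else 0
    have hv : ∀ i, i ∉ sideFinset 𝒢 a → v i = 0 := fun i hi => by simp [v, hi]
    have hvw : ∀ i : sideFinset 𝒢 a, v i = w i := fun i => by simp [v]
    have hv0 := h v hv fun j hj => by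
      rw [hext _ _ hv]
      simp only [hvw]
      have h1 := congrFun hw ⟨j, hj⟩
      have h2 : ∀ i : sideFinset 𝒢 a, M j i = M i j := fun i => congrFun (congrFun hM i) j
      simp only [h2]
      exact h1
    funext i
    rw [← hvw, hv0]
    rfl
  have hrank : L.rank = (sideFinset 𝒢 a).card := by
    rw [← Matrix.rank_transpose, Matrix.rank, LinearMap.finrank_range_of_inj hLt,
      Module.finrank_fintype_fun_eq_card, Fintype.card_coe]
  have hnull := LinearMap.finrank_range_add_finrank_ker L.mulVecLin
  rw [← hrange, LinearMap.finrank_range_of_inj hR, Module.finrank_fintype_fun_eq_card,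
    Fintype.card_coe] at hnull
  have : Module.finrank ℝ (LinearMap.range L.mulVecLin) = (sideFinset 𝒢 a).card := hrank
  omega

theorem finrank_residual (hK : K ∈ concentrationCone 𝒢) (hg : IsSufficientlyGeneral 𝒢 K)
    (a : VertexClass 𝒢) :
    Module.finrank ℝ (residual (toClass 𝒢) (normalForm 𝒢 K) a) = nClass 𝒢 a := by
  rw [nClass_eq]
  rcases le_total (sideFinset 𝒢 a).card (classFinset 𝒢 a).card with h | h
  · refine finrank_residual_of_separates (transpose_eq_of_posDef (posDef_normalForm hK.1)) ?_
      (hg.separates_side a h)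
    intro i j hi hj hij
    by_contra hne
    have := isSideNeighbor_of_normalForm_ne_zero hK (by rw [hi]; exact hj) hne
    rw [hi] at this
    exact hij this.symm
  · rw [residual_eq_bot (hg.separates_class a h), finrank_bot, Nat.sub_eq_zero_of_le h]

/-- Either `a` has a side neighbour at least as large, through which it is tame, or it is larger
than all its side neighbours, which are then tame through `a`. -/
theorem isRigidlyCoupled_normalForm (hK : K ∈ concentrationCone 𝒢)
    (hg : IsSufficientlyGeneral 𝒢 K) :
    IsRigidlyCoupled (toClass 𝒢) (normalForm 𝒢 K) := by
  intro a
  by_cases h : ∃ b, IsSideNeighbor 𝒢 a b ∧ (classFinset 𝒢 a).card ≤ (classFinset 𝒢 b).card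
  · obtain ⟨b, hb, hle⟩ := h
    exact Or.inl ⟨b, hg.cyclic a b hb hle⟩
  · push Not at h
    right
    rintro b hab ⟨i, j, rfl, rfl, hne⟩
    have hs := isSideNeighbor_of_normalForm_ne_zero hK hab.symm hne
    exact ⟨toClass 𝒢 i, hg.cyclic _ _ hs.symm (h _ hs).le⟩

theorem mem_G0Stabilizer {g : GL (Fin m) ℝ} :
    g ∈ G0Stabilizer 𝒢 K ↔ g.val ∈ patternAlgebra 𝒢 ∧ g.val.transpose * K * g.val = K := by
  refine and_congr Iff.rfl ?_
  have h1 : g.val * (g⁻¹ : GL (Fin m) ℝ).val = 1 := g.mul_inv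
  have h2 : (g⁻¹ : GL (Fin m) ℝ).val * g.val = 1 := g.inv_mul
  have h1' := congrArg Matrix.transpose h1
  have h2' := congrArg Matrix.transpose h2
  rw [Matrix.transpose_mul, Matrix.transpose_one] at h1' h2'
  constructor
  · intro h
    unfold act at h
    conv_lhs => rw [← h]
    calc _ = (g.val.transpose * (g⁻¹ : GL (Fin m) ℝ).val.transpose) * K *
          ((g⁻¹ : GL (Fin m) ℝ).val * g.val) := by simp only [mul_assoc]
      _ = K := by rw [h2', h2, one_mul, mul_one]
  · intro h
    unfold act
    conv_lhs => rw [← h]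
    calc _ = ((g⁻¹ : GL (Fin m) ℝ).val.transpose * g.val.transpose) * K *
          (g.val * (g⁻¹ : GL (Fin m) ℝ).val) := by simp only [mul_assoc]
      _ = K := by rw [h1', h1, one_mul, mul_one]

theorem isBlock_frameMatrix {ι : Type} [Fintype ι] [DecidableEq ι] {n : ι → ℕ} {cls : Fin m → ι}
    {J : Matrix (Fin m) (Σ a, Fin (n a)) ℝ} {L : Matrix (Σ a, Fin (n a)) (Fin m) ℝ}
    (hJ : ∀ i (k : Σ a, Fin (n a)), cls i ≠ k.1 → J i k = 0)
    (hL : ∀ (k : Σ a, Fin (n a)) j, cls j ≠ k.1 → L k j = 0)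
    (s : (a : ι) → Matrix (Fin (n a)) (Fin (n a)) ℝ) : IsBlock cls (frameMatrix J L s) := by
  intro i j hij
  have hne : i ≠ j := fun h => hij (congrArg cls h)
  rw [frameMatrix, Matrix.add_apply, Matrix.one_apply_ne hne, zero_add, Matrix.mul_apply]
  refine Finset.sum_eq_zero fun l _ => ?_
  by_cases hl : cls j = l.1
  · rw [Matrix.mul_apply, Finset.sum_eq_zero, zero_mul]
    intro k _
    by_cases hk : cls i = k.1
    · have hkl : k.1 ≠ l.1 := by rwa [← hk, ← hl]
      have : (Matrix.blockDiagonal' s - 1) k l = 0 := by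
        obtain ⟨a, k⟩ := k
        obtain ⟨b, l⟩ := l
        rw [← Matrix.blockDiagonal'_one, ← Matrix.blockDiagonal'_sub,
          Matrix.blockDiagonal'_apply_ne _ _ _ hkl]
      rw [this, mul_zero]
    · rw [hJ i k hk, zero_mul]
  · rw [hL l j hl, mul_zero]

theorem mem_patternAlgebra_of_isBlock {g : Matrix (Fin m) (Fin m) ℝ}
    (hg : IsBlock (toClass 𝒢) g) : g ∈ patternAlgebra 𝒢 := by
  intro i j hij
  refine hg i j fun h => hij ?_
  rw [← toClass_le_toClass, h]

/-- The residual frame `J` of the normal form is carried back to `K` as `h J`, with dual frame `(h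
J)ᵀ K`. Membership in the stabilizer and rigidity are checked after conjugating by `h`. -/
theorem stabilizer_of_isSufficientlyGeneral (hK : K ∈ concentrationCone 𝒢)
    (hg : IsSufficientlyGeneral 𝒢 K) :
    lieDim (G0Stabilizer 𝒢 K) = ∑ a : VertexClass 𝒢, (nClass 𝒢 a).choose 2 ∧
      ∃ φ : ((a : VertexClass 𝒢) → Matrix.specialOrthogonalGroup (Fin (nClass 𝒢 a)) ℝ) →*
          GL (Fin m) ℝ,
        Topology.IsEmbedding φ ∧
        Set.range φ = identityComponent (G0Stabilizer 𝒢 K) ∧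
        Set.range φ = zariskiIdentityComponent (G0Stabilizer 𝒢 K) := by
  obtain ⟨h, hh⟩ : ∃ h : GL (Fin m) ℝ, h.val = normalizer 𝒢 K := isUnit_normalizer hK.1
  have hpat : h.val ∈ patternAlgebra 𝒢 := hh ▸ normalizer_mem_patternAlgebra K
  have hpat' := inv_mem_patternAlgebra 𝒢 h hpat
  have hhinv : h.val * (h⁻¹ : GL (Fin m) ℝ).val = 1 := h.mul_inv
  have hinvh : (h⁻¹ : GL (Fin m) ℝ).val * h.val = 1 := h.inv_mul
  obtain ⟨M, hMdef⟩ : ∃ M, M = normalForm 𝒢 K := ⟨_, rfl⟩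
  have hMK : M = h.val.transpose * K * h.val := by rw [hMdef, normalForm, hh]
  have hMh : M * (h⁻¹ : GL (Fin m) ℝ).val = h.val.transpose * K := by
    rw [hMK, mul_assoc, hhinv, mul_one]
  have hKt := transpose_eq_of_posDef hK.1
  have hM : M.PosDef := hMdef ▸ posDef_normalForm hK.1
  have hMt := transpose_eq_of_posDef hM
  have hc : IsRigidlyCoupled (toClass 𝒢) M := hMdef ▸ isRigidlyCoupled_normalForm hK hg
  obtain ⟨J, hJ1, hJ2, hJ3⟩ := exists_residual_frame (cls := toClass 𝒢) hM
    fun a => hMdef ▸ finrank_residual hK hg a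
  have hJA := transpose_mul_blockPart_eq hMt hJ2
  have hJM : J.transpose * M * J = 1 := by rw [← hJA, hJ1]
  have hL : (h.val * J).transpose * K = J.transpose * M * (h⁻¹ : GL (Fin m) ℝ).val := by
    rw [Matrix.mul_assoc, hMh, Matrix.transpose_mul, Matrix.mul_assoc]
  have hLJ : (h.val * J).transpose * K * (h.val * J) = 1 := by
    rw [hL, ← hJM]
    calc _ = J.transpose * M * ((h⁻¹ : GL (Fin m) ℝ).val * h.val) * J := by
          simp only [Matrix.mul_assoc]
      _ = _ := by rw [hinvh, Matrix.mul_one]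
  have hconj : ∀ s : (a : VertexClass 𝒢) → Matrix (Fin (nClass 𝒢 a)) (Fin (nClass 𝒢 a)) ℝ,
      frameMatrix (h.val * J) ((h.val * J).transpose * K) s =
        h.val * frameMatrix J (J.transpose * M) s * (h⁻¹ : GL (Fin m) ℝ).val := by
    intro s
    rw [hL, frameMatrix, frameMatrix, mul_add, add_mul, mul_one, hhinv]
    simp only [Matrix.mul_assoc]
  have hmem : ∀ s, frameHom hLJ s ∈ G0Stabilizer 𝒢 K := by
    intro s
    rw [mem_G0Stabilizer, frameHom_val]
    refine ⟨?_, frameMatrix_isometry hKt hLJ fun a =>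
      (mem_specialOrthogonalGroup_iff_transpose.mp (s a).property).1⟩
    rw [hconj]
    refine mul_mem (mul_mem hpat (mem_patternAlgebra_of_isBlock (isBlock_frameMatrix ?_ ?_ _)))
      hpat'
    · exact fun i k hik => (hJ2 k).1 i hik
    · intro k j hkj
      have : (J.transpose * M) k j = M.mulVec (fun i => J i k) j := by
        rw [← Matrix.vecMul_transpose, hMt]
        rfl
      rw [this]
      exact (hJ2 k).2 j hkj
  have hblock : ∀ g ∈ G0Stabilizer 𝒢 K, IsBlockIsometry (toClass 𝒢) M
      ((h⁻¹ : GL (Fin m) ℝ).val * g.val * h.val) := by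
    intro g hgK
    rw [mem_G0Stabilizer] at hgK
    have hiso : ((h⁻¹ : GL (Fin m) ℝ).val * g.val * h.val).transpose * M *
        ((h⁻¹ : GL (Fin m) ℝ).val * g.val * h.val) = M := by
      have e1 : h.val * ((h⁻¹ : GL (Fin m) ℝ).val * g.val * h.val) = g.val * h.val := by
        rw [← mul_assoc, ← mul_assoc, hhinv, one_mul]
      calc _ = (h.val * ((h⁻¹ : GL (Fin m) ℝ).val * g.val * h.val)).transpose * K *
            (h.val * ((h⁻¹ : GL (Fin m) ℝ).val * g.val * h.val)) := by
            rw [Matrix.transpose_mul h.val, hMK]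
            simp only [mul_assoc]
        _ = h.val.transpose * (g.val.transpose * K * g.val) * h.val := by
            rw [e1, Matrix.transpose_mul]
            simp only [mul_assoc]
        _ = M := by rw [hgK.2, hMK]
    refine ⟨?_, hiso⟩
    have := isBlock_of_isometry (g := h⁻¹ * g * h) hK.1
      (mul_mem (mul_mem hpat' hgK.1) hpat) (hMdef ▸ hiso)
    exact this
  -- Every polynomial with finitely many values on the stabilizer is admitted; the argument uses
  -- only the traces on tame classes and the determinants on all classes.
  let P : Set (MvPolynomial (Fin m × Fin m) ℝ) :=
    {p | ((fun g : GL (Fin m) ℝ => evalMatrix p g.val) '' G0Stabilizer 𝒢 K).Finite}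
  have hconjpoly : IsPolyMat fun A => (h⁻¹ : GL (Fin m) ℝ).val * A * h.val :=
    ((IsPolyMat.const _).mul IsPolyMat.id).mul (IsPolyMat.const _)
  have hrigid : ∀ g ∈ G0Stabilizer 𝒢 K,
      (∀ p ∈ P, evalMatrix p g.val = evalMatrix p (1 : GL (Fin m) ℝ).val) →
      g ∈ Set.range (frameHom hLJ) := by
    intro g hgK hgP
    have hpoly : ∀ f : Matrix (Fin m) (Fin m) ℝ → ℝ, IsPolyFun f → ∀ S : Set ℝ, S.Finite →
        (∀ g ∈ G0Stabilizer 𝒢 K, f g.val ∈ S) → f g.val = f 1 := by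
      rintro f ⟨p, hp⟩ S hS hfS
      have := hgP p (hS.subset (by
        rintro _ ⟨g, hg, rfl⟩
        simp only [hp]
        exact hfS g hg))
      simpa [hp] using this
    have hb := hblock g hgK
    have htame : ∀ a, IsTame (toClass 𝒢) M a →
        ((h⁻¹ : GL (Fin m) ℝ).val * g.val * h.val) * classProj (toClass 𝒢) a =
          classProj (toClass 𝒢) a := by
      intro a ha
      refine hb.mul_classProj_eq hM ha ?_
      have := hpoly (fun A => (((h⁻¹ : GL (Fin m) ℝ).val * A * h.val) *
        classProj (toClass 𝒢) a).trace) (hconjpoly.mul (IsPolyMat.const _)).trace _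
        ((Set.finite_Iic m).image _) fun g hg => (hblock g hg).trace_mem hM ha
      rw [this, mul_one, hinvh, one_mul]
    have hdet : ∀ a, (classProj (toClass 𝒢) a * ((h⁻¹ : GL (Fin m) ℝ).val * g.val * h.val) +
        (1 - classProj (toClass 𝒢) a)).det = 1 := by
      intro a
      have := hpoly (fun A => (classProj (toClass 𝒢) a *
        ((h⁻¹ : GL (Fin m) ℝ).val * A * h.val) + (1 - classProj (toClass 𝒢) a)).det)
        (((IsPolyMat.const _).mul hconjpoly).add (IsPolyMat.const _)).det {1, -1}
        (Set.toFinite _) fun g hg => (hblock g hg).det_mem hM a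
      rw [this, mul_one, hinvh, mul_one, add_sub_cancel, Matrix.det_one]
    obtain ⟨s, hs⟩ := hb.exists_eq_frameMatrix hM hc htame hdet hJ1 hJ2 hJ3
    refine ⟨s, Units.ext ?_⟩
    rw [frameHom_val, hconj, ← hs]
    calc _ = (h.val * (h⁻¹ : GL (Fin m) ℝ).val) * g.val * (h.val * (h⁻¹ : GL (Fin m) ℝ).val) := by
          simp only [mul_assoc]
      _ = g.val := by rw [hhinv, one_mul, mul_one]
  obtain ⟨h1, h2⟩ := range_frameHom_eq_components hLJ hmem P (fun p hp => hp) hrigid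
  exact ⟨lieDim_eq_of_frame hLJ hmem h1.ge, frameHom hLJ, isEmbedding_frameHom hLJ, h1, h2⟩

end Stabilizer

/-! ### Generic properties -/

section Generic

variable {𝒢 : SimpleGraph (Fin m)}

theorem one_mem_concentrationCone : (1 : Matrix (Fin m) (Fin m) ℝ) ∈ concentrationCone 𝒢 :=
  ⟨Matrix.PosDef.one, fun _ _ h _ => Matrix.one_apply_ne h⟩

theorem combo_mem_concentrationCone {K₁ K₂ : Matrix (Fin m) (Fin m) ℝ}
    (h₁ : K₁ ∈ concentrationCone 𝒢) (h₂ : K₂ ∈ concentrationCone 𝒢) {t : ℝ} (ht : t ∈ Set.Ioo 0 1) :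
    K₁ + t • (K₂ - K₁) ∈ concentrationCone 𝒢 := by
  constructor
  · have : K₁ + t • (K₂ - K₁) = (1 - t) • K₁ + t • K₂ := by module
    rw [this]
    exact (h₁.1.smul (sub_pos.mpr ht.2)).add (h₂.1.smul ht.1)
  · intro i j hij hadj
    simp [h₁.2 i j hij hadj, h₂.2 i j hij hadj]

theorem exists_polynomial_eval_line (p : MvPolynomial (Fin m × Fin m) ℝ)
    (K D : Matrix (Fin m) (Fin m) ℝ) :
    ∃ q : Polynomial ℝ, ∀ t, q.eval t = evalMatrix p (K + t • D) := by
  induction p using MvPolynomial.induction_on with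
  | C a => exact ⟨Polynomial.C a, fun t => by simp [evalMatrix]⟩
  | add p q hp hq =>
    obtain ⟨P, hP⟩ := hp
    obtain ⟨Q, hQ⟩ := hq
    exact ⟨P + Q, fun t => by rw [Polynomial.eval_add, hP, hQ]; simp [evalMatrix]⟩
  | mul_X p ij hp =>
    obtain ⟨P, hP⟩ := hp
    refine ⟨P * (Polynomial.C (K ij.1 ij.2) + Polynomial.X * Polynomial.C (D ij.1 ij.2)),
      fun t => ?_⟩
    rw [Polynomial.eval_mul, hP]
    simp only [evalMatrix, Polynomial.eval_add, Polynomial.eval_mul, Polynomial.eval_C,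
      Polynomial.eval_X, map_mul, MvPolynomial.eval_X, Matrix.add_apply, Matrix.smul_apply,
      smul_eq_mul]

/-- On the segment joining a nonzero of `p` to a nonzero of `q`, both become nonzero polynomials in
one variable, so their product has finitely many roots, while the segment lies in the convex cone.
-/
theorem exists_mem_concentrationCone_mul_ne_zero {p q : MvPolynomial (Fin m × Fin m) ℝ}
    (hp : ∃ K ∈ concentrationCone 𝒢, evalMatrix p K ≠ 0)
    (hq : ∃ K ∈ concentrationCone 𝒢, evalMatrix q K ≠ 0) :
    ∃ K ∈ concentrationCone 𝒢, evalMatrix (p * q) K ≠ 0 := by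
  obtain ⟨K₁, h₁, hp⟩ := hp
  obtain ⟨K₂, h₂, hq⟩ := hq
  obtain ⟨P, hP⟩ := exists_polynomial_eval_line p K₁ (K₂ - K₁)
  obtain ⟨Q, hQ⟩ := exists_polynomial_eval_line q K₁ (K₂ - K₁)
  have hP0 : P ≠ 0 := by
    rintro rfl
    have := hP 0
    rw [zero_smul, add_zero, Polynomial.eval_zero] at this
    exact hp this.symm
  have hQ0 : Q ≠ 0 := by
    rintro rfl
    have := hQ 1
    rw [one_smul, add_sub_cancel, Polynomial.eval_zero] at this
    exact hq this.symm
  have hfin : (((P * Q).roots.toFinset : Finset ℝ) : Set ℝ).Finite := Finset.finite_toSet _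
  obtain ⟨t, ht, hroot⟩ := (Set.Ioo_infinite (zero_lt_one (α := ℝ))).exists_notMem_finite hfin
  refine ⟨_, combo_mem_concentrationCone h₁ h₂ ht, fun h => hroot ?_⟩
  have h0 : evalMatrix (p * q) (K₁ + t • (K₂ - K₁)) = (P * Q).eval t := by
    rw [Polynomial.eval_mul, hP, hQ]
    simp [evalMatrix]
  rw [h0] at h
  simpa [hP0, hQ0] using h

namespace HoldsGenerically

variable {P Q : Matrix (Fin m) (Fin m) ℝ → Prop}

theorem of_isPolyFun {f : Matrix (Fin m) (Fin m) ℝ → ℝ} (hf : IsPolyFun f)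
    (hne : ∃ K ∈ concentrationCone 𝒢, f K ≠ 0)
    (h : ∀ K ∈ concentrationCone 𝒢, f K ≠ 0 → P K) : HoldsGenerically 𝒢 P := by
  obtain ⟨p, hp⟩ := hf
  exact ⟨p, by simpa only [hp] using hne, by simpa only [hp] using h⟩

theorem of_forall (h : ∀ K ∈ concentrationCone 𝒢, P K) : HoldsGenerically 𝒢 P :=
  of_isPolyFun (IsPolyFun.const 1) ⟨1, one_mem_concentrationCone, one_ne_zero⟩
    fun K hK _ => h K hK

theorem mono (hP : HoldsGenerically 𝒢 P) (h : ∀ K ∈ concentrationCone 𝒢, P K → Q K) :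
    HoldsGenerically 𝒢 Q := by
  obtain ⟨p, hp, hpP⟩ := hP
  exact ⟨p, hp, fun K hK hne => h K hK (hpP K hK hne)⟩

theorem and (hP : HoldsGenerically 𝒢 P) (hQ : HoldsGenerically 𝒢 Q) :
    HoldsGenerically 𝒢 fun K => P K ∧ Q K := by
  obtain ⟨p, hp, hpP⟩ := hP
  obtain ⟨q, hq, hqQ⟩ := hQ
  refine ⟨p * q, exists_mem_concentrationCone_mul_ne_zero hp hq, fun K hK hne => ?_⟩
  have : evalMatrix p K * evalMatrix q K ≠ 0 := by simpa [evalMatrix] using hne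
  exact ⟨hpP K hK (left_ne_zero_of_mul this), hqQ K hK (right_ne_zero_of_mul this)⟩

theorem all {κ : Type*} [Finite κ] {P : κ → Matrix (Fin m) (Fin m) ℝ → Prop}
    (h : ∀ k, HoldsGenerically 𝒢 (P k)) : HoldsGenerically 𝒢 fun K => ∀ k, P k K := by
  classical
  have := Fintype.ofFinite κ
  have key : ∀ s : Finset κ, HoldsGenerically 𝒢 fun K => ∀ k ∈ s, P k K := by
    intro s
    induction s using Finset.induction_on with
    | empty => exact of_forall fun K _ => by simp
    | insert k s _ ih =>
      refine ((h k).and ih).mono fun K _ hK => ?_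
      intro l hl
      rcases Finset.mem_insert.mp hl with rfl | hl
      · exact hK.1
      · exact hK.2 l hl
  exact (key Finset.univ).mono fun K _ hK k => hK k (Finset.mem_univ k)

theorem imp {c : Prop} (h : c → HoldsGenerically 𝒢 P) : HoldsGenerically 𝒢 fun K => c → P K := by
  by_cases hc : c
  · exact (h hc).mono fun K _ hK _ => hK
  · exact of_forall fun K _ h => absurd h hc

end HoldsGenerically

/-! ### The separation and cyclicity conditions as polynomial conditions -/

/-- The coordinate projection onto a set of coordinates. -/
def coordProj (s : Finset (Fin m)) : Matrix (Fin m) (Fin m) ℝ :=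
  Matrix.diagonal fun i => if i ∈ s then 1 else 0

theorem coordProj_mulVec (s : Finset (Fin m)) (v : Fin m → ℝ) (i : Fin m) :
    (coordProj s).mulVec v i = if i ∈ s then v i else 0 := by
  simp [coordProj, Matrix.mulVec_diagonal]

/-- The Gram matrix whose determinant detects whether `M` separates `s` by `t`. -/
def separationMatrix (M : Matrix (Fin m) (Fin m) ℝ) (s t : Finset (Fin m)) :
    Matrix (Fin m) (Fin m) ℝ :=
  coordProj s * M * coordProj t * M * coordProj s + (1 - coordProj s)

theorem separationMatrix_mulVec (M : Matrix (Fin m) (Fin m) ℝ) (s t : Finset (Fin m))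
    (v : Fin m → ℝ) (i : Fin m) : (separationMatrix M s t).mulVec v i =
      if i ∈ s then M.mulVec ((coordProj t).mulVec (M.mulVec ((coordProj s).mulVec v))) i
      else v i := by
  rw [separationMatrix, Matrix.add_mulVec, Matrix.sub_mulVec, Matrix.one_mulVec]
  simp only [← Matrix.mulVec_mulVec, Pi.add_apply, Pi.sub_apply, coordProj_mulVec s]
  split_ifs <;> simp

/-- For `v` supported in `s`, the quadratic form of the Gram matrix is the sum of the squares of the
entries of `M v` in `t`. The summand `1 - coordProj s` excludes kernel vectors outside `s`. -/
theorem separates_iff_det_ne_zero {M : Matrix (Fin m) (Fin m) ℝ} (hM : M.transpose = M)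
    (s t : Finset (Fin m)) : Separates M s t ↔ (separationMatrix M s t).det ≠ 0 := by
  constructor
  · intro h hdet
    obtain ⟨v, hv, hv0⟩ := Matrix.exists_mulVec_eq_zero_iff.mpr hdet
    have hrow := fun i => (separationMatrix_mulVec M s t v i).symm.trans (congrFun hv0 i)
    have hsupp : ∀ i, i ∉ s → v i = 0 := fun i hi => by simpa [hi] using hrow i
    have hsv : (coordProj s).mulVec v = v := by
      funext i
      rw [coordProj_mulVec]
      split_ifs with hi
      · rfl
      · exact (hsupp i hi).symm
    refine hv (h v hsupp fun j hj => ?_)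
    set w := M.mulVec v with hw
    have h1 : v ⬝ᵥ M.mulVec ((coordProj t).mulVec w) = 0 := by
      refine Finset.sum_eq_zero fun i _ => ?_
      by_cases hi : i ∈ s
      · have := hrow i
        rw [if_pos hi, hsv, ← hw] at this
        rw [this, Pi.zero_apply, mul_zero]
      · rw [hsupp i hi, zero_mul]
    rw [Matrix.dotProduct_mulVec, ← Matrix.mulVec_transpose, hM, ← hw] at h1
    have h2 : ∑ i, (if i ∈ t then w i * w i else 0) = 0 := by
      refine Eq.trans (Finset.sum_congr rfl fun i _ => ?_) h1
      rw [coordProj_mulVec]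
      split_ifs <;> simp
    have h3 := (Finset.sum_eq_zero_iff_of_nonneg fun i _ => by
      split_ifs
      · exact mul_self_nonneg _
      · exact le_rfl).mp h2 j (Finset.mem_univ j)
    simpa [hj] using h3
  · intro hdet v hv hMv
    by_contra hne
    refine hdet (Matrix.exists_mulVec_eq_zero_iff.mp ⟨v, hne, funext fun i => ?_⟩)
    have hsv : (coordProj s).mulVec v = v := by
      funext i
      rw [coordProj_mulVec]
      split_ifs with hi
      · rfl
      · exact (hv i hi).symm
    have htv : (coordProj t).mulVec (M.mulVec v) = 0 := by
      funext i
      rw [coordProj_mulVec]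
      split_ifs with hi
      · exact hMv i hi
      · rfl
    rw [separationMatrix_mulVec, hsv, htv, Matrix.mulVec_zero]
    split_ifs with hi
    · rfl
    · exact hv i hi

theorem isPolyFun_det_separationMatrix (s t : Finset (Fin m)) :
    IsPolyFun fun K => (separationMatrix (normalForm 𝒢 K) s t).det := by
  have hM : IsPolyMat (normalForm 𝒢) := isPolyMat_normalForm
  exact (((((IsPolyMat.const _).mul hM).mul (IsPolyMat.const _)).mul hM).mul
    (IsPolyMat.const _) |>.add (IsPolyMat.const _)).det

/-! ### Cyclicity through Krylov matrices. -/

section Cyclic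

variable {ι : Type} [DecidableEq ι] (cls : Fin m → ι)

/-- The matrix whose columns are the iterates of the indicator vector of `a` under the operator
`crossOp cls M a b`. -/
def krylovMatrix (M : Matrix (Fin m) (Fin m) ℝ) (a b : ι) : Matrix (Fin m) (Fin m) ℝ :=
  Matrix.of fun i k => (crossOp cls M a b ^ (k : ℕ)).mulVec ((classProj cls a).mulVec 1) i

/-- The Gram matrix whose determinant detects cyclicity. -/
def krylovGram (M : Matrix (Fin m) (Fin m) ℝ) (a b : ι) : Matrix (Fin m) (Fin m) ℝ :=
  krylovMatrix cls M a b * (krylovMatrix cls M a b).transpose + (1 - classProj cls a)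

variable {cls}

theorem classProj_mul_krylovMatrix (M : Matrix (Fin m) (Fin m) ℝ) (a b : ι) :
    classProj cls a * krylovMatrix cls M a b = krylovMatrix cls M a b := by
  have hS : classProj cls a * crossOp cls M a b = crossOp cls M a b := by
    simp only [crossOp, ← mul_assoc, classProj_mul_self]
  have key : ∀ k : ℕ, (classProj cls a).mulVec
      ((crossOp cls M a b ^ k).mulVec ((classProj cls a).mulVec 1)) =
      (crossOp cls M a b ^ k).mulVec ((classProj cls a).mulVec 1) := by
    intro k
    cases k with
    | zero => rw [pow_zero, Matrix.one_mulVec, Matrix.mulVec_mulVec, classProj_mul_self]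
    | succ k => rw [Matrix.mulVec_mulVec, pow_succ', ← mul_assoc, hS]
  ext i k
  exact congrFun (key k) i

/-- An invertible Gram matrix means that the columns of the Krylov matrix span the coordinates of
`a`; a combination of these columns is a polynomial in the operator applied to the indicator vector.
-/
theorem cyclic_of_det_krylovGram_ne_zero {M : Matrix (Fin m) (Fin m) ℝ} {a b : ι}
    (h : (krylovGram cls M a b).det ≠ 0) (u : Fin m → ℝ) :
    ∃ q : Polynomial ℝ, (classProj cls a).mulVec u =
      (Polynomial.aeval (crossOp cls M a b) q).mulVec ((classProj cls a).mulVec 1) := by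
  set C := krylovMatrix cls M a b with hC
  have hPC : classProj cls a * C = C := classProj_mul_krylovMatrix M a b
  have hunit : IsUnit (krylovGram cls M a b).det := isUnit_iff_ne_zero.mpr h
  let w := (krylovGram cls M a b)⁻¹.mulVec ((classProj cls a).mulVec u)
  have hw : (krylovGram cls M a b).mulVec w = (classProj cls a).mulVec u := by
    rw [Matrix.mulVec_mulVec, Matrix.mul_nonsing_inv _ hunit, Matrix.one_mulVec]
  have hP : classProj cls a * krylovGram cls M a b = C * C.transpose := by
    rw [krylovGram, mul_add, ← mul_assoc, hPC, mul_sub, mul_one, classProj_mul_self, sub_self,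
      add_zero]
  have h1 : (classProj cls a).mulVec u = C.mulVec (C.transpose.mulVec w) := by
    rw [Matrix.mulVec_mulVec, ← hP, ← Matrix.mulVec_mulVec, hw, Matrix.mulVec_mulVec,
      classProj_mul_self]
  refine ⟨∑ k : Fin m, Polynomial.C (C.transpose.mulVec w k) * Polynomial.X ^ (k : ℕ), ?_⟩
  rw [h1, map_sum, Matrix.sum_mulVec]
  funext i
  rw [Finset.sum_apply]
  change ∑ k, C i k * C.transpose.mulVec w k = _
  refine Finset.sum_congr rfl fun k _ => ?_
  simp only [map_mul, Polynomial.aeval_C, map_pow, Polynomial.aeval_X,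
    Algebra.algebraMap_eq_smul_one, Matrix.smul_mul, one_mul, Matrix.smul_mulVec, Pi.smul_apply,
    smul_eq_mul]
  rw [mul_comm]
  rfl

/-- For a diagonal operator with distinct eigenvalues on `a`, the rows of the Krylov matrix at `a`
are Vandermonde rows and hence independent. -/
theorem det_krylovGram_ne_zero {M : Matrix (Fin m) (Fin m) ℝ} {a b : ι} {σ : Fin m → ℝ}
    (hσ : Function.Injective σ)
    (hS : crossOp cls M a b = Matrix.diagonal fun i => if cls i = a then σ i else 0) :
    (krylovGram cls M a b).det ≠ 0 := by
  intro hdet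
  obtain ⟨x, hx, hx0⟩ := Matrix.exists_mulVec_eq_zero_iff.mpr hdet
  set C := krylovMatrix cls M a b with hC
  have hPC : classProj cls a * C = C := classProj_mul_krylovMatrix M a b
  have hentry : ∀ i k, cls i = a → C i k = σ i ^ (k : ℕ) := by
    intro i k hi
    simp only [hC, krylovMatrix, Matrix.of_apply, hS, Matrix.diagonal_pow, Matrix.mulVec_diagonal,
      classProj_mulVec, Pi.pow_apply, Pi.one_apply, if_pos hi, mul_one]
  have hsupp : ∀ i, cls i ≠ a → x i = 0 := by
    intro i hi
    have h1 := congrFun hx0 i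
    rw [krylovGram, ← hC, ← hPC, Matrix.add_mulVec, Matrix.sub_mulVec, Matrix.one_mulVec, mul_assoc,
      ← Matrix.mulVec_mulVec, Pi.add_apply, Pi.sub_apply, classProj_mulVec, classProj_mulVec,
      if_neg hi, if_neg hi] at h1
    simpa using h1
  have hPx : (classProj cls a).mulVec x = x := by
    funext i
    rw [classProj_mulVec]
    split_ifs with hi
    · rfl
    · exact (hsupp i hi).symm
  have hCC : (C * C.transpose).mulVec x = 0 := by
    rw [krylovGram, ← hC, Matrix.add_mulVec, Matrix.sub_mulVec, Matrix.one_mulVec, hPx, sub_self,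
      add_zero] at hx0
    exact hx0
  have hCx : C.transpose.mulVec x = 0 := by
    have h1 : C.transpose.mulVec x ⬝ᵥ C.transpose.mulVec x = 0 := by
      rw [Matrix.dotProduct_mulVec, Matrix.vecMul_transpose, Matrix.mulVec_mulVec, hCC,
        zero_dotProduct]
    exact dotProduct_self_eq_zero.mp h1
  refine hx (Matrix.eq_zero_of_forall_pow_sum_mul_pow_eq_zero hσ fun k => ?_)
  refine Eq.trans ?_ (congrFun hCx k)
  change _ = ∑ i, C.transpose k i * x i
  refine Finset.sum_congr rfl fun i _ => ?_
  by_cases hi : cls i = a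
  · rw [Matrix.transpose_apply, hentry i k hi, mul_comm]
  · rw [hsupp i hi, zero_mul, mul_zero]

end Cyclic

theorem isPolyFun_det_krylovGram (a b : VertexClass 𝒢) :
    IsPolyFun fun K => (krylovGram (toClass 𝒢) (normalForm 𝒢 K) a b).det := by
  have hM : IsPolyMat (normalForm 𝒢) := isPolyMat_normalForm
  have hA : IsPolyMat fun K => blockPart (toClass 𝒢) (normalForm 𝒢 K) := fun i j =>
    IsPolyFun.ite (fun _ => hM i j) fun _ => IsPolyFun.const _
  have hT : IsPolyMat fun K => transferOp (toClass 𝒢) (normalForm 𝒢 K) := hA.adjugate.mul hM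
  have hS : IsPolyMat fun K => crossOp (toClass 𝒢) (normalForm 𝒢 K) a b :=
    ((((IsPolyMat.const _).mul hT).mul (IsPolyMat.const _)).mul hT).mul (IsPolyMat.const _)
  have hC : IsPolyMat fun K => krylovMatrix (toClass 𝒢) (normalForm 𝒢 K) a b := by
    intro i k
    simp only [krylovMatrix, Matrix.of_apply]
    exact (hS.pow k).mulVec (v := fun _ => (classProj _ a).mulVec 1) (fun _ => IsPolyFun.const _) i
  exact ((hC.mul hC.transpose).add (IsPolyMat.const _)).det

end Generic

/-! ### Existence of sufficiently general concentration matrices -/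

section Witness

/-- Since `2 |x_i x_j| ≤ x_i² + x_j²`, the form of `E` is bounded by `m / (m + 1)` times the squared
norm, which is less than that of the identity. -/
theorem posDef_one_add {E : Matrix (Fin m) (Fin m) ℝ} (hE : E.transpose = E)
    (hb : ∀ i j, |E i j| ≤ 1 / (m + 1)) : (1 + E).PosDef := by
  refine Matrix.PosDef.of_dotProduct_mulVec_pos ?_ fun x hx => ?_
  · rw [Matrix.IsHermitian, Matrix.conjTranspose_eq_transpose_of_trivial, Matrix.transpose_add,
      Matrix.transpose_one, hE]
  have hm : (0 : ℝ) < m + 1 := by positivity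
  have hpos : 0 < ∑ i, x i * x i := by
    obtain ⟨i, hi⟩ := Function.ne_iff.mp hx
    exact Finset.sum_pos' (fun i _ => mul_self_nonneg _)
      ⟨i, Finset.mem_univ i, mul_self_pos.mpr hi⟩
  have hentry : ∀ i j, -((x i * x i + x j * x j) / 2 * (1 / (m + 1))) ≤ x i * (E i j * x j) := by
    intro i j
    have h1 : |x i * x j| ≤ (x i * x i + x j * x j) / 2 := by
      rw [abs_le]
      constructor <;> nlinarith [sq_nonneg (x i + x j), sq_nonneg (x i - x j)]
    have h2 : |x i * x j * E i j| ≤ (x i * x i + x j * x j) / 2 * (1 / (m + 1)) := by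
      rw [abs_mul]
      exact mul_le_mul h1 (hb i j) (abs_nonneg _) ((abs_nonneg _).trans h1)
    have h3 := (abs_le.mp h2).1
    linarith [h3, show x i * (E i j * x j) = x i * x j * E i j by ring]
  have hsum : -(m * (∑ i, x i * x i) * (1 / (m + 1))) ≤ x ⬝ᵥ E.mulVec x := by
    have h1 : x ⬝ᵥ E.mulVec x = ∑ i, ∑ j, x i * (E i j * x j) := by
      simp only [dotProduct, Matrix.mulVec, Finset.mul_sum]
    rw [h1]
    refine le_trans (le_of_eq ?_)
      (Finset.sum_le_sum fun i _ => Finset.sum_le_sum fun j _ => hentry i j)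
    simp only [Finset.sum_neg_distrib, ← Finset.sum_mul, ← Finset.sum_div, Finset.sum_add_distrib,
      Finset.sum_const, Finset.card_univ, Fintype.card_fin, nsmul_eq_mul]
    simp only [mul_assoc, ← Finset.mul_sum]
    ring
  have hx1 : x ⬝ᵥ x = ∑ i, x i * x i := rfl
  rw [star_trivial, Matrix.add_mulVec, Matrix.one_mulVec, dotProduct_add, hx1]
  have h2 : (m : ℝ) * (∑ i, x i * x i) * (1 / (m + 1)) < ∑ i, x i * x i := by
    rw [mul_one_div, div_lt_iff₀ hm]
    nlinarith
  linarith

variable {𝒢 : SimpleGraph (Fin m)} {K : Matrix (Fin m) (Fin m) ℝ}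

/-- A matrix with unit diagonal and no entries between distinct comparable vertices. -/
structure IsDecoupled (𝒢 : SimpleGraph (Fin m)) (K : Matrix (Fin m) (Fin m) ℝ) : Prop where
  diag : ∀ i, K i i = 1
  off : ∀ i j, i ≠ j → vle 𝒢 i j ∨ vle 𝒢 j i → K i j = 0

namespace IsDecoupled

/-- There is nothing above a vertex to orthogonalize against, so for decoupled matrices the change
of basis only rescales coordinates and the normal form is explicit. -/
theorem normalizer_eq (h : IsDecoupled 𝒢 K) :
    normalizer 𝒢 K = Matrix.diagonal fun l => (upperPart 𝒢 K l).det := by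
  ext i l
  by_cases hil : i = l
  · rw [hil, normalizer_self, Matrix.diagonal_apply_eq]
  · have h0 : upperColumn 𝒢 K l = 0 := by
      funext j
      simp only [upperColumn, Pi.zero_apply, ite_eq_right_iff]
      intro hj
      refine h.off j l ?_ (Or.inr hj.1)
      rintro rfl
      exact hj.2 hj.1
    simp [normalizer, h0, hil]

theorem normalForm_apply (h : IsDecoupled 𝒢 K) (i j : Fin m) :
    normalForm 𝒢 K i j = (upperPart 𝒢 K i).det * K i j * (upperPart 𝒢 K j).det := by
  rw [normalForm, h.normalizer_eq, Matrix.diagonal_transpose, Matrix.mul_diagonal,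
    Matrix.diagonal_mul]

theorem blockPart_eq (h : IsDecoupled 𝒢 K) : blockPart (toClass 𝒢) (normalForm 𝒢 K) =
    Matrix.diagonal fun l => (upperPart 𝒢 K l).det * (upperPart 𝒢 K l).det := by
  ext i j
  rw [blockPart, Matrix.of_apply, h.normalForm_apply]
  by_cases hij : i = j
  · rw [hij, if_pos rfl, Matrix.diagonal_apply_eq, h.diag, mul_one]
  · rw [Matrix.diagonal_apply_ne _ hij, ite_eq_right_iff]
    intro hc
    rw [h.off i j hij (Or.inl ((toClass_le_toClass 𝒢 i j).mp hc.le)), mul_zero, zero_mul]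

theorem det_mul_transferOp (h : IsDecoupled 𝒢 K) (hK : K.PosDef) (i j : Fin m) :
    (upperPart 𝒢 K i).det * transferOp (toClass 𝒢) (normalForm 𝒢 K) i j =
      (blockPart (toClass 𝒢) (normalForm 𝒢 K)).det * K i j * (upperPart 𝒢 K j).det := by
  have h1 := congrFun (congrFun
    (blockPart_mul_transferOp (cls := toClass 𝒢) (normalForm 𝒢 K)) i) j
  rw [Matrix.smul_apply, smul_eq_mul, h.normalForm_apply] at h1
  conv_lhs at h1 => rw [h.blockPart_eq, Matrix.diagonal_mul]
  refine mul_left_cancel₀ (det_upperPart_ne_zero (𝒢 := 𝒢) hK i) ?_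
  linarith

/-- The transfer operator is, up to a scalar, `K` conjugated by the diagonal scaling, and a
conjugation preserves the diagonal shape of the product through `b`. -/
theorem crossOp_eq (h : IsDecoupled 𝒢 K) (hK : K.PosDef) {a b : VertexClass 𝒢} {τ : Fin m → ℝ}
    (hτ : ∀ i j, toClass 𝒢 i = a → toClass 𝒢 j = a →
      ∑ k, (if toClass 𝒢 k = b then K i k * K k j else 0) = if i = j then τ i else 0) :
    crossOp (toClass 𝒢) (normalForm 𝒢 K) a b = Matrix.diagonal fun i =>
      if toClass 𝒢 i = a then (blockPart (toClass 𝒢) (normalForm 𝒢 K)).det ^ 2 * τ i else 0 := by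
  set T := transferOp (toClass 𝒢) (normalForm 𝒢 K) with hT
  set δ := (blockPart (toClass 𝒢) (normalForm 𝒢 K)).det
  have hd := det_upperPart_ne_zero (𝒢 := 𝒢) hK
  have key := h.det_mul_transferOp hK
  rw [← hT] at key
  have hterm : ∀ i k j, (upperPart 𝒢 K i).det * (T i k * T k j) =
      δ ^ 2 * (upperPart 𝒢 K j).det * (K i k * K k j) := by
    intro i k j
    refine mul_left_cancel₀ (hd k) ?_
    calc _ = ((upperPart 𝒢 K i).det * T i k) * ((upperPart 𝒢 K k).det * T k j) := by ring
      _ = _ := by rw [key, key]; ring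
  ext i j
  have hentry : crossOp (toClass 𝒢) (normalForm 𝒢 K) a b i j = if toClass 𝒢 j = a then
      if toClass 𝒢 i = a then ∑ k, (if toClass 𝒢 k = b then T i k * T k j else 0) else 0
      else 0 := by
    rw [crossOp, ← hT, mul_classProj_apply]
    congr 1
    rw [mul_assoc, mul_assoc, classProj_mul_apply]
    congr 1
    rw [Matrix.mul_apply]
    refine Finset.sum_congr rfl fun k _ => ?_
    rw [classProj_mul_apply, mul_ite, mul_zero]
  rw [hentry]
  by_cases hi : toClass 𝒢 i = a
  swap
  · simp [Matrix.diagonal_apply, hi]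
  by_cases hj : toClass 𝒢 j = a
  swap
  · rw [if_neg hj, Matrix.diagonal_apply_ne]
    rintro rfl
    exact hj hi
  rw [if_pos hj, if_pos hi]
  refine mul_left_cancel₀ (hd i) ?_
  have hsum : (upperPart 𝒢 K i).det * ∑ k, (if toClass 𝒢 k = b then T i k * T k j else 0) =
      δ ^ 2 * (upperPart 𝒢 K j).det * if i = j then τ i else 0 := by
    rw [← hτ i j hi hj, Finset.mul_sum, Finset.mul_sum]
    refine Finset.sum_congr rfl fun k _ => ?_
    split_ifs
    · exact hterm i k j
    · rw [mul_zero, mul_zero]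
  rw [hsum]
  by_cases hij : i = j
  · subst hij
    rw [Matrix.diagonal_apply_eq, if_pos rfl, if_pos hi]
    ring
  · rw [Matrix.diagonal_apply_ne _ hij, if_neg hij, mul_zero, mul_zero]

end IsDecoupled

/-! ### Witness matrices built from matchings. -/

/-- Distinct small positive numbers attached to the vertices. -/
noncomputable def coupling (i : Fin m) : ℝ := (i + 1) / (2 * (m + 1) ^ 2)

theorem coupling_pos (i : Fin m) : 0 < coupling i := by
  unfold coupling
  positivity

theorem coupling_injective : Function.Injective (coupling (m := m)) := by
  intro i j h
  unfold coupling at h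
  have h1 : (0 : ℝ) < 2 * (m + 1) ^ 2 := by positivity
  rw [div_left_inj' h1.ne'] at h
  exact Fin.ext (by exact_mod_cast add_right_cancel h)

theorem coupling_le (i : Fin m) : coupling i ≤ 1 / (m + 1) / 2 := by
  unfold coupling
  have h1 : (i : ℝ) + 1 ≤ m + 1 := by exact_mod_cast Nat.succ_le_succ i.isLt.le
  have h2 : (0 : ℝ) < m + 1 := by positivity
  rw [div_div, div_le_div_iff₀ (by positivity) (by positivity)]
  nlinarith

/-- A decoupled matrix in the cone whose only entries between `s` and `t` are given by a
matching `f`. -/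
theorem exists_matching_matrix {s t : Finset (Fin m)} (hcard : s.card ≤ t.card)
    (hst : ∀ i ∈ s, ∀ j ∈ t, 𝒢.Adj i j ∧ ¬ vle 𝒢 i j ∧ ¬ vle 𝒢 j i) :
    ∃ K ∈ concentrationCone 𝒢, IsDecoupled 𝒢 K ∧ ∃ f : Fin m → Fin m,
      (∀ i ∈ s, f i ∈ t) ∧ (∀ i ∈ s, ∀ j ∈ s, f i = f j → i = j) ∧
      ∀ i ∈ s, ∀ k ∈ t, K i k = if k = f i then coupling i else 0 := by
  classical
  obtain ⟨f, hft, hf⟩ : ∃ f : Fin m → Fin m, (∀ i ∈ s, f i ∈ t) ∧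
      ∀ i ∈ s, ∀ j ∈ s, f i = f j → i = j := by
    obtain ⟨e⟩ : Nonempty (s ↪ t) :=
      Function.Embedding.nonempty_of_card_le (by simpa using hcard)
    refine ⟨fun i => if hi : i ∈ s then e ⟨i, hi⟩ else i, fun i hi => ?_, fun i hi j hj hij => ?_⟩
    · simp [hi]
    · simp only [hi, hj, dif_pos] at hij
      exact congrArg Subtype.val (e.injective (Subtype.ext hij))
  -- An entry of `E` is a sum of two terms, and each is at most half the bound needed for positive
  -- definiteness; this is the reason for the factor `2` in `coupling`.
  let E : Matrix (Fin m) (Fin m) ℝ := Matrix.of fun i j =>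
    (if i ∈ s ∧ j = f i then coupling i else 0) + if j ∈ s ∧ i = f j then coupling j else 0
  have hE : E.transpose = E := by
    ext i j
    simp only [E, Matrix.transpose_apply, Matrix.of_apply]
    exact add_comm _ _
  have hEne : ∀ i j, E i j ≠ 0 → 𝒢.Adj i j ∧ ¬ vle 𝒢 i j ∧ ¬ vle 𝒢 j i := by
    intro i j h
    by_cases h1 : i ∈ s ∧ j = f i
    · exact hst i h1.1 j (h1.2 ▸ hft i h1.1)
    · by_cases h2 : j ∈ s ∧ i = f j
      · obtain ⟨h3, h4, h5⟩ := hst j h2.1 i (h2.2 ▸ hft j h2.1)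
        exact ⟨h3.symm, h5, h4⟩
      · simp [E, h1, h2] at h
  have hEb : ∀ i j, |E i j| ≤ 1 / (m + 1) := by
    intro i j
    have hterm : ∀ (c : Prop) [Decidable c] (k : Fin m),
        |if c then coupling k else 0| ≤ 1 / ((m : ℝ) + 1) / 2 := by
      intro c _ k
      split_ifs
      · rw [abs_of_pos (coupling_pos k)]
        exact coupling_le k
      · rw [abs_zero]
        positivity
    refine (abs_add_le _ _).trans ?_
    linarith [hterm (i ∈ s ∧ j = f i) i, hterm (j ∈ s ∧ i = f j) j]
  have hoff : ∀ i j, i ≠ j → (1 + E) i j = E i j := fun i j hij => by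
    rw [Matrix.add_apply, Matrix.one_apply_ne hij, zero_add]
  refine ⟨1 + E, ⟨posDef_one_add hE hEb, fun i j hij hadj => ?_⟩,
    ⟨fun i => ?_, fun i j hij h => ?_⟩, f, hft, hf, fun i hi k hk => ?_⟩
  · rw [hoff i j hij]
    by_contra h
    exact hadj (hEne i j h).1
  · rw [Matrix.add_apply, Matrix.one_apply_eq, add_eq_left]
    by_contra h
    exact 𝒢.loopless.irrefl i (hEne i i h).1
  · rw [hoff i j hij]
    by_contra hne
    exact h.elim (hEne i j hne).2.1 (hEne i j hne).2.2
  -- The sets are disjoint, as a common vertex would be adjacent to itself, so only the first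
  -- summand of `E` contributes.
  · have hks : k ∉ s := fun hks => 𝒢.loopless.irrefl k (hst k hks k hk).1
    rw [hoff i k (by rintro rfl; exact hks hi)]
    simp [E, hi, hks]

/-- All vertices of a class have the same closed neighbourhood, so adjacent classes are completely
joined and any matching between them consists of edges. -/
theorem adj_of_isSideNeighbor {i j : Fin m} (h : IsSideNeighbor 𝒢 (toClass 𝒢 i) (toClass 𝒢 j)) :
    𝒢.Adj i j ∧ ¬ vle 𝒢 i j ∧ ¬ vle 𝒢 j i := by
  obtain ⟨⟨hne, k, l, hk, hl, hkl⟩, h1, h2⟩ := h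
  refine ⟨(eq_or_adj_of_vle ((toClass_le_toClass 𝒢 i k).mp hk.ge)
    ((toClass_le_toClass 𝒢 j l).mp hl.ge) (Or.inr hkl)).resolve_left ?_, h1, h2⟩
  rintro rfl
  exact hne rfl

theorem exists_separates {s t : Finset (Fin m)} (hcard : s.card ≤ t.card)
    (hst : ∀ i ∈ s, ∀ j ∈ t, 𝒢.Adj i j ∧ ¬ vle 𝒢 i j ∧ ¬ vle 𝒢 j i) :
    ∃ K ∈ concentrationCone 𝒢, Separates (normalForm 𝒢 K) s t := by
  obtain ⟨K, hK, hdec, f, hft, hf, hKf⟩ := exists_matching_matrix hcard hst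
  refine ⟨K, hK, fun v hv hMv => funext fun i => ?_⟩
  by_cases hi : i ∈ s
  swap
  · exact hv i hi
  have h1 := hMv (f i) (hft i hi)
  rw [Matrix.mulVec, dotProduct, Finset.sum_eq_single i] at h1
  · rw [normalForm_symm hK.1, hdec.normalForm_apply, hKf i hi _ (hft i hi), if_pos rfl] at h1
    exact (mul_eq_zero.mp h1).resolve_left (mul_ne_zero (mul_ne_zero
      (det_upperPart_ne_zero hK.1 i) (coupling_pos i).ne') (det_upperPart_ne_zero hK.1 _))
  · intro j _ hji
    by_cases hj : j ∈ s
    · rw [normalForm_symm hK.1, hdec.normalForm_apply, hKf j hj _ (hft i hi),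
        if_neg fun h => hji (hf j hj i hi h.symm)]
      ring
    · rw [hv j hj, mul_zero]
  · simp

/-- For a matching of `a` into `b`, the operator through `b` is diagonal on `a` with eigenvalues
proportional to the squared weights, which are distinct. -/
theorem exists_det_krylovGram_ne_zero {a b : VertexClass 𝒢} (hab : IsSideNeighbor 𝒢 a b)
    (hcard : (classFinset 𝒢 a).card ≤ (classFinset 𝒢 b).card) :
    ∃ K ∈ concentrationCone 𝒢, (krylovGram (toClass 𝒢) (normalForm 𝒢 K) a b).det ≠ 0 := by
  obtain ⟨K, hK, hdec, f, hft, hf, hKf⟩ := exists_matching_matrix hcard fun i hi j hj =>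
    adj_of_isSideNeighbor (by rwa [mem_classFinset.mp hi, mem_classFinset.mp hj])
  have hKt : ∀ i k, K k i = K i k := fun i k =>
    congrFun (congrFun (transpose_eq_of_posDef hK.1) i) k
  have hδ := (posDef_blockPart (cls := toClass 𝒢) (posDef_normalForm (𝒢 := 𝒢) hK.1)).det_pos.ne'
  refine ⟨K, hK, det_krylovGram_ne_zero (σ := fun i =>
    (blockPart (toClass 𝒢) (normalForm 𝒢 K)).det ^ 2 * coupling i ^ 2) ?_
    (hdec.crossOp_eq hK.1 fun i j hi hj => ?_)⟩
  · intro i j hij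
    have h1 := mul_left_cancel₀ (pow_ne_zero 2 hδ) hij
    exact coupling_injective
      ((sq_eq_sq₀ (coupling_pos i).le (coupling_pos j).le).mp h1)
  · rw [← mem_classFinset] at hi hj
    rw [Finset.sum_eq_single (f i)]
    · rw [if_pos (mem_classFinset.mp (hft i hi)), hKt j, hKf i hi _ (hft i hi),
        hKf j hj _ (hft i hi), if_pos rfl]
      by_cases hij : i = j
      · rw [if_pos hij, hij, if_pos rfl, sq]
      · rw [if_neg hij, if_neg fun h => hij (hf i hi j hj h), mul_zero]
    · intro k _ hk
      split_ifs with hkb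
      · rw [hKf i hi k (mem_classFinset.mpr hkb), if_neg hk, zero_mul]
      · rfl
    · simp

/-! ### Genericity of the conditions. -/

theorem holdsGenerically_separates {s t : Finset (Fin m)} (hcard : s.card ≤ t.card)
    (hst : ∀ i ∈ s, ∀ j ∈ t, 𝒢.Adj i j ∧ ¬ vle 𝒢 i j ∧ ¬ vle 𝒢 j i) :
    HoldsGenerically 𝒢 fun K => Separates (normalForm 𝒢 K) s t := by
  have hiff : ∀ K ∈ concentrationCone 𝒢, Separates (normalForm 𝒢 K) s t ↔ _ := fun K hK =>
    separates_iff_det_ne_zero (transpose_eq_of_posDef (posDef_normalForm hK.1)) s t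
  obtain ⟨K, hK, hsep⟩ := exists_separates hcard hst
  exact .of_isPolyFun (isPolyFun_det_separationMatrix s t) ⟨K, hK, (hiff K hK).mp hsep⟩
    fun K hK => (hiff K hK).mpr

theorem holdsGenerically_isSufficientlyGeneral (𝒢 : SimpleGraph (Fin m)) :
    HoldsGenerically 𝒢 (IsSufficientlyGeneral 𝒢) := by
  have h1 : HoldsGenerically 𝒢 fun K => ∀ a b, IsSideNeighbor 𝒢 a b →
      (classFinset 𝒢 a).card ≤ (classFinset 𝒢 b).card →
      (krylovGram (toClass 𝒢) (normalForm 𝒢 K) a b).det ≠ 0 :=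
    .all fun a => .all fun b => .imp fun hab => .imp fun hcard =>
      .of_isPolyFun (isPolyFun_det_krylovGram a b) (exists_det_krylovGram_ne_zero hab hcard)
        fun _ _ h => h
  have h2 : HoldsGenerically 𝒢 fun K => ∀ a, (sideFinset 𝒢 a).card ≤ (classFinset 𝒢 a).card →
      Separates (normalForm 𝒢 K) (sideFinset 𝒢 a) (classFinset 𝒢 a) :=
    .all fun a => .imp fun hcard => holdsGenerically_separates hcard fun i hi j hj =>
      adj_of_isSideNeighbor (by
        rw [mem_classFinset.mp hj]
        exact (mem_sideFinset.mp hi).symm)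
  have h3 : HoldsGenerically 𝒢 fun K => ∀ a, (classFinset 𝒢 a).card ≤ (sideFinset 𝒢 a).card →
      Separates (normalForm 𝒢 K) (classFinset 𝒢 a) (sideFinset 𝒢 a) :=
    .all fun a => .imp fun hcard => holdsGenerically_separates hcard fun i hi j hj =>
      adj_of_isSideNeighbor (by
        rw [mem_classFinset.mp hi]
        exact mem_sideFinset.mp hj)
  exact (h1.and (h2.and h3)).mono fun K _ h =>
    ⟨fun a b hab hcard => cyclic_of_det_krylovGram_ne_zero (h.1 a b hab hcard), h.2.1, h.2.2⟩

end Witness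

end GGM

theorem mainTheorem6 (m : ℕ) (𝒢 : SimpleGraph (Fin m)) :
    GGM.HoldsGenerically 𝒢 (fun K =>
      GGM.lieDim (GGM.G0Stabilizer 𝒢 K) =
          ∑ a : GGM.VertexClass 𝒢, (GGM.nClass 𝒢 a).choose 2 ∧
      ∃ φ : ((a : GGM.VertexClass 𝒢) →
          Matrix.specialOrthogonalGroup (Fin (GGM.nClass 𝒢 a)) ℝ) →* GL (Fin m) ℝ,
        Topology.IsEmbedding φ ∧
        Set.range φ = GGM.identityComponent (GGM.G0Stabilizer 𝒢 K) ∧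
        Set.range φ = GGM.zariskiIdentityComponent (GGM.G0Stabilizer 𝒢 K)) := by
  exact (GGM.holdsGenerically_isSufficientlyGeneral 𝒢).mono fun K hK hg =>
    GGM.stabilizer_of_isSufficientlyGeneral hK hg
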